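/- Let $\varphi$ be a monotone CNF in variables $x_1,\dots,x_n$, regarded as a finite set of clauses (each a set of variables), and let $\|\varphi\|$ be its length, i.e. its number of literal occurrences. $\varphi$ is prime if each of its clauses is a prime implicate of the function $f$ it represents. For an ordering $y_1,\dots,y_n$ of the variables let $\varphi_i$ be the CNF obtained from $\varphi$ by fixing $y_j=1$ for all $j\ge i+1$ (clauses containing a fixed variable disappear), and let $\Delta^i$ be the set of clauses of $\varphi_i$ that are not in $\varphi_{i-1}$. $\varphi$ is $k$-degenerate if for some ordering of the variables $|\Delta^i|\le k$ for all $i=1,\dots,n$. Problem Dualization: given the prime CNF $\varphi$ of a monotone Boolean function $f$, output the clauses of the prime CNF of the dual function $f^d(x)=\overline{f(\overline{x})}$ (equivalently, the prime implicants of $f$), each exactly once. Theorem. For every constant $k\ge 1$ there are an algorithm (a program for a unit-cost random access machine whose only arithmetic is successor and predecessor) and a constant $C$, both depending on $k$ only, such that on every $k$-degenerate prime monotone CNF $\varphi$ in which all of its $n$ variables occur, given as a list of its clauses in arbitrary order, the algorithm solves Dualization with delay at most $C\cdot(\|\varphi\|\cdot n^{k+1}+1)$: at most that many steps pass before the first clause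 is output, between the outputs of two consecutive clauses, and between the last output and the halt (between the start and the halt if there is no output). (The summand $1$ matters only for the constant CNFs, $n=0$.) Hence Dualization for $k$-degenerate CNFs is solvable with $O(\|\varphi\|\cdot n^{k+1})$ polynomial delay. -/

import Mathlib

namespace Dualization

/-! ### Boolean functions, clauses, monotone CNFs -/

/-- Boolean functions of `n` variables, ordered pointwise (`false ≤ true`). -/
abbrev BoolFn (n : ℕ) := (Fin n → Bool) → Bool

/-- The function represented by the clause with positive literals `P` and negative literals `N`. -/
def clauseFn {n : ℕ} (P N : Finset (Fin n)) : BoolFn n :=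
  fun v => decide ((∃ i ∈ P, v i = true) ∨ (∃ i ∈ N, v i = false))

/-- The monotone clause `c` (the disjunction of the variables in `c`) is a prime implicate of `f`:
it is an implicate, and no clause (monotone or not, with at most one of `xᵢ`, `¬ xᵢ` for
each `i`) that is an implicate of `f` is strictly smaller. -/
def IsPrimeImplicate {n : ℕ} (f : BoolFn n) (c : Finset (Fin n)) : Prop :=
  f ≤ clauseFn c ∅ ∧
    ∀ P N : Finset (Fin n), Disjoint P N → f ≤ clauseFn P N → ¬ clauseFn P N < clauseFn c ∅

/-- A monotone CNF, as a finite set of monotone clauses, each clause a finite set of variables. -/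
abbrev MonotoneCNF (n : ℕ) := Finset (Finset (Fin n))

/-- The function represented by a monotone CNF. -/
def cnfFn {n : ℕ} (φ : MonotoneCNF n) : BoolFn n :=
  fun v => decide (∀ c ∈ φ, clauseFn c ∅ v = true)

/-- `φ` is the prime CNF of `f`: it represents `f`, and its clauses are exactly the prime implicates
of `f`. (All prime implicates of a monotone `f` are monotone.) -/
def IsPrimeCNFOf {n : ℕ} (φ : MonotoneCNF n) (f : BoolFn n) : Prop :=
  cnfFn φ = f ∧ ∀ c : Finset (Fin n), c ∈ φ ↔ IsPrimeImplicate f c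

/-- `φ` is prime: all its clauses are prime implicates of the function it represents. -/
def IsPrime {n : ℕ} (φ : MonotoneCNF n) : Prop := ∀ c ∈ φ, IsPrimeImplicate (cnfFn φ) c

/-- The dual function `v ↦ ¬ f (¬ v)`. -/
def dual {n : ℕ} (f : BoolFn n) : BoolFn n := fun v => !f (fun i => !v i)

/-- The length of `φ`: its number of literal occurrences. -/
def length {n : ℕ} (φ : MonotoneCNF n) : ℕ := ∑ c ∈ φ, c.card

/-- Every one of the `n` variables occurs in `φ`. -/
def AllOccur {n : ℕ} (φ : MonotoneCNF n) : Prop := ∀ v : Fin n, ∃ c ∈ φ, v ∈ c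

/-! ### Degeneracy

A variable ordering is a permutation `x` of `Fin n`; since positions are counted from `0`,
the variables in order are `x 0, …, x (n - 1)`. -/

/-- The CNF obtained from `φ` by fixing to `1` all variables but the first `i` ones
in the ordering `x`: the clauses containing a fixed variable disappear. -/
def fixTail {n : ℕ} (φ : MonotoneCNF n) (x : Equiv.Perm (Fin n)) (i : ℕ) : MonotoneCNF n :=
  φ.filter (fun c => ∀ j : Fin n, i ≤ (j : ℕ) → x j ∉ c)

/-- The clauses that belong to the CNF on the first `i + 1` variables but not to the CNF on
the first `i` variables. -/
def Delta {n : ℕ} (φ : MonotoneCNF n) (x : Equiv.Perm (Fin n)) (i : Fin n) : MonotoneCNF n :=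
  fixTail φ x ((i : ℕ) + 1) \ fixTail φ x (i : ℕ)

/-- `φ` is `k`-degenerate. -/
def IsDegenerate {n : ℕ} (k : ℕ) (φ : MonotoneCNF n) : Prop :=
  ∃ x : Equiv.Perm (Fin n), ∀ i : Fin n, (Delta φ x i).card ≤ k

/-! ### Machine model

Structured programs for a unit-cost random access machine whose only arithmetic is successor and
predecessor. The memory consists of arrays of natural numbers `σ a 0, σ a 1, …`, one for each
name `a`; a program is a finite text and mentions finitely many names. As numbers grow by at most
a constant in each step, they have `O(log (N + t))` bits after `t` steps on an input of
length and entries at most `N`. -/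

/-- Memory contents: `σ a i` is the entry number `i` of the array `a`. -/
abbrev Memory := ℕ → ℕ → ℕ

inductive Expr : Type
  | const (c : ℕ) : Expr
  /-- `get a e` reads the entry of the array `a` whose index is the value of `e`. -/
  | get (a : ℕ) (e : Expr) : Expr
  | succ (e : Expr) : Expr
  | pred (e : Expr) : Expr

def Expr.eval (σ : Memory) : Expr → ℕ
  | .const c => c
  | .get a e => σ a (e.eval σ)
  | .succ e => e.eval σ + 1
  | .pred e => e.eval σ - 1

inductive Test : Type
  | lt (e₁ e₂ : Expr) : Test
  | eq (e₁ e₂ : Expr) : Test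
  | not (b : Test) : Test
  | and (b₁ b₂ : Test) : Test

def Test.eval (σ : Memory) : Test → Bool
  | .lt e₁ e₂ => decide (e₁.eval σ < e₂.eval σ)
  | .eq e₁ e₂ => decide (e₁.eval σ = e₂.eval σ)
  | .not b => !b.eval σ
  | .and b₁ b₂ => b₁.eval σ && b₂.eval σ

inductive Program : Type
  | skip : Program
  /-- `a[i] := e` -/
  | assign (a : ℕ) (i e : Expr) : Program
  | seq (p q : Program) : Program
  | ite (b : Test) (p q : Program) : Program
  | while (b : Test) (p : Program) : Program
  /-- Write the value of `e` on the output. -/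
  | write (e : Expr) : Program
  /-- Declare the current output item complete. -/
  | endItem : Program

/-- What can be observed of one step of a run. Every event takes exactly one unit of time. -/
inductive Event : Type
  | silent : Event
  | symbol (v : ℕ) : Event
  | itemEnd : Event

/-- `Run p σ σ' tr`: the program `p`, started with memory `σ`, halts with memory `σ'`, and
`tr` is its sequence of steps. Each assignment, each evaluation of a test and each output
operation is one step (expressions have constant size in a fixed program). -/
inductive Run : Program → Memory → Memory → List Event → Prop
  | skip (σ : Memory) : Run .skip σ σ [.silent]
  | assign (σ : Memory) (a : ℕ) (i e : Expr) :
      Run (.assign a i e) σ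
        (Function.update σ a (Function.update (σ a) (i.eval σ) (e.eval σ))) [.silent]
  | seq {p q : Program} {σ σ' σ'' : Memory} {tr tr' : List Event} :
      Run p σ σ' tr → Run q σ' σ'' tr' → Run (.seq p q) σ σ'' (tr ++ tr')
  | ite_true {b : Test} {p q : Program} {σ σ' : Memory} {tr : List Event} :
      b.eval σ = true → Run p σ σ' tr → Run (.ite b p q) σ σ' (.silent :: tr)
  | ite_false {b : Test} {p q : Program} {σ σ' : Memory} {tr : List Event} :
      b.eval σ = false → Run q σ σ' tr → Run (.ite b p q) σ σ' (.silent :: tr)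
  | while_true {b : Test} {p : Program} {σ σ' σ'' : Memory} {tr tr' : List Event} :
      b.eval σ = true → Run p σ σ' tr → Run (.while b p) σ' σ'' tr' →
        Run (.while b p) σ σ'' (.silent :: (tr ++ tr'))
  | while_false {b : Test} {p : Program} {σ : Memory} :
      b.eval σ = false → Run (.while b p) σ σ [.silent]
  | write (σ : Memory) (e : Expr) : Run (.write e) σ σ [.symbol (e.eval σ)]
  | endItem (σ : Memory) : Run .endItem σ σ [.itemEnd]

/-- The memory at the start: the input word in array `0`, zeros elsewhere. -/
def initial (w : List ℕ) : Memory := fun a i => if a = 0 then w.getD i 0 else 0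

/-- The sequence of numbers written during a sequence of steps. -/
def symbols (tr : List Event) : List ℕ :=
  tr.filterMap (fun
    | .symbol v => some v
    | _ => none)

/-- The steps `tr` of a halting run output exactly the items `items`, in this order, with delay at
most `D`: at most `D` steps pass until the first item is complete, from the completion of an item
to the completion of the next one, and from the completion of the last item
(from the start, if there is none) until the machine halts. -/
def OutputsWithDelay (D : ℕ) (tr : List Event) (items : List (List ℕ)) : Prop :=
  ∃ (blocks : List (List Event)) (rest : List Event),
    tr = (blocks.map (fun b => b ++ [Event.itemEnd])).flatten ++ rest ∧
    (∀ b ∈ blocks, Event.itemEnd ∉ b ∧ b.length + 1 ≤ D) ∧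
    (Event.itemEnd ∉ rest ∧ rest.length ≤ D) ∧
    blocks.map symbols = items ∧ symbols rest = []

/-! ### The problem Dualization -/

/-- The list `L` lists the clauses of `φ`, each once, in some order, and each clause is given as the
list of its variables, each once, in some order. -/
def Lists {n : ℕ} (L : List (List (Fin n))) (φ : MonotoneCNF n) : Prop :=
  (∀ l ∈ L, l.Nodup) ∧ (L.map List.toFinset).Nodup ∧ (L.map List.toFinset).toFinset = φ

/-- The input word for a listed CNF: the number of variables, the number of clauses, and then for
each clause its number of variables followed by these variables (numbered from `0`). -/
def encode {n : ℕ} (L : List (List (Fin n))) : List ℕ :=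
  n :: L.length :: L.flatMap (fun l => l.length :: l.map Fin.val)

/-- On the input `φ`, in whatever order it is listed, the program `p` outputs one by one, without
repetition, the clauses of the prime CNF of the dual of the function represented by `φ`, and
halts; the delay is at most `D`. -/
def DualizesWithDelay {n : ℕ} (p : Program) (φ : MonotoneCNF n) (D : ℕ) : Prop :=
  ∀ L : List (List (Fin n)), Lists L φ →
    ∃ (σ : Memory) (tr : List Event) (ψ : MonotoneCNF n) (out : List (List (Fin n))),
      Run p (initial (encode L)) σ tr ∧
      IsPrimeCNFOf ψ (dual (cnfFn φ)) ∧ Lists out ψ ∧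
      OutputsWithDelay D tr (out.map (fun l => l.map Fin.val))

end Dualization

/-!
Let `Δ i` be the layers of the CNF in a degenerate ordering. Every layer has at most `k` clauses,
which share a variable that occurs in no lower layer; the layers are found by repeatedly removing
a variable that occurs in at least one and at most `k` of the remaining clauses. The clauses of
the dual are the minimal transversals of the hypergraph of all clauses. They are the leaves of a
tree whose `i`-th level consists of the minimal transversals of the first `i` layers: inside such
a set `T'` for `i + 1` layers, the transversals of the first `i` layers have a smallest one `T` in
the colexicographic order, which is minimal and is taken as the parent of `T'`.

Each element of `T' \ T` has a private clause that `T` does not hit and that therefore lies in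
the layer `i`, so that `T' \ T` has at most `k` elements. Hence all children of `T` are found by
testing the `O(n ^ k)` sets with at most `k` elements, each in time linear in the length of the CNF.
Moreover, every node has a child: add nothing if `T` hits the new layer, and the variable shared
by its clauses otherwise. So depth-first search has no dead ends, and it reaches the next leaf
after it has tried `O(n ^ k)` sets on each of at most `n` levels on the way up and on the way down.
-/

namespace Dualization

/-! ### Reasoning about programs -/

/-- The memory `σ` after storing `v` in entry `i` of the array `a`. -/
def store (σ : Memory) (a i v : ℕ) : Memory := Function.update σ a (Function.update (σ a) i v)

@[simp]
theorem store_self (σ : Memory) (a i v : ℕ) : store σ a i v a = Function.update (σ a) i v :=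
  Function.update_self ..

@[simp]
theorem store_of_ne {a b : ℕ} (h : b ≠ a) (σ : Memory) (i v : ℕ) : store σ a i v b = σ b :=
  Function.update_of_ne h ..

/-- The arrays an expression reads. -/
def Expr.arrays : Expr → List ℕ
  | .const _ => []
  | .get a e => a :: e.arrays
  | .succ e => e.arrays
  | .pred e => e.arrays

theorem Expr.eval_congr {e : Expr} {σ σ' : Memory} (h : ∀ a ∈ e.arrays, σ' a = σ a) :
    e.eval σ' = e.eval σ := by
  induction e with
  | const c => rfl
  | get a e ih =>
    simp only [arrays, List.mem_cons, forall_eq_or_imp] at h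
    simp only [eval, ih h.2, h.1]
  | succ e ih => simp only [eval, ih h]
  | pred e ih => simp only [eval, ih h]

/-- Whether `p` writes to the array `a`. -/
def Program.touches : Program → ℕ → Bool
  | .assign b _ _, a => a == b
  | .seq p q, a => p.touches a || q.touches a
  | .ite _ p q, a => p.touches a || q.touches a
  | .while _ p, a => p.touches a
  | _, _ => false

/-- Whether `p` writes to none of the arrays in the list. -/
def Program.preserves (p : Program) (as : List ℕ) : Bool := as.all fun a => !p.touches a

/-- `σ'` and `σ` agree on all arrays that `p` does not write to. -/
abbrev Frame (p : Program) (σ σ' : Memory) : Prop := ∀ a, p.touches a = false → σ' a = σ a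

theorem Program.touches_of_preserves {p : Program} {as : List ℕ} {a : ℕ}
    (h : p.preserves as = true) (ha : a ∈ as) : p.touches a = false := by
  simpa using List.all_eq_true.1 h a ha

theorem Frame.eval_eq {p : Program} {σ σ' : Memory} (h : Frame p σ σ') {e : Expr}
    (he : p.preserves e.arrays = true) : e.eval σ' = e.eval σ :=
  Expr.eval_congr fun _ ha => h _ (Program.touches_of_preserves he ha)

theorem Frame.seq {p q : Program} {σ σ' σ'' : Memory} (h : Frame p σ σ') (h' : Frame q σ' σ'') :
    Frame (.seq p q) σ σ'' := by
  intro a ha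
  simp only [Program.touches, Bool.or_eq_false_iff] at ha
  rw [h' a ha.2, h a ha.1]

theorem Run.frame {p : Program} {σ σ' : Memory} {tr : List Event} (h : Run p σ σ' tr) :
    Frame p σ σ' := by
  induction h with
  | skip | while_false | write | endItem => exact fun _ _ => rfl
  | assign σ b i e =>
    intro a ha
    exact Function.update_of_ne (by simpa [Program.touches] using ha) ..
  | seq _ _ ih ih' => exact ih.seq ih'
  | ite_true _ _ ih =>
    intro a ha
    simp only [Program.touches, Bool.or_eq_false_iff] at ha
    exact ih a ha.1
  | ite_false _ _ ih =>
    intro a ha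
    simp only [Program.touches, Bool.or_eq_false_iff] at ha
    exact ih a ha.2
  | while_true _ _ _ ih ih' => exact fun a ha => (ih' a ha).trans (ih a ha)

@[simp]
theorem symbols_append (tr tr' : List Event) : symbols (tr ++ tr') = symbols tr ++ symbols tr' :=
  List.filterMap_append ..

@[simp]
theorem symbols_silent_cons (tr : List Event) : symbols (.silent :: tr) = symbols tr := rfl

/-- Started with memory `σ`, the program `p` halts after at most `t` steps; it writes the word `w`
without completing an output item, and the final memory satisfies `Q`. -/
def Exec (p : Program) (σ : Memory) (t : ℕ) (w : List ℕ) (Q : Memory → Prop) : Prop :=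
  ∃ (σ' : Memory) (tr : List Event),
    Run p σ σ' tr ∧ Event.itemEnd ∉ tr ∧ symbols tr = w ∧ tr.length ≤ t ∧ Q σ'

namespace Exec

variable {p q : Program} {b : Test} {σ : Memory} {t t' : ℕ} {w w' : List ℕ} {Q R : Memory → Prop}

theorem mono (h : Exec p σ t w R) (ht : t ≤ t') (hQ : ∀ σ', R σ' → Frame p σ σ' → Q σ') :
    Exec p σ t' w Q := by
  obtain ⟨σ', tr, hrun, hend, hsym, hlen, hR⟩ := h
  exact ⟨σ', tr, hrun, hend, hsym, hlen.trans ht, hQ σ' hR hrun.frame⟩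

theorem exists_eq (h : Exec p σ t w Q) : ∃ σ', Q σ' ∧ Exec p σ t w (· = σ') := by
  obtain ⟨σ', tr, hrun, hend, hsym, hlen, hQ⟩ := h
  exact ⟨σ', hQ, σ', tr, hrun, hend, hsym, hlen, rfl⟩

theorem skip (hQ : Q σ) : Exec .skip σ 1 [] Q :=
  ⟨σ, _, .skip σ, by simp, rfl, by simp, hQ⟩

theorem assign {a : ℕ} {i e : Expr} (hQ : Q (store σ a (i.eval σ) (e.eval σ))) :
    Exec (.assign a i e) σ 1 [] Q :=
  ⟨_, _, .assign σ a i e, by simp, rfl, by simp, hQ⟩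

theorem write {e : Expr} (hQ : Q σ) : Exec (.write e) σ 1 [e.eval σ] Q :=
  ⟨σ, _, .write σ e, by simp, rfl, by simp, hQ⟩

theorem seq (h : Exec p σ t w R)
    (h' : ∀ σ', R σ' → Frame p σ σ' → Exec q σ' t' w' Q) :
    Exec (.seq p q) σ (t + t') (w ++ w') Q := by
  obtain ⟨σ', tr, hrun, hend, hsym, hlen, hR⟩ := h
  obtain ⟨σ'', tr', hrun', hend', hsym', hlen', hQ⟩ := h' σ' hR hrun.frame
  refine ⟨σ'', tr ++ tr', hrun.seq hrun', by simp [hend, hend'], by simp [hsym, hsym'], ?_, hQ⟩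
  rw [List.length_append]
  omega

theorem ite (h : b.eval σ = true → Exec p σ t w Q) (h' : b.eval σ = false → Exec q σ t w Q) :
    Exec (.ite b p q) σ (t + 1) w Q := by
  cases hb : b.eval σ with
  | true =>
    obtain ⟨σ', tr, hrun, hend, hsym, hlen, hQ⟩ := h hb
    exact ⟨σ', _, hrun.ite_true hb, by simpa using hend, hsym, by simpa using hlen, hQ⟩
  | false =>
    obtain ⟨σ', tr, hrun, hend, hsym, hlen, hQ⟩ := h' hb
    exact ⟨σ', _, hrun.ite_false hb, by simpa using hend, hsym, by simpa using hlen, hQ⟩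

theorem while_false (hb : b.eval σ = false) (hQ : Q σ) : Exec (.while b p) σ 1 [] Q :=
  ⟨σ, _, .while_false hb, by simp, rfl, by simp, hQ⟩

theorem while_true (hb : b.eval σ = true)
    (h : Exec p σ t w fun σ' => Exec (.while b p) σ' t' w' Q) :
    Exec (.while b p) σ (t + t' + 1) (w ++ w') Q := by
  obtain ⟨σ', tr, hrun, hend, hsym, hlen, σ'', tr', hrun', hend', hsym', hlen', hQ⟩ := h
  refine ⟨σ'', _, hrun.while_true hb hrun', by simp [hend, hend'], by simp [hsym, hsym'], ?_, hQ⟩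
  simp only [List.length_cons, List.length_append]
  omega

theorem while_of_measure {I : ℕ → Memory → Prop}
    (hstep : ∀ r σ, I r σ → b.eval σ = true → Exec p σ t [] fun σ' => ∃ r' < r, I r' σ')
    {r : ℕ} (hI : I r σ) :
    Exec (.while b p) σ (r * (t + 1) + 1) [] fun σ' => b.eval σ' = false ∧ ∃ r', I r' σ' := by
  induction r using Nat.strong_induction_on generalizing σ with
  | _ r ih =>
    cases hb : b.eval σ with
    | false => exact (while_false hb ⟨hb, r, hI⟩).mono (by omega) fun _ h _ => h
    | true =>
      have hbody : Exec p σ t [] fun σ' => Exec (.while b p) σ' ((r - 1) * (t + 1) + 1) []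
          fun σ' => b.eval σ' = false ∧ ∃ r', I r' σ' := by
        refine (hstep r σ hI hb).mono le_rfl ?_
        rintro σ' ⟨r', hr, hI'⟩ -
        have : r' * (t + 1) ≤ (r - 1) * (t + 1) := Nat.mul_le_mul_right _ (by omega)
        exact (ih r' hr hI').mono (by omega) fun _ h _ => h
      obtain ⟨s, rfl⟩ : ∃ s, r = s + 1 := by
        obtain ⟨_, _, _, _, _, _, r', hr, _⟩ := hstep r σ hI hb
        exact ⟨r - 1, by omega⟩
      refine (while_true hb hbody).mono ?_ fun _ h _ => h
      rw [Nat.add_sub_cancel, add_one_mul]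
      omega

end Exec

/-- Whether a program has neither loops nor output. -/
def Program.straight : Program → Bool
  | .skip => true
  | .assign _ _ _ => true
  | .seq p q => p.straight && q.straight
  | .ite _ p q => p.straight && q.straight
  | _ => false

/-- The memory transformation computed by a straight program. -/
def Program.eff : Program → Memory → Memory
  | .assign a i e, σ => store σ a (i.eval σ) (e.eval σ)
  | .seq p q, σ => q.eff (p.eff σ)
  | .ite b p q, σ => if b.eval σ = true then p.eff σ else q.eff σ
  | _, σ => σ

/-- The largest number of steps of a straight program. -/
def Program.cost : Program → ℕ
  | .seq p q => p.cost + q.cost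
  | .ite _ p q => max p.cost q.cost + 1
  | _ => 1

namespace Exec

variable {p q : Program} {σ : Memory} {t : ℕ} {w : List ℕ} {Q : Memory → Prop}

theorem of_eff (hp : p.straight = true) (hQ : Q (p.eff σ)) : Exec p σ p.cost [] Q := by
  induction p generalizing σ Q with
  | skip => exact skip hQ
  | assign a i e => exact assign hQ
  | seq p q ihp ihq =>
    simp only [Program.straight, Bool.and_eq_true] at hp
    refine (ihp (Q := fun σ' => σ' = p.eff σ) hp.1 rfl).seq fun σ' h _ => ?_
    exact ihq hp.2 (h ▸ hQ)
  | ite b p q ihp ihq =>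
    simp only [Program.straight, Bool.and_eq_true] at hp
    refine ite (fun hb => ?_) (fun hb => ?_)
    · exact (ihp hp.1 (by simpa [Program.eff, hb] using hQ)).mono (le_max_left _ _) fun _ h _ => h
    · exact (ihq hp.2 (by simpa [Program.eff, hb] using hQ)).mono (le_max_right _ _) fun _ h _ => h
  | _ => simp [Program.straight] at hp

theorem eff_seq (hp : p.straight = true) (h : Exec q (p.eff σ) t w Q) :
    Exec (.seq p q) σ (p.cost + t) w Q :=
  (of_eff (Q := fun σ' => σ' = p.eff σ) hp rfl).seq fun _ hσ _ => hσ ▸ h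

end Exec

theorem Program.frame_eff {p : Program} (hp : p.straight = true) (σ : Memory) :
    Frame p σ (p.eff σ) :=
  let ⟨_, _, hrun, _, _, _, h⟩ := Exec.of_eff (Q := fun σ' => σ' = p.eff σ) hp rfl
  h ▸ hrun.frame

/-- The scalar stored in entry `0` of the array `a`. -/
def scal (a : ℕ) : Expr := .get a (.const 0)

@[simp]
theorem eval_scal (σ : Memory) (a : ℕ) : (scal a).eval σ = σ a 0 := rfl

/-- `for x := 0, …, e - 1 do p`. -/
def forLoop (x : ℕ) (e : Expr) (p : Program) : Program :=
  .seq (.assign x (.const 0) (.const 0))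
    (.while (.lt (scal x) e) (.seq p (.assign x (.const 0) (.succ (scal x)))))

section forLoop

variable {x : ℕ} {e : Expr} {p : Program} {σ : Memory} {N t : ℕ} {I : ℕ → Memory → Prop}

theorem touches_forLoop {a : ℕ} :
    (forLoop x e p).touches a = false ↔ a ≠ x ∧ p.touches a = false := by
  simp +contextual [forLoop, Program.touches]

/-- Since `I` is insensitive to the loop variable (`hI`), it need not be restored when the
loop variable is incremented. -/
theorem Exec.forLoop_output {w : ℕ → List ℕ} (hN : e.eval σ = N) (h0 : I 0 σ)
    (hstep : ∀ j < N, ∀ σ', I j σ' → σ' x 0 = j → Frame (forLoop x e p) σ σ' →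
      Exec p σ' t (w j) (I (j + 1)))
    (hI : ∀ j σ' v, I j σ' → I j (store σ' x 0 v))
    (he : (forLoop x e p).preserves e.arrays = true) (hx : p.touches x = false) :
    Exec (forLoop x e p) σ (N * (t + 2) + 2) ((List.range N).flatMap w) (I N) := by
  have hloop : ∀ r j σ', r + j = N → I j σ' → σ' x 0 = j → Frame (forLoop x e p) σ σ' →
      Exec (.while (.lt (scal x) e) (.seq p (.assign x (.const 0) (.succ (scal x))))) σ'
        (r * (t + 2) + 1) ((List.range' j r).flatMap w) (I N) := by
    intro r
    induction r with
    | zero =>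
      rintro j σ' hj hIj hxj hfr
      refine (while_false ?_ ((by omega : j = N) ▸ hIj)).mono (by omega) fun _ h _ => h
      simp [Test.eval, hfr.eval_eq he, hN, hxj, ← hj]
    | succ r ih =>
      rintro j σ' hj hIj hxj hfr
      rw [List.range'_succ, List.flatMap_cons]
      refine (while_true (t := t + 1) (t' := r * (t + 2) + 1) ?_ ?_).mono (by linarith)
        fun _ h _ => h
      · simp only [Test.eval, eval_scal, hfr.eval_eq he, hN, hxj, decide_eq_true_eq]
        omega
      refine List.append_nil (w j) ▸ (hstep j (by omega) σ' hIj hxj hfr).seq fun σ'' hI' hfr' => ?_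
      have hx'' : σ'' x 0 = j := by rw [hfr' x hx, hxj]
      refine assign (ih (j + 1) _ (by omega) (hI _ _ _ hI') ?_ ?_)
      · simp [Expr.eval, hx'']
      · intro a ha
        obtain ⟨hax, hap⟩ := touches_forLoop.1 ha
        rw [store_of_ne hax, hfr' a hap, hfr a ha]
  have hinit : Frame (forLoop x e p) σ (store σ x 0 0) := fun a ha =>
    store_of_ne (touches_forLoop.1 ha).1 ..
  refine (eff_seq rfl ?_).mono (t := 1 + (N * (t + 2) + 1)) (by omega) fun _ h _ => h
  rw [List.range_eq_range']
  exact hloop N 0 (store σ x 0 0) (by omega) (hI _ _ _ h0) (by simp) hinit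

theorem Exec.forLoop (hN : e.eval σ = N) (h0 : I 0 σ)
    (hstep : ∀ j < N, ∀ σ', I j σ' → σ' x 0 = j → Frame (forLoop x e p) σ σ' →
      Exec p σ' t [] (I (j + 1)))
    (hI : ∀ j σ' v, I j σ' → I j (store σ' x 0 v) := by exact fun _ _ _ h => h)
    (he : (forLoop x e p).preserves e.arrays = true := by rfl)
    (hx : p.touches x = false := by rfl) :
    Exec (forLoop x e p) σ (N * (t + 2) + 2) [] (I N) :=
  List.flatMap_eq_nil_iff.2 (fun _ _ => rfl) ▸
    forLoop_output (w := fun _ => []) hN h0 hstep hI he hx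

theorem Exec.forLoop_straight (hN : e.eval σ = N) (h0 : I 0 σ)
    (hstep : ∀ j < N, ∀ σ', I j σ' → σ' x 0 = j → Frame (Dualization.forLoop x e p) σ σ' →
      I (j + 1) (p.eff σ'))
    (hI : ∀ j σ' v, I j σ' → I j (store σ' x 0 v) := by exact fun _ _ _ h => h)
    (hp : p.straight = true := by rfl)
    (he : (Dualization.forLoop x e p).preserves e.arrays = true := by rfl)
    (hx : p.touches x = false := by rfl) :
    Exec (Dualization.forLoop x e p) σ (N * (p.cost + 2) + 2) [] (I N) :=
  .forLoop hN h0 (fun j hj σ' h h' hfr => .of_eff hp (hstep j hj σ' h h' hfr)) hI he hx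

end forLoop

/-! ### Enumeration with delay -/

/-- The program `p`, started with memory `σ`, halts and outputs `items` with delay at most `D`, even
if up to `s` silent steps precede the run. -/
def Enumerates (p : Program) (σ : Memory) (s D : ℕ) (items : List (List ℕ)) : Prop :=
  ∃ (σ' : Memory) (tr : List Event), Run p σ σ' tr ∧
    ∀ pre : List Event, Event.itemEnd ∉ pre → symbols pre = [] → pre.length ≤ s →
      OutputsWithDelay D (pre ++ tr) items

namespace Enumerates

variable {p q : Program} {b : Test} {σ : Memory} {s t D : ℕ} {w : List ℕ} {items : List (List ℕ)}

theorem of_exec {Q : Memory → Prop} (h : Exec p σ t [] Q) (hD : s + t ≤ D) :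
    Enumerates p σ s D [] := by
  obtain ⟨σ', tr, hrun, hend, hsym, hlen, -⟩ := h
  refine ⟨σ', tr, hrun, fun pre hpre hsym' hs => ⟨[], pre ++ tr, rfl, by simp, ⟨?_, ?_⟩, rfl, ?_⟩⟩
  · simp [hpre, hend]
  · rw [List.length_append]
    omega
  · simp [hsym, hsym']

theorem seq {R : Memory → Prop} (h : Exec p σ t [] R)
    (h' : ∀ σ', R σ' → Frame p σ σ' → Enumerates q σ' (s + t) D items) :
    Enumerates (.seq p q) σ s D items := by
  obtain ⟨σ', tr, hrun, hend, hsym, hlen, hR⟩ := h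
  obtain ⟨σ'', tr', hrun', hout⟩ := h' σ' hR hrun.frame
  refine ⟨σ'', _, hrun.seq hrun', fun pre hpre hsym' hs => ?_⟩
  rw [← List.append_assoc]
  refine hout _ (by simp [hpre, hend]) (by simp [hsym, hsym']) ?_
  rw [List.length_append]
  omega

theorem ite (h : b.eval σ = true → Enumerates p σ (s + 1) D items)
    (h' : b.eval σ = false → Enumerates q σ (s + 1) D items) :
    Enumerates (.ite b p q) σ s D items := by
  obtain ⟨σ', tr, hrun, hout⟩ : ∃ σ' tr, Run (.ite b p q) σ σ' (.silent :: tr) ∧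
      ∀ pre, Event.itemEnd ∉ pre → symbols pre = [] → pre.length ≤ s + 1 →
        OutputsWithDelay D (pre ++ tr) items := by
    cases hb : b.eval σ with
    | true =>
      obtain ⟨σ', tr, hrun, hout⟩ := h hb
      exact ⟨σ', tr, hrun.ite_true hb, hout⟩
    | false =>
      obtain ⟨σ', tr, hrun, hout⟩ := h' hb
      exact ⟨σ', tr, hrun.ite_false hb, hout⟩
  refine ⟨σ', _, hrun, fun pre hpre hsym hs => ?_⟩
  rw [List.append_cons]
  exact hout _ (by simp [hpre]) (by rw [symbols_append, hsym]; rfl) (by simpa using hs)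

theorem while_cons (hb : b.eval σ = true) {R : Memory → Prop} (hp : Exec p σ t w R)
    (hnext : ∀ σ', R σ' → Frame p σ σ' →
      Enumerates (.seq q (.while b (.seq p (.seq .endItem q)))) σ' 0 D items)
    (hD : s + t + 2 ≤ D) :
    Enumerates (.while b (.seq p (.seq .endItem q))) σ s D (w :: items) := by
  obtain ⟨σ₁, tr, hrun, hend, hsym, hlen, hR⟩ := hp
  obtain ⟨σ₃, _, hrun', hout⟩ := hnext σ₁ hR hrun.frame
  cases hrun' with | seq hq hloop =>
  refine ⟨σ₃, _, .while_true hb (hrun.seq ((Run.endItem σ₁).seq hq)) hloop,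
    fun pre hpre hsym' hs => ?_⟩
  obtain ⟨blocks, rest, htr, hblocks, hrest, hitems, hsymr⟩ := hout [] (by simp) rfl le_rfl
  rw [List.nil_append] at htr
  refine ⟨(pre ++ .silent :: tr) :: blocks, rest, ?_, ?_, hrest, ?_, hsymr⟩
  · simp [htr]
  · simp only [List.forall_mem_cons]
    refine ⟨⟨by simp [hpre, hend], ?_⟩, hblocks⟩
    simp only [List.length_append, List.length_cons]
    omega
  · simp [hitems, hsym, hsym']

theorem while_nil (hb : b.eval σ = false) (hD : s + 1 ≤ D) :
    Enumerates (.while b p) σ s D [] :=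
  of_exec (.while_false hb trivial (Q := fun _ => True)) hD

end Enumerates

/-! ### Minimal transversals of layered hypergraphs -/

section Transversal

variable {ι α : Type*} [DecidableEq α]

/-- `T` meets all edges `E c`, `c ∈ s`, of a hypergraph. -/
def IsTransversal (s : Finset ι) (E : ι → Finset α) (T : Finset α) : Prop :=
  ∀ c ∈ s, (E c ∩ T).Nonempty

/-- `T` is a minimal transversal: minimality is expressed by a private edge for each vertex. -/
structure IsMinTransversal (s : Finset ι) (E : ι → Finset α) (T : Finset α) : Prop where
  isTransversal : IsTransversal s E T
  exists_private : ∀ v ∈ T, ∃ c ∈ s, E c ∩ T = {v}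

/-- The edges in the layers below `i`, where `lv c` is the layer of the edge `c`. -/
def layersBelow (s : Finset ι) (lv : ι → ℕ) (i : ℕ) : Finset ι := {c ∈ s | lv c < i}

variable {s : Finset ι} {E : ι → Finset α} {lv : ι → ℕ} {i k : ℕ} {S T T' : Finset α} {v : α}

@[simp]
theorem mem_layersBelow {c : ι} : c ∈ layersBelow s lv i ↔ c ∈ s ∧ lv c < i :=
  Finset.mem_filter

theorem mem_layersBelow_succ {c : ι} :
    c ∈ layersBelow s lv (i + 1) ↔ c ∈ layersBelow s lv i ∨ c ∈ s ∧ lv c = i := by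
  rw [mem_layersBelow, mem_layersBelow, Nat.lt_succ_iff_lt_or_eq, and_or_left]

theorem IsTransversal.mono (h : IsTransversal s E T) (hT : T ⊆ T') : IsTransversal s E T' :=
  fun c hc => (h c hc).mono (Finset.inter_subset_inter_left hT)

theorem IsMinTransversal.eq_of_subset (hT : IsMinTransversal s E T) (hT' : IsTransversal s E T')
    (h : T' ⊆ T) : T' = T := by
  refine h.antisymm fun v hv => ?_
  obtain ⟨c, hc, hpriv⟩ := hT.exists_private v hv
  obtain ⟨u, hu⟩ := hT' c hc
  have hu' : u ∈ E c ∩ T := Finset.inter_subset_inter_left h hu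
  rw [hpriv, Finset.mem_singleton] at hu'
  exact hu' ▸ (Finset.mem_inter.1 hu).2

theorem IsMinTransversal.subset_biUnion (hT : IsMinTransversal s E T) : T ⊆ s.biUnion E := by
  intro v hv
  obtain ⟨c, hc, hpriv⟩ := hT.exists_private v hv
  have hvc : v ∈ E c ∩ T := hpriv ▸ Finset.mem_singleton_self v
  exact Finset.mem_biUnion.2 ⟨c, hc, (Finset.mem_inter.1 hvc).1⟩

theorem IsMinTransversal.eq_empty (hT : IsMinTransversal ∅ E T) : T = ∅ := by
  simpa using hT.subset_biUnion

theorem isMinTransversal_image {κ : Type*} [DecidableEq ι] {s : Finset κ} {g : κ → ι} :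
    IsMinTransversal (s.image g) E T ↔ IsMinTransversal s (E ∘ g) T := by
  constructor
  · rintro ⟨h₁, h₂⟩
    exact ⟨fun c hc => h₁ _ (Finset.mem_image_of_mem g hc), by simpa using h₂⟩
  · rintro ⟨h₁, h₂⟩
    exact ⟨by simpa [IsTransversal] using h₁, by simpa using h₂⟩

theorem isMinTransversal_map {β : Type*} [DecidableEq β] (f : α ↪ β) :
    IsMinTransversal s (fun c => (E c).map f) (T.map f) ↔ IsMinTransversal s E T := by
  constructor
  · rintro ⟨h₁, h₂⟩
    refine ⟨fun c hc => ?_, fun v hv => ?_⟩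
    · simpa [← Finset.map_inter] using h₁ c hc
    · obtain ⟨c, hc, h⟩ := h₂ (f v) (Finset.mem_map_of_mem f hv)
      exact ⟨c, hc, by simpa [← Finset.map_inter, ← Finset.map_singleton] using h⟩
  · rintro ⟨h₁, h₂⟩
    refine ⟨fun c hc => ?_, ?_⟩
    · simpa [← Finset.map_inter] using h₁ c hc
    · simpa [← Finset.map_inter, ← Finset.map_singleton] using h₂

section LinearOrder

variable {α : Type*} [LinearOrder α] {E : ι → Finset α} {T T₁ T₂ T' S : Finset α}

/-- Every element of `T` has a private edge in which it is the smallest element of `T'`. Among the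
transversals contained in `T'` this determines `T`, as the one that a greedy procedure finds. -/
def IsGreedyIn (s : Finset ι) (E : ι → Finset α) (T T' : Finset α) : Prop :=
  ∀ v ∈ T, ∃ c ∈ s, E c ∩ T = {v} ∧ ∀ u ∈ E c ∩ T', v ≤ u

theorem IsGreedyIn.isMinTransversal (h : IsGreedyIn s E T T') (hT : IsTransversal s E T) :
    IsMinTransversal s E T := by
  refine ⟨hT, fun v hv => ?_⟩
  obtain ⟨c, hc, hpriv, -⟩ := h v hv
  exact ⟨c, hc, hpriv⟩

theorem IsMinTransversal.isGreedyIn (h : IsMinTransversal s E T)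
    (hT' : ∀ c ∈ s, E c ∩ T' = E c ∩ T) : IsGreedyIn s E T T' := by
  intro v hv
  obtain ⟨c, hc, hpriv⟩ := h.exists_private v hv
  exact ⟨c, hc, hpriv, by simp [hT' c hc, hpriv]⟩

theorem IsGreedyIn.unique (h₁ : IsGreedyIn s E T₁ T') (h₂ : IsGreedyIn s E T₂ T')
    (ht₁ : IsTransversal s E T₁) (ht₂ : IsTransversal s E T₂) (hs₁ : T₁ ⊆ T') (hs₂ : T₂ ⊆ T') :
    T₁ = T₂ := by
  by_contra hne
  have hD : (symmDiff T₁ T₂).Nonempty := by simpa [Finset.nonempty_iff_ne_empty] using hne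
  set v := (symmDiff T₁ T₂).max' hD
  have hv : v ∈ symmDiff T₁ T₂ := Finset.max'_mem _ hD
  have hmax : ∀ u ∈ symmDiff T₁ T₂, u ≤ v := fun u hu => Finset.le_max' _ u hu
  clear_value v
  wlog hv₁ : v ∈ T₁ ∧ v ∉ T₂ generalizing T₁ T₂
  · exact this h₂ h₁ ht₂ ht₁ hs₂ hs₁ (Ne.symm hne) (symmDiff_comm T₁ T₂ ▸ hD)
      (symmDiff_comm T₁ T₂ ▸ hv) (symmDiff_comm T₁ T₂ ▸ hmax)
      ((Finset.mem_symmDiff.1 hv).resolve_left hv₁)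
  obtain ⟨c, hc, hpriv, hmin⟩ := h₁ v hv₁.1
  obtain ⟨u, hu⟩ := ht₂ c hc
  rw [Finset.mem_inter] at hu
  have hvu : v ≤ u := hmin u (Finset.mem_inter.2 ⟨hu.1, hs₂ hu.2⟩)
  have huv : u ≠ v := fun h => hv₁.2 (h ▸ hu.2)
  by_cases hu₁ : u ∈ T₁
  · have : u ∈ E c ∩ T₁ := Finset.mem_inter.2 ⟨hu.1, hu₁⟩
    rw [hpriv, Finset.mem_singleton] at this
    exact huv this
  · exact huv ((hmax u (Finset.mem_symmDiff.2 (.inr ⟨hu.2, hu₁⟩))).antisymm hvu)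

theorem IsTransversal.exists_isGreedyIn (h : IsTransversal s E T') :
    ∃ T ⊆ T', IsTransversal s E T ∧ IsGreedyIn s E T T' := by
  classical
  -- the transversal `T ⊆ T'` that is smallest in the colexicographic order
  obtain ⟨T, hT, hmin⟩ := {T ∈ T'.powerset | IsTransversal s E T}.exists_min_image toColex
    ⟨T', by simpa using h⟩
  simp only [Finset.mem_filter, Finset.mem_powerset] at hT hmin
  refine ⟨T, hT.1, hT.2, fun v hv => ?_⟩
  by_contra! hno
  set R := {u ∈ T | v < u} ∪ {u ∈ T' | u < v} with hR
  have hRT : toColex R < toColex T := by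
    refine Finset.Colex.toColex_lt_toColex_iff_exists_forall_lt.2 ⟨v, hv, by simp [hR], ?_⟩
    intro u hu huT
    simp only [hR, Finset.mem_union, Finset.mem_filter] at hu
    exact (hu.resolve_left fun h => huT h.1).2
  refine hRT.not_ge (hmin R ⟨?_, fun c hc => ?_⟩)
  · exact Finset.union_subset ((Finset.filter_subset _ _).trans hT.1) (Finset.filter_subset _ _)
  by_contra hdisj
  have hnot : ∀ u ∈ E c, u ∉ R := fun u hu huR => hdisj ⟨u, Finset.mem_inter.2 ⟨hu, huR⟩⟩
  simp only [hR, Finset.mem_union, Finset.mem_filter, not_or, not_and, not_lt] at hnot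
  have hpriv : E c ∩ T = {v} := by
    refine Finset.eq_singleton_iff_nonempty_unique_mem.2 ⟨hT.2 c hc, fun u hu => ?_⟩
    rw [Finset.mem_inter] at hu
    exact ((hnot u hu.1).1 hu.2).antisymm ((hnot u hu.1).2 (hT.1 hu.2))
  obtain ⟨u, hu, huv⟩ := hno c hc hpriv
  rw [Finset.mem_inter] at hu
  exact ((hnot u hu.1).2 hu.2).not_gt huv

theorem IsTransversal.exists_isMinTransversal (h : IsTransversal s E T') :
    ∃ T ⊆ T', IsMinTransversal s E T :=
  let ⟨T, hTT', hT, hgr⟩ := h.exists_isGreedyIn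
  ⟨T, hTT', hgr.isMinTransversal hT⟩

/-- In the tree whose `i`-th level consists of the minimal transversals of the layers below `i`,
the node `T ∪ S` is a child of the node `T` at level `i`. -/
structure IsChild (s : Finset ι) (E : ι → Finset α) (lv : ι → ℕ) (i : ℕ) (T S : Finset α) :
    Prop where
  disjoint : Disjoint T S
  isMinTransversal : IsMinTransversal (layersBelow s lv (i + 1)) E (T ∪ S)
  isGreedyIn : IsGreedyIn (layersBelow s lv i) E T (T ∪ S)

/-- A decomposition of the edges into layers of at most `k` edges, such that the edges of a layer
have a common vertex that lies in no edge of a lower layer. -/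
structure IsLayering (k : ℕ) (s : Finset ι) (E : ι → Finset α) (lv : ι → ℕ) : Prop where
  card_le : ∀ i, {c ∈ s | lv c = i}.card ≤ k
  exists_pivot : ∀ c₀ ∈ s, ∃ y, ∀ c ∈ s, lv c ≤ lv c₀ → (y ∈ E c ↔ lv c = lv c₀)

theorem IsMinTransversal.isChild_empty (hT : IsMinTransversal (layersBelow s lv i) E T)
    (h : IsTransversal (layersBelow s lv (i + 1)) E T) : IsChild s E lv i T ∅ := by
  refine ⟨by simp, ?_, hT.isGreedyIn (by simp)⟩
  rw [Finset.union_empty]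
  refine ⟨h, fun v hv => ?_⟩
  obtain ⟨c, hc, hpriv⟩ := hT.exists_private v hv
  exact ⟨c, mem_layersBelow_succ.2 (.inl hc), hpriv⟩

theorem IsMinTransversal.isChild_singleton (hT : IsMinTransversal (layersBelow s lv i) E T) {y : α}
    (hlow : ∀ c ∈ layersBelow s lv i, y ∉ E c) (hlayer : ∀ c ∈ s, lv c = i → y ∈ E c)
    {c₀ : ι} (hc₀ : c₀ ∈ s) (hi : lv c₀ = i) (h : E c₀ ∩ T = ∅) : IsChild s E lv i T {y} := by
  have hy : y ∉ T := by
    intro hy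
    obtain ⟨c, hc, hyc⟩ := Finset.mem_biUnion.1 (hT.subset_biUnion hy)
    exact hlow c hc hyc
  have hinter : ∀ c ∈ layersBelow s lv i, E c ∩ (T ∪ {y}) = E c ∩ T := by
    intro c hc
    rw [Finset.inter_union_distrib_left, Finset.inter_singleton_of_notMem (hlow c hc),
      Finset.union_empty]
  refine ⟨by simpa using hy, ⟨fun c hc => ?_, fun v hv => ?_⟩, hT.isGreedyIn hinter⟩
  · rcases mem_layersBelow_succ.1 hc with hc | ⟨hc, hci⟩
    · exact hT.isTransversal.mono Finset.subset_union_left c hc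
    · exact ⟨y, by simp [hlayer c hc hci]⟩
  · rcases Finset.mem_union.1 hv with hv | hv
    · obtain ⟨c, hc, hpriv⟩ := hT.exists_private v hv
      exact ⟨c, mem_layersBelow_succ.2 (.inl hc), (hinter c hc).trans hpriv⟩
    · refine ⟨c₀, mem_layersBelow_succ.2 (.inr ⟨hc₀, hi⟩), ?_⟩
      rw [Finset.inter_union_distrib_left, h, Finset.empty_union, Finset.mem_singleton.1 hv,
        Finset.inter_singleton_of_mem (hlayer c₀ hc₀ hi)]

theorem IsLayering.exists_isChild (hL : IsLayering k s E lv)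
    (hT : IsMinTransversal (layersBelow s lv i) E T) :
    ∃ S ⊆ s.biUnion E, S.card ≤ k ∧ IsChild s E lv i T S := by
  by_cases h : IsTransversal (layersBelow s lv (i + 1)) E T
  · exact ⟨∅, by simp, by simp, hT.isChild_empty h⟩
  obtain ⟨c₀, hc₀, hunhit⟩ : ∃ c₀ ∈ layersBelow s lv (i + 1), E c₀ ∩ T = ∅ := by
    simpa only [IsTransversal, not_forall, exists_prop, Finset.not_nonempty_iff_eq_empty] using h
  obtain ⟨hc₀, hi⟩ : c₀ ∈ s ∧ lv c₀ = i := by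
    refine (mem_layersBelow_succ.1 hc₀).resolve_left fun hc => ?_
    simpa [hunhit] using hT.isTransversal c₀ hc
  obtain ⟨y, hy⟩ := hL.exists_pivot c₀ hc₀
  refine ⟨{y}, ?_, ?_, hT.isChild_singleton (fun c hc hyc => ?_) (fun c hc hci => ?_) hc₀ hi hunhit⟩
  · simpa using ⟨c₀, hc₀, (hy c₀ hc₀ le_rfl).2 rfl⟩
  · refine (Finset.card_singleton y).le.trans (le_trans ?_ (hL.card_le (lv c₀)))
    exact Finset.card_pos.2 ⟨c₀, by simp [hc₀]⟩
  · rw [mem_layersBelow, ← hi] at hc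
    exact hc.2.ne ((hy c hc.1 hc.2.le).1 hyc)
  · exact (hy c hc (hci.trans hi.symm).le).2 (hci.trans hi.symm)

theorem IsMinTransversal.exists_parent (h : IsMinTransversal (layersBelow s lv (i + 1)) E T') :
    ∃ T S, IsMinTransversal (layersBelow s lv i) E T ∧ IsChild s E lv i T S ∧ T ∪ S = T' := by
  have hlow : IsTransversal (layersBelow s lv i) E T' := fun c hc =>
    h.isTransversal c (mem_layersBelow_succ.2 (.inl hc))
  obtain ⟨T, hTT', hT, hgr⟩ := hlow.exists_isGreedyIn
  have hunion : T ∪ (T' \ T) = T' := Finset.union_sdiff_of_subset hTT'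
  exact ⟨T, T' \ T, hgr.isMinTransversal hT,
    ⟨Finset.disjoint_sdiff, hunion.symm ▸ h, hunion.symm ▸ hgr⟩, hunion⟩

/-- The private edge of a vertex of `S` is not hit by `T`, so that it lies in layer `i`. -/
theorem IsChild.card_le (h : IsChild s E lv i T S)
    (hT : IsTransversal (layersBelow s lv i) E T) : S.card ≤ {c ∈ s | lv c = i}.card := by
  have hpriv : ∀ v ∈ S, ∃ c ∈ ({c ∈ s | lv c = i} : Finset ι), E c ∩ (T ∪ S) = {v} := by
    intro v hv
    obtain ⟨c, hc, hpriv⟩ :=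
      h.isMinTransversal.exists_private v (Finset.mem_union_right T hv)
    refine ⟨c, Finset.mem_filter.2 ((mem_layersBelow_succ.1 hc).resolve_left fun hc => ?_), hpriv⟩
    obtain ⟨u, hu⟩ := hT c hc
    have huv : u ∈ E c ∩ (T ∪ S) :=
      Finset.inter_subset_inter_left Finset.subset_union_left hu
    rw [hpriv, Finset.mem_singleton] at huv
    exact Finset.disjoint_left.1 h.disjoint (huv ▸ (Finset.mem_inter.1 hu).2) hv
  choose f hf hfpriv using hpriv
  rw [← Finset.card_attach]
  refine Finset.card_le_card_of_injOn (fun v => f v v.2) (fun v _ => hf v v.2) ?_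
  intro v _ w _ hvw
  rw [Subtype.ext_iff, ← Finset.singleton_inj, ← hfpriv v v.2, ← hfpriv w w.2]
  exact congrArg (fun c => E c ∩ (T ∪ S)) hvw

end LinearOrder

end Transversal

/-! ### Depth-first search -/

section DepthFirstSearch

variable {M n r a x y : ℕ} {child : List ℕ → ℕ → Prop} {st st' : List ℕ}

open Classical in
/-- The children `x :: st` of the node `st` with `a ≤ x < M`, represented by the numbers `x`. A node
of a tree is given by the choices on the path from the root to it, the last one first. -/
noncomputable def childrenFrom (M : ℕ) (child : List ℕ → ℕ → Prop) (st : List ℕ) (a : ℕ) : List ℕ :=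
  (List.range' a (M - a)).filter fun x => child st x

/-- `st` is a node of the tree that is described by `child`. -/
def IsNode (M : ℕ) (child : List ℕ → ℕ → Prop) : List ℕ → Prop
  | [] => True
  | x :: st => x ∈ childrenFrom M child st 0 ∧ IsNode M child st

/-- The descendants of the node `st` that are `r` levels below it, in depth-first order. -/
noncomputable def leaves (M : ℕ) (child : List ℕ → ℕ → Prop) : ℕ → List ℕ → List (List ℕ)
  | 0, st => [st]
  | r + 1, st => (childrenFrom M child st 0).flatMap fun x => leaves M child r (x :: st)

/-- The leaves on level `n` that depth-first search reaches after it has left the subtree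
below `st`. -/
noncomputable def laterLeaves (M : ℕ) (child : List ℕ → ℕ → Prop) (n : ℕ) :
    List ℕ → List (List ℕ)
  | [] => []
  | x :: st =>
    ((childrenFrom M child st (x + 1)).flatMap fun y =>
      leaves M child (n - (st.length + 1)) (y :: st)) ++ laterLeaves M child n st

/-- The leaves on level `n` that depth-first search has still to reach when it enters `st`. -/
noncomputable def remainingLeaves (M : ℕ) (child : List ℕ → ℕ → Prop) (n : ℕ) (st : List ℕ) :
    List (List ℕ) :=
  leaves M child (n - st.length) st ++ laterLeaves M child n st

theorem mem_childrenFrom :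
    x ∈ childrenFrom M child st a ↔ a ≤ x ∧ x < M ∧ child st x := by
  simp only [childrenFrom, List.mem_filter, List.mem_range'_1, decide_eq_true_eq, ← and_assoc]
  exact and_congr_left fun _ => by omega

theorem nodup_childrenFrom : (childrenFrom M child st a).Nodup :=
  (List.nodup_range' ..).filter _

theorem childrenFrom_eq_nil (h : M ≤ a) : childrenFrom M child st a = [] := by
  simp [childrenFrom, Nat.sub_eq_zero_of_le h]

theorem childrenFrom_eq_cons (ha : a < M) (h : child st a) :
    childrenFrom M child st a = a :: childrenFrom M child st (a + 1) := by
  rw [childrenFrom, show M - a = M - (a + 1) + 1 by omega, List.range'_succ,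
    List.filter_cons_of_pos (by simpa using h), childrenFrom]

theorem childrenFrom_succ (ha : a < M) (h : ¬ child st a) :
    childrenFrom M child st (a + 1) = childrenFrom M child st a := by
  rw [childrenFrom, childrenFrom, show M - a = M - (a + 1) + 1 by omega, List.range'_succ,
    List.filter_cons_of_neg (by simpa using h)]

theorem remainingLeaves_of_length_eq (h : st.length = n) :
    remainingLeaves M child n st = st :: laterLeaves M child n st := by
  rw [remainingLeaves, h, Nat.sub_self, leaves, List.singleton_append]

theorem remainingLeaves_cons (hn : st.length < n)
    (h : childrenFrom M child st 0 = x :: childrenFrom M child st (x + 1)) :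
    remainingLeaves M child n (x :: st) = remainingLeaves M child n st := by
  rw [remainingLeaves, remainingLeaves, show n - st.length = n - (st.length + 1) + 1 by omega,
    leaves, h, List.flatMap_cons, laterLeaves, List.length_cons, List.append_assoc]

theorem laterLeaves_cons_of_eq_nil (h : childrenFrom M child st (x + 1) = []) :
    laterLeaves M child n (x :: st) = laterLeaves M child n st := by
  rw [laterLeaves, h, List.flatMap_nil, List.nil_append]

theorem laterLeaves_cons_of_eq_cons
    (h : childrenFrom M child st (x + 1) = y :: childrenFrom M child st (y + 1)) :
    laterLeaves M child n (x :: st) = remainingLeaves M child n (y :: st) := by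
  rw [laterLeaves, h, List.flatMap_cons, remainingLeaves, laterLeaves, List.length_cons,
    List.append_assoc]

theorem IsNode.of_suffix (h : IsNode M child st') (hs : st <:+ st') : IsNode M child st := by
  induction st' with
  | nil => exact List.suffix_nil.1 hs ▸ h
  | cons x st' ih => exact (List.suffix_cons_iff.1 hs).elim (fun e => e ▸ h) (ih h.2)

theorem isNode_of_mem_leaves (h : IsNode M child st) (hst' : st' ∈ leaves M child r st) :
    IsNode M child st' ∧ st <:+ st' ∧ st'.length = st.length + r := by
  induction r generalizing st with
  | zero =>
    obtain rfl := List.mem_singleton.1 hst'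
    exact ⟨h, List.suffix_refl _, rfl⟩
  | succ r ih =>
    obtain ⟨x, hx, hst'⟩ := List.mem_flatMap.1 hst'
    obtain ⟨hnode, hsuff, hlen⟩ := ih (st := x :: st) ⟨hx, h⟩ hst'
    exact ⟨hnode, (List.suffix_cons x st).trans hsuff, by simp only [hlen, List.length_cons]; omega⟩

theorem mem_leaves_of_isNode (h : IsNode M child st') (hs : st <:+ st')
    (hlen : st'.length = st.length + r) : st' ∈ leaves M child r st := by
  induction r generalizing st with
  | zero => exact List.mem_singleton.2 (hs.eq_of_length hlen.symm).symm
  | succ r ih =>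
    obtain ⟨l, rfl⟩ := hs
    obtain rfl | ⟨l, x, rfl⟩ := l.eq_nil_or_concat
    · simp at hlen
    have hs : x :: st <:+ (l.concat x) ++ st := ⟨l, by simp⟩
    refine List.mem_flatMap.2 ⟨x, (h.of_suffix hs).1, ih hs ?_⟩
    rw [hlen, List.length_cons]
    omega

theorem mem_leaves : st ∈ leaves M child n [] ↔ IsNode M child st ∧ st.length = n := by
  constructor
  · intro h
    obtain ⟨hnode, -, hlen⟩ := isNode_of_mem_leaves (st := []) trivial h
    exact ⟨hnode, by simpa using hlen⟩
  · rintro ⟨h, rfl⟩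
    exact mem_leaves_of_isNode h (List.nil_suffix) (by simp)

theorem nodup_leaves (h : IsNode M child st) : (leaves M child r st).Nodup := by
  induction r generalizing st with
  | zero => exact List.nodup_singleton _
  | succ r ih =>
    refine List.nodup_flatMap.2 ⟨fun x hx => ih ⟨hx, h⟩, ?_⟩
    refine nodup_childrenFrom.pairwise_of_forall_ne fun x hx y hy hxy st' hst'x hst'y => hxy ?_
    have hsx := (isNode_of_mem_leaves (st := x :: st) ⟨hx, h⟩ hst'x).2.1
    have hsy := (isNode_of_mem_leaves (st := y :: st) ⟨hy, h⟩ hst'y).2.1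
    have heq := (List.suffix_of_suffix_length_le hsx hsy (by simp)).eq_of_length (by simp)
    exact (List.cons.inj heq).1

end DepthFirstSearch

/-! ### The tree of minimal transversals -/

section TransversalTree

variable {ι α : Type*} [LinearOrder α] {s : Finset ι} {E : ι → Finset α} {lv : ι → ℕ}
  {cand : ℕ → Finset α} {k M i : ℕ} {V T : Finset α} {st st' : List ℕ}

/-- The union of the candidates chosen on the path to a node. -/
def chosen (cand : ℕ → Finset α) : List ℕ → Finset α
  | [] => ∅
  | x :: st => chosen cand st ∪ cand x

/-- The child relation of the tree of minimal transversals in which the number `x` stands for adding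
the candidate `cand x`. -/
def IsCandChild (s : Finset ι) (E : ι → Finset α) (lv : ι → ℕ) (cand : ℕ → Finset α)
    (st : List ℕ) (x : ℕ) : Prop :=
  IsChild s E lv st.length (chosen cand st) (cand x)

/-- The sets with at most `k` elements that are contained in `V`. -/
def smallSubsets (k : ℕ) (V : Finset α) : Set (Finset α) := {S | S ⊆ V ∧ S.card ≤ k}

theorem IsNode.isMinTransversal (h : IsNode M (IsCandChild s E lv cand) st) :
    IsMinTransversal (layersBelow s lv st.length) E (chosen cand st) := by
  cases st with
  | nil => exact ⟨fun c hc => by simp at hc, by simp [chosen]⟩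
  | cons x st => exact (mem_childrenFrom.1 h.1).2.2.isMinTransversal

theorem IsNode.eq_of_chosen_eq (hcand : Set.InjOn cand (Set.Iio M))
    (h : IsNode M (IsCandChild s E lv cand) st) (h' : IsNode M (IsCandChild s E lv cand) st')
    (hlen : st.length = st'.length) (heq : chosen cand st = chosen cand st') : st = st' := by
  induction st generalizing st' with
  | nil => exact (List.length_eq_zero_iff.1 hlen.symm).symm
  | cons x st ih =>
    obtain _ | ⟨y, st'⟩ := st'
    · simp at hlen
    replace hlen : st.length = st'.length := by simpa using hlen
    obtain ⟨-, hx, hdisj, -, hgr⟩ := mem_childrenFrom.1 h.1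
    obtain ⟨-, hy, hdisj', -, hgr'⟩ := mem_childrenFrom.1 h'.1
    change chosen cand st ∪ cand x = chosen cand st' ∪ cand y at heq
    rw [← hlen, ← heq] at hgr'
    have hparent : chosen cand st = chosen cand st' := by
      refine hgr.unique hgr' h.2.isMinTransversal.isTransversal ?_ Finset.subset_union_left ?_
      · rw [hlen]
        exact h'.2.isMinTransversal.isTransversal
      · exact heq ▸ Finset.subset_union_left
    have hstep : cand x = cand y := by
      rw [← Finset.union_sdiff_cancel_left hdisj, heq, hparent,
        Finset.union_sdiff_cancel_left hdisj']
    rw [hcand hx hy hstep, ih h.2 h'.2 hlen hparent]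

variable (hL : IsLayering k s E lv) (hcand : Set.SurjOn cand (Set.Iio M) (smallSubsets k V))
  (hV : s.biUnion E ⊆ V)

include hL hcand hV

theorem IsMinTransversal.exists_isNode (hT : IsMinTransversal (layersBelow s lv i) E T) :
    ∃ st, IsNode M (IsCandChild s E lv cand) st ∧ st.length = i ∧ chosen cand st = T := by
  induction i generalizing T with
  | zero =>
    have hempty : layersBelow s lv 0 = ∅ := by simp [layersBelow]
    exact ⟨[], trivial, rfl, (hempty ▸ hT).eq_empty.symm⟩
  | succ i ih =>
    obtain ⟨T, S, hT', hS, rfl⟩ := hT.exists_parent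
    obtain ⟨st, hst, rfl, rfl⟩ := ih hT'
    have hSV : S ⊆ V := by
      refine (Finset.subset_union_right.trans hT.subset_biUnion).trans (le_trans ?_ hV)
      exact Finset.biUnion_subset_biUnion_of_subset_left E (Finset.filter_subset _ _)
    obtain ⟨x, hx, rfl⟩ :=
      hcand ⟨hSV, (hS.card_le hT'.isTransversal).trans (hL.card_le _)⟩
    exact ⟨x :: st, ⟨mem_childrenFrom.2 ⟨Nat.zero_le x, hx, hS⟩, hst⟩, rfl, rfl⟩

theorem IsNode.childrenFrom_ne_nil (h : IsNode M (IsCandChild s E lv cand) st) :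
    childrenFrom M (IsCandChild s E lv cand) st 0 ≠ [] := by
  obtain ⟨S, hSV, hcard, hS⟩ := hL.exists_isChild h.isMinTransversal
  obtain ⟨x, hx, rfl⟩ := hcand ⟨hSV.trans hV, hcard⟩
  exact List.ne_nil_of_mem (mem_childrenFrom.2 ⟨Nat.zero_le x, hx, hS⟩)

end TransversalTree

/-! ### The prime CNF of the dual function -/

section Duality

variable {n : ℕ} {φ ψ : MonotoneCNF n} {c P : Finset (Fin n)} {v : Fin n → Bool}

theorem boolFn_le_iff {f g : BoolFn n} : f ≤ g ↔ ∀ v, f v = true → g v = true := by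
  simp only [Pi.le_def, Bool.le_iff_imp]

@[simp]
theorem clauseFn_empty_eq_true : clauseFn c ∅ v = true ↔ ∃ i ∈ c, v i = true := by
  simp [clauseFn]

theorem cnfFn_eq_true : cnfFn φ v = true ↔ ∀ c ∈ φ, ∃ i ∈ c, v i = true := by
  simp [cnfFn]

theorem dual_cnfFn_eq_true : dual (cnfFn φ) v = true ↔ ∃ c ∈ φ, ∀ i ∈ c, v i = true := by
  simp [dual, cnfFn]

theorem clauseFn_empty_le_iff : clauseFn P ∅ ≤ clauseFn c ∅ ↔ P ⊆ c := by
  rw [boolFn_le_iff]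
  refine ⟨fun h i hi => ?_, fun h v hv => ?_⟩
  · simpa using h (fun j => decide (j = i)) (by simpa using hi)
  · obtain ⟨i, hi, hv⟩ := clauseFn_empty_eq_true.1 hv
    exact clauseFn_empty_eq_true.2 ⟨i, h hi, hv⟩

theorem isPrimeImplicate_iff {f : BoolFn n} :
    IsPrimeImplicate f c ↔ f ≤ clauseFn c ∅ ∧ ∀ P ⊆ c, f ≤ clauseFn P ∅ → P = c := by
  refine and_congr_right fun _ => ⟨fun h P hP hle => ?_, fun h P N _ hle hlt => ?_⟩
  · by_contra hne
    refine h P ∅ (Finset.disjoint_empty_right P) hle (lt_of_le_not_ge ?_ ?_)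
    · exact clauseFn_empty_le_iff.2 hP
    · exact fun hge => hne (hP.antisymm (clauseFn_empty_le_iff.1 hge))
  · -- a negative literal would make the smaller clause true at `0`
    have hN : N = ∅ := by
      rw [Finset.eq_empty_iff_forall_notMem]
      intro i hi
      have := boolFn_le_iff.1 hlt.le (fun _ => false) (by simpa [clauseFn] using ⟨i, hi⟩)
      simp at this
    subst hN
    exact hlt.ne (congrArg (clauseFn · ∅) (h P (clauseFn_empty_le_iff.1 hlt.le) hle))

theorem dual_cnfFn_le_iff : dual (cnfFn φ) ≤ clauseFn c ∅ ↔ IsTransversal φ id c := by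
  rw [boolFn_le_iff]
  refine ⟨fun h C hC => ?_, fun h v hv => ?_⟩
  · have := h (fun i => decide (i ∈ C)) (dual_cnfFn_eq_true.2 ⟨C, hC, by simp⟩)
    obtain ⟨i, hi, hiC⟩ := clauseFn_empty_eq_true.1 this
    exact ⟨i, Finset.mem_inter.2 ⟨by simpa using hiC, hi⟩⟩
  · obtain ⟨C, hC, hCv⟩ := dual_cnfFn_eq_true.1 hv
    obtain ⟨i, hi⟩ := h C hC
    rw [Finset.mem_inter] at hi
    exact clauseFn_empty_eq_true.2 ⟨i, hi.2, hCv i hi.1⟩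

theorem isPrimeImplicate_dual_iff :
    IsPrimeImplicate (dual (cnfFn φ)) c ↔ IsMinTransversal φ id c := by
  simp only [isPrimeImplicate_iff, dual_cnfFn_le_iff]
  refine ⟨fun h => ?_, fun h => ⟨h.isTransversal, fun P hP hPt => h.eq_of_subset hPt hP⟩⟩
  obtain ⟨T, hTc, hT⟩ := h.1.exists_isMinTransversal
  exact h.2 T hTc hT.isTransversal ▸ hT

theorem isPrimeCNFOf_dual (hψ : ∀ c, c ∈ ψ ↔ IsMinTransversal φ id c) :
    IsPrimeCNFOf ψ (dual (cnfFn φ)) := by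
  refine ⟨?_, fun c => by rw [hψ, isPrimeImplicate_dual_iff]⟩
  funext v
  rw [Bool.eq_iff_iff, dual_cnfFn_eq_true, cnfFn_eq_true]
  constructor
  · -- otherwise the zeros of `v` contain a minimal transversal, and its clause is false at `v`
    intro h
    by_contra! hno
    have hzeros : IsTransversal φ id {i | v i = false} := fun C hC => by
      obtain ⟨i, hi, hv⟩ := hno C hC
      exact ⟨i, by simpa [hi] using hv⟩
    obtain ⟨c, hc, hmin⟩ := hzeros.exists_isMinTransversal
    obtain ⟨i, hi, hv⟩ := h c ((hψ c).2 hmin)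
    simpa [hv] using hc hi
  · rintro ⟨C, hC, hCv⟩ c hc
    obtain ⟨i, hi⟩ := ((hψ c).1 hc).isTransversal C hC
    rw [Finset.mem_inter] at hi
    exact ⟨i, hi.2, hCv i hi.1⟩

end Duality

/-! ### Degenerate families and listed CNFs -/

/-- Every nonempty subfamily has a vertex of positive degree at most `k`. -/
def IsDegenerateFamily {ι α : Type*} [DecidableEq α] (k : ℕ) (s : Finset ι) (E : ι → Finset α) :
    Prop :=
  ∀ U ⊆ s, U.Nonempty → ∃ v, {c ∈ U | v ∈ E c}.Nonempty ∧ {c ∈ U | v ∈ E c}.card ≤ k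

section Listed

variable {k n : ℕ} {φ : MonotoneCNF n} {L : List (List (Fin n))}

/-- The vertex is the last variable in the ordering that occurs in the subfamily. -/
theorem IsDegenerate.isDegenerateFamily (hφ : IsDegenerate k φ) (hne : ∀ c ∈ φ, c.Nonempty) :
    IsDegenerateFamily k φ id := by
  obtain ⟨x, hx⟩ := hφ
  rintro U hU ⟨c₀, hc₀⟩
  obtain ⟨v₀, hv₀⟩ := hne c₀ (hU hc₀)
  obtain ⟨i, hi, hmax⟩ := ({i | ∃ c ∈ U, x i ∈ c} : Finset (Fin n)).exists_max_image id
    ⟨x.symm v₀, by simpa using ⟨c₀, hc₀, hv₀⟩⟩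
  simp only [Finset.mem_filter, Finset.mem_univ, true_and, id] at hi hmax
  obtain ⟨c, hc, hic⟩ := hi
  refine ⟨x i, ⟨c, by simp [hc, hic]⟩, (Finset.card_le_card fun c hc => ?_).trans (hx i)⟩
  simp only [Finset.mem_filter, id] at hc
  simp only [Delta, fixTail, Finset.mem_sdiff, Finset.mem_filter, not_and]
  refine ⟨⟨hU hc.1, fun j hj hxj => ?_⟩, fun _ h => h i le_rfl hc.2⟩
  have hji : j ≤ i := hmax j ⟨c, hc.1, hxj⟩
  exact absurd hj (by simpa using hji)

/-- The clause with number `c` of a listed CNF. -/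
def listedClause (L : List (List (Fin n))) (c : ℕ) : Finset (Fin n) := (L.getD c []).toFinset

theorem Lists.image_listedClause (hL : Lists L φ) :
    (Finset.range L.length).image (listedClause L) = φ := by
  rw [← hL.2.2]
  ext C
  simp only [Finset.mem_image, Finset.mem_range, List.mem_toFinset, List.mem_map, listedClause]
  constructor
  · rintro ⟨c, hc, rfl⟩
    exact ⟨L[c], List.getElem_mem hc, by simp [hc]⟩
  · rintro ⟨l, hl, rfl⟩
    obtain ⟨c, hc, rfl⟩ := List.mem_iff_getElem.1 hl
    exact ⟨c, hc, by simp [hc]⟩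

theorem Lists.injOn_listedClause (hL : Lists L φ) :
    Set.InjOn (listedClause L) (Finset.range L.length) := by
  intro c hc c' hc' h
  rw [Finset.mem_coe, Finset.mem_range] at hc hc'
  simp only [listedClause, List.getD_eq_getElem, hc, hc'] at h
  exact (hL.2.1.getElem_inj_iff (hi := by simpa using hc) (hj := by simpa using hc')).1
    (by simpa using h)

theorem Lists.card_listedClause (hL : Lists L φ) (c : ℕ) :
    (listedClause L c).card = (L.getD c []).length := by
  refine List.toFinset_card_of_nodup ?_
  rcases lt_or_ge c L.length with hc | hc
  · simpa [hc] using hL.1 _ (List.getElem_mem hc)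
  · simp [hc]

theorem Lists.sum_length (hL : Lists L φ) :
    ∑ c ∈ Finset.range L.length, (L.getD c []).length = length φ := by
  rw [length, ← hL.image_listedClause, Finset.sum_image hL.injOn_listedClause]
  exact Finset.sum_congr rfl fun c _ => (hL.card_listedClause c).symm

/-- The clause with number `c` of a listed CNF, as a set of natural numbers. -/
def listedEdge (L : List (List (Fin n))) (c : ℕ) : Finset ℕ :=
  (listedClause L c).map Fin.valEmbedding

theorem Lists.isMinTransversal_iff (hL : Lists L φ) {T : Finset (Fin n)} :
    IsMinTransversal (Finset.range L.length) (listedEdge L) (T.map Fin.valEmbedding) ↔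
      IsMinTransversal φ id T := by
  rw [← hL.image_listedClause, isMinTransversal_image]
  exact isMinTransversal_map Fin.valEmbedding

theorem Lists.isDegenerateFamily (hL : Lists L φ) (h : IsDegenerateFamily k φ id) :
    IsDegenerateFamily k (Finset.range L.length) (listedEdge L) := by
  intro U hU hne
  obtain ⟨v, hv, hcard⟩ := h (U.image (listedClause L))
    (hL.image_listedClause ▸ Finset.image_subset_image hU) (hne.image _)
  have hfilter : {c ∈ U.image (listedClause L) | v ∈ id c} =
      {c ∈ U | v.val ∈ listedEdge L c}.image (listedClause L) := by
    rw [Finset.filter_image]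
    simp [listedEdge, Fin.val_inj]
  rw [hfilter] at hv hcard
  rw [Finset.card_image_of_injOn
    (hL.injOn_listedClause.mono fun c hc => hU (Finset.mem_filter.1 hc).1)] at hcard
  exact ⟨v, Finset.image_nonempty.1 hv, hcard⟩

end Listed

/-! ### Memory layout -/

infixr:30 " ;; " => Program.seq

/-- Assignment to the scalar `a`. -/
def setScal (a : ℕ) (e : Expr) : Program := .assign a (.const 0) e

/-- The entry of the array `a` whose index is the scalar `b`. -/
def entry (a b : ℕ) : Expr := .get a (scal b)

/-- The entry of the array `a` whose index is `b[c]` for the scalar `c`. -/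
def entry₂ (a b c : ℕ) : Expr := .get a (entry b c)

namespace Arr

abbrev input : ℕ := 0
-- The literal occurrence number `p < numLits` is the variable `lit[p]` in the clause `cls[p]`.
abbrev lit : ℕ := 1
abbrev cls : ℕ := 2
abbrev numLits : ℕ := 3
-- For `0 < x < tableSize`, the candidate set number `x` consists of the element `value[x]` and the
-- set number `parent[x]`, and has `card[x]` elements; the set number `0` is empty.
abbrev parent : ℕ := 4
abbrev value : ℕ := 5
abbrev card : ℕ := 6
abbrev tableSize : ℕ := 7
-- The clauses `c` with `layer[c] = i` form the layer `i`, and `choice[i]` is the number of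
-- the candidate that the current node of the tree adds in the layer `i < depth`.
abbrev layer : ℕ := 8
abbrev choice : ℕ := 9
abbrev depth : ℕ := 10
abbrev ok : ℕ := 11
abbrev done : ℕ := 12
-- `mark[v] = 1` for the elements of the current node, and `mark[v] = 2` for those of the candidate.
abbrev mark : ℕ := 13
abbrev countAll : ℕ := 14
abbrev countOld : ℕ := 15
abbrev minMarked : ℕ := 16
abbrev witness : ℕ := 17
abbrev witnessOld : ℕ := 18
abbrev degree : ℕ := 19
abbrev pivot : ℕ := 20
abbrev pos : ℕ := 21
abbrev count : ℕ := 22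
abbrev cursor : ℕ := 23
abbrev outer : ℕ := 24
abbrev inner : ℕ := 25
abbrev hasEmpty : ℕ := 26

end Arr

def numVars : Expr := .get Arr.input (.const 0)

def numClauses : Expr := .get Arr.input (.const 1)

attribute [simp] Program.eff Expr.eval Test.eval

@[simp]
theorem eff_setScal (σ : Memory) (a : ℕ) (e : Expr) :
    (setScal a e).eff σ = store σ a 0 (e.eval σ) := rfl

@[simp]
theorem eval_entry (σ : Memory) (a b : ℕ) : (entry a b).eval σ = σ a (σ b 0) := rfl

@[simp]
theorem eval_entry₂ (σ : Memory) (a b c : ℕ) : (entry₂ a b c).eval σ = σ a (σ b (σ c 0)) := rfl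

@[simp]
theorem eval_numVars (σ : Memory) : numVars.eval σ = σ Arr.input 0 := rfl

@[simp]
theorem eval_numClauses (σ : Memory) : numClauses.eval σ = σ Arr.input 1 := rfl

/-- The memory contains the literal occurrences of the clauses `E c`, `c < m`. -/
structure Input (n m N : ℕ) (E : ℕ → Finset ℕ) (σ : Memory) : Prop where
  numVars_eq : σ Arr.input 0 = n
  numClauses_eq : σ Arr.input 1 = m
  numLits_eq : σ Arr.numLits 0 = N
  edge_lt : ∀ c < m, ∀ v ∈ E c, v < n
  bijOn : Set.BijOn (fun p => (σ Arr.cls p, σ Arr.lit p)) (Set.Iio N) {o | o.1 < m ∧ o.2 ∈ E o.1}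

namespace Input

variable {n m N : ℕ} {E : ℕ → Finset ℕ} {σ σ' : Memory}

theorem of_frame (h : Input n m N E σ) {p : Program} (hf : Frame p σ σ')
    (hp : p.preserves [Arr.input, Arr.lit, Arr.cls, Arr.numLits] = true := by rfl) :
    Input n m N E σ' := by
  have hpres : ∀ a ∈ [Arr.input, Arr.lit, Arr.cls, Arr.numLits], σ' a = σ a := fun a ha =>
    hf a (Program.touches_of_preserves hp ha)
  simp only [List.forall_mem_cons] at hpres
  obtain ⟨hin, hlit, hcls, hnum, -⟩ := hpres
  constructor
  · rw [hin, h.numVars_eq]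
  · rw [hin, h.numClauses_eq]
  · rw [hnum, h.numLits_eq]
  · exact h.edge_lt
  · rw [hlit, hcls]
    exact h.bijOn

theorem cls_lt (h : Input n m N E σ) {p : ℕ} (hp : p < N) : σ Arr.cls p < m :=
  (h.bijOn.mapsTo hp).1

theorem lit_mem (h : Input n m N E σ) {p : ℕ} (hp : p < N) : σ Arr.lit p ∈ E (σ Arr.cls p) :=
  (h.bijOn.mapsTo hp).2

theorem exists_occurrence (h : Input n m N E σ) {c v : ℕ} (hc : c < m) (hv : v ∈ E c) :
    ∃ p < N, σ Arr.cls p = c ∧ σ Arr.lit p = v := by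
  obtain ⟨p, hp, heq⟩ := h.bijOn.surjOn (show (c, v) ∈ _ from ⟨hc, hv⟩)
  exact ⟨p, hp, congrArg Prod.fst heq, congrArg Prod.snd heq⟩

theorem image_lit_setOf (h : Input n m N E σ) {c : ℕ} (hc : c < m) (P : ℕ → Prop)
    [DecidablePred P] :
    σ Arr.lit '' {p | p < N ∧ σ Arr.cls p = c ∧ P (σ Arr.lit p)} = ↑{v ∈ E c | P v} := by
  ext v
  rw [Finset.mem_coe, Finset.mem_filter]
  refine ⟨?_, fun ⟨hv, hPv⟩ => ?_⟩
  · rintro ⟨p, ⟨hp, rfl, hPp⟩, rfl⟩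
    exact ⟨h.lit_mem hp, hPp⟩
  · obtain ⟨p, hp, rfl, rfl⟩ := h.exists_occurrence hc hv
    exact ⟨p, ⟨hp, rfl, hPv⟩, rfl⟩

theorem occurrence_ext (h : Input n m N E σ) {p q : ℕ} (hp : p < N) (hq : q < N)
    (hcls : σ Arr.cls p = σ Arr.cls q) (hlit : σ Arr.lit p = σ Arr.lit q) : p = q :=
  h.bijOn.injOn hp hq (Prod.ext hcls hlit)

theorem count_cls (h : Input n m N E σ) (P : ℕ → Prop) [DecidablePred P] {c : ℕ} (hc : c < m) :
    Nat.count (fun p => σ Arr.cls p = c ∧ P (σ Arr.lit p)) N = {v ∈ E c | P v}.card := by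
  rw [Nat.count_eq_card_filter_range]
  refine Finset.card_bij (fun p _ => σ Arr.lit p) ?_ ?_ ?_ <;>
    simp only [Finset.mem_filter, Finset.mem_range]
  · rintro p ⟨hp, rfl, hP⟩
    exact ⟨h.lit_mem hp, hP⟩
  · rintro p ⟨hp, hpc, -⟩ q ⟨hq, hqc, -⟩ hpq
    exact h.occurrence_ext hp hq (hpc.trans hqc.symm) hpq
  · rintro v ⟨hv, hP⟩
    obtain ⟨p, hp, hpc, rfl⟩ := h.exists_occurrence hc hv
    exact ⟨p, ⟨hp, hpc, hP⟩, rfl⟩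

theorem count_lit (h : Input n m N E σ) (P : ℕ → Prop) [DecidablePred P] (y : ℕ) :
    Nat.count (fun p => σ Arr.lit p = y ∧ P (σ Arr.cls p)) N =
      {c ∈ {c ∈ Finset.range m | P c} | y ∈ E c}.card := by
  rw [Nat.count_eq_card_filter_range]
  refine Finset.card_bij (fun p _ => σ Arr.cls p) ?_ ?_ ?_ <;>
    simp only [Finset.mem_filter, Finset.mem_range]
  · rintro p ⟨hp, rfl, hP⟩
    exact ⟨⟨h.cls_lt hp, hP⟩, h.lit_mem hp⟩
  · rintro p ⟨hp, hpy, -⟩ q ⟨hq, hqy, -⟩ hpq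
    exact h.occurrence_ext hp hq hpq (hpy.trans hqy.symm)
  · rintro c ⟨⟨hc, hP⟩, hy⟩
    obtain ⟨p, hp, rfl, rfl⟩ := h.exists_occurrence hc hy
    exact ⟨p, ⟨hp, rfl, hP⟩, rfl⟩

end Input

/-! ### Reading the input -/

section Parse

variable {n c : ℕ} {L : List (List (Fin n))} {l : List (Fin n)} {w rest : List ℕ} {σ : Memory}

/-- Append the clause that is stored from `input[pos]` on to the literal occurrences. -/
def parseClause : Program :=
  (setScal Arr.count (entry Arr.input Arr.pos) ;;
    setScal Arr.pos (.succ (scal Arr.pos)) ;;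
    .ite (.eq (scal Arr.count) (.const 0)) (setScal Arr.hasEmpty (.const 1)) .skip) ;;
  forLoop Arr.inner (scal Arr.count)
    (.assign Arr.lit (scal Arr.numLits) (entry Arr.input Arr.pos) ;;
      .assign Arr.cls (scal Arr.numLits) (scal Arr.outer) ;;
      setScal Arr.numLits (.succ (scal Arr.numLits)) ;;
      setScal Arr.pos (.succ (scal Arr.pos)))

def parse : Program :=
  setScal Arr.pos (.const 2) ;; forLoop Arr.outer numClauses parseClause

/-- The literal occurrences `(clause, variable)` in the memory. -/
def storedLits (σ : Memory) : List (ℕ × ℕ) :=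
  (List.range (σ Arr.numLits 0)).map fun p => (σ Arr.cls p, σ Arr.lit p)

/-- The literal occurrences `(clause, variable)` in the first `c` clauses. -/
def occurrences (L : List (List (Fin n))) (c : ℕ) : List (ℕ × ℕ) :=
  (List.range c).flatMap fun i => (L.getD i []).map fun v => (i, v.val)

theorem storedLits_congr {σ' : Memory} (hnum : σ' Arr.numLits = σ Arr.numLits)
    (hcls : σ' Arr.cls = σ Arr.cls) (hlit : σ' Arr.lit = σ Arr.lit) :
    storedLits σ' = storedLits σ := by
  rw [storedLits, hnum, hcls, hlit, storedLits]

theorem storedLits_append {σ' : Memory} {o : ℕ × ℕ}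
    (hnum : σ' Arr.numLits 0 = σ Arr.numLits 0 + 1)
    (hcls : σ' Arr.cls = Function.update (σ Arr.cls) (σ Arr.numLits 0) o.1)
    (hlit : σ' Arr.lit = Function.update (σ Arr.lit) (σ Arr.numLits 0) o.2) :
    storedLits σ' = storedLits σ ++ [o] := by
  rw [storedLits, hnum, List.range_succ, List.map_append, hcls, hlit, storedLits]
  congr 1
  · refine List.map_congr_left fun p hp => ?_
    have hne : p ≠ σ Arr.numLits 0 := (List.mem_range.1 hp).ne
    rw [Function.update_of_ne hne, Function.update_of_ne hne]
  · simp

theorem getD_of_drop_eq_cons {i a : ℕ} (h : w.drop i = a :: rest) :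
    w.getD i 0 = a ∧ w.drop (i + 1) = rest := by
  constructor
  · have hi : (w.drop i)[0]? = some a := by rw [h]; rfl
    rw [List.getElem?_drop, add_zero] at hi
    rw [List.getD_eq_getElem?_getD, hi, Option.getD_some]
  · rw [← List.drop_drop, h, List.drop_one, List.tail_cons]

theorem exec_parseClause (hw : ∀ i, σ Arr.input i = w.getD i 0) (hc : σ Arr.outer 0 = c)
    (hpos : w.drop (σ Arr.pos 0) = l.length :: (l.map Fin.val ++ rest)) :
    Exec parseClause σ (l.length * 6 + 6) [] fun σ' =>
      storedLits σ' = storedLits σ ++ l.map (fun v => (c, v.val)) ∧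
      w.drop (σ' Arr.pos 0) = rest ∧
      σ' Arr.hasEmpty 0 = if l = [] then 1 else σ Arr.hasEmpty 0 := by
  obtain ⟨hlen, hdrop⟩ := getD_of_drop_eq_cons hpos
  rw [← hw] at hlen
  refine ((Exec.of_eff (Q := fun σ₁ => w.drop (σ₁ Arr.pos 0) = l.map Fin.val ++ rest ∧
    σ₁ Arr.count 0 = l.length ∧ σ₁ Arr.hasEmpty 0 = if l = [] then 1 else σ Arr.hasEmpty 0)
    rfl ?_).seq (t' := l.length * 6 + 2) ?_).mono (by simp +arith [Program.cost, setScal])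
    fun _ h _ => h
  · by_cases hl : l = [] <;> simp (disch := decide) [hlen, hdrop, hl]
  rintro σ₁ ⟨hpos₁, hcount, hempty⟩ hf
  refine (Exec.forLoop_straight (I := fun d σ' =>
    storedLits σ' = storedLits σ ++ (l.take d).map (fun v => (c, v.val)) ∧
    w.drop (σ' Arr.pos 0) = (l.drop d).map Fin.val ++ rest) (by exact hcount)
    ⟨?_, by simpa using hpos₁⟩
    ?_).mono le_rfl fun σ' h hf' => ⟨by simpa using h.1, by simpa using h.2, ?_⟩
  · simpa using storedLits_congr (hf _ rfl) (hf _ rfl) (hf _ rfl)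
  · rintro d hd σ' ⟨hlits, hpos'⟩ - hf'
    rw [List.drop_eq_getElem_cons hd, List.map_cons, List.cons_append] at hpos'
    obtain ⟨hhead, hdrop'⟩ := getD_of_drop_eq_cons hpos'
    rw [← hw, ← hf Arr.input rfl, ← hf' Arr.input rfl] at hhead
    have hc' : σ' Arr.outer 0 = c := by rw [hf' _ rfl, hf _ rfl, hc]
    rw [List.take_succ_eq_append_getElem hd, List.map_append, ← List.append_assoc, ← hlits]
    refine ⟨storedLits_append ?_ ?_ ?_, ?_⟩ <;> simp (disch := decide) [hhead, hc', hdrop']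
  · rw [hf' _ rfl, hempty]

theorem exec_parse (hL : ∀ l ∈ L, l.Nodup) :
    Exec parse (initial (encode L)) (L.length * (n * 6 + 8) + 3) [] fun σ =>
      storedLits σ = occurrences L L.length ∧ (σ Arr.hasEmpty 0 = 0 ↔ [] ∉ L) := by
  refine (Exec.eff_seq (t := L.length * (n * 6 + 6 + 2) + 2) rfl ?_).mono
    (by simp +arith [Program.cost, setScal]) fun _ h _ => h
  refine (Exec.forLoop (I := fun c σ => storedLits σ = occurrences L c ∧
    (encode L).drop (σ Arr.pos 0) = (L.drop c).flatMap (fun l => l.length :: l.map Fin.val) ∧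
    (σ Arr.hasEmpty 0 = 0 ↔ [] ∉ L.take c)) ?_ ⟨?_, ?_, ?_⟩ ?_).mono le_rfl
    fun σ h _ => ⟨h.1, by simpa using h.2.2⟩
  · simp [initial, encode]
  · simp [storedLits, occurrences, initial]
  · simp [encode]
  · simp [initial]
  rintro c hc σ ⟨hlits, hpos, hempty⟩ houter hf
  have hw : ∀ i, σ Arr.input i = (encode L).getD i 0 := by
    rw [hf _ rfl]
    simp [initial]
  rw [List.drop_eq_getElem_cons hc, List.flatMap_cons, List.cons_append] at hpos
  have hlen : L[c].length ≤ n := by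
    simpa using (hL _ (List.getElem_mem hc)).length_le_card
  refine (exec_parseClause hw houter hpos).mono (by omega) ?_
  rintro σ' ⟨hlits', hpos', hempty'⟩ -
  refine ⟨?_, hpos', ?_⟩
  · rw [hlits', hlits, occurrences, occurrences, List.range_succ, List.flatMap_append]
    simp [hc]
  · rw [hempty', List.take_succ_eq_append_getElem hc, List.mem_append, List.mem_singleton]
    by_cases hl : L[c] = [] <;> simp [hl, hempty, eq_comm]

theorem mem_occurrences {o : ℕ × ℕ} :
    o ∈ occurrences L c ↔ o.1 < c ∧ o.2 ∈ listedEdge L o.1 := by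
  obtain ⟨i, v⟩ := o
  simp [occurrences, listedEdge, listedClause]

theorem nodup_occurrences (hL : ∀ l ∈ L, l.Nodup) : (occurrences L c).Nodup := by
  refine List.nodup_flatMap.2 ⟨fun i _ => ?_, List.nodup_range.imp fun {a b} hab => ?_⟩
  · refine List.Nodup.map (fun u v h => by simpa [Fin.val_inj] using h) ?_
    rcases lt_or_ge i L.length with hi | hi
    · simpa [hi] using hL _ (List.getElem_mem hi)
    · simp [hi]
  · rw [Function.onFun, List.disjoint_left]
    simp only [List.mem_map]
    rintro _ ⟨u, -, rfl⟩ ⟨v, -, h⟩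
    exact hab (congrArg Prod.fst h).symm

theorem length_occurrences :
    (occurrences L c).length = ∑ i ∈ Finset.range c, (L.getD i []).length := by
  simp only [occurrences, List.length_flatMap, List.length_map]
  rfl

theorem input_of_storedLits_eq (hL : ∀ l ∈ L, l.Nodup)
    (hlits : storedLits σ = occurrences L L.length) (hn : σ Arr.input 0 = n)
    (hm : σ Arr.input 1 = L.length) :
    Input n L.length (occurrences L L.length).length (listedEdge L) σ := by
  have hN : σ Arr.numLits 0 = (occurrences L L.length).length := by
    simp [← hlits, storedLits]
  refine ⟨hn, hm, hN, fun c _ v hv => ?_, ?_, ?_, ?_⟩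
  · obtain ⟨i, -, rfl⟩ := Finset.mem_map.1 hv
    exact i.isLt
  · intro p hp
    rw [← hN] at hp
    exact mem_occurrences.1 (hlits ▸ List.mem_map_of_mem (List.mem_range.2 hp))
  · intro p hp q hq hpq
    rw [Set.mem_Iio, ← hN] at hp hq
    exact List.inj_on_of_nodup_map (hlits ▸ nodup_occurrences hL) (List.mem_range.2 hp)
      (List.mem_range.2 hq) hpq
  · intro o ho
    rw [Set.mem_ofPred_eq, ← mem_occurrences, ← hlits] at ho
    obtain ⟨p, hp, rfl⟩ := List.mem_map.1 ho
    exact ⟨p, hN ▸ List.mem_range.1 hp, rfl⟩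

end Parse

/-! ### Sweeps over an array -/

/-- In all memories that differ from `σ` only in the array `a` and in the loop variable, the test
`b` decides `P` at the value of the loop variable. -/
def Test.Decides (b : Test) (a : ℕ) (σ : Memory) (P : ℕ → Prop) : Prop :=
  ∀ (σ' : Memory) (j : ℕ), (∀ x, x ≠ a → x ≠ Arr.inner → σ' x = σ x) → σ' Arr.inner 0 = j →
    (b.eval σ' = true ↔ P j)

/-- `a[j] := v` for `j < e`. -/
def fill (a : ℕ) (e v : Expr) : Program := forLoop Arr.inner e (.assign a (scal Arr.inner) v)

/-- Let `a[i]`, `i < e`, be the number of the `p < numLits` with `key[p] = i` that pass the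
test `b`. -/
def tally (a : ℕ) (e : Expr) (key : ℕ) (b : Test) : Program :=
  fill a e (.const 0) ;;
  forLoop Arr.inner (scal Arr.numLits)
    (.ite b (.assign a (entry key Arr.inner) (.succ (.get a (entry key Arr.inner)))) .skip)

/-- Let `a[v]` be nonzero if `v = minMarked[c]` for some clause `c` that passes the test `b`. -/
def collect (a : ℕ) (b : Test) : Program :=
  fill a numVars (.const 0) ;;
  forLoop Arr.inner numClauses
    (.ite b (.assign a (entry Arr.minMarked Arr.inner) (.const 1)) .skip)

/-- Reset `ok` if some `j < e` passes the test `b`. -/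
def rejectIf (e : Expr) (b : Test) : Program :=
  forLoop Arr.inner e (.ite b (setScal Arr.ok (.const 0)) .skip)

section Sweeps

variable {a key n m N L w : ℕ} {e v : Expr} {b : Test} {σ : Memory} {P : ℕ → Prop}

theorem preserves_forLoop {x : ℕ} {p : Program} {as : List ℕ}
    (hp : ∀ y, y ≠ a → p.touches y = false) (has : ∀ y ∈ as, y ≠ a ∧ y ≠ x) :
    (forLoop x e p).preserves as = true := by
  refine List.all_eq_true.2 fun y hy => ?_
  rw [Bool.not_eq_true', touches_forLoop]
  exact ⟨(has y hy).2, hp y (has y hy).1⟩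

theorem touches_assign {i : Expr} : ∀ y, y ≠ a → (Program.assign a i v).touches y = false :=
  fun y hy => by simpa [Program.touches] using hy

theorem touches_ite_assign {i : Expr} :
    ∀ y, y ≠ a → (Program.ite b (.assign a i v) .skip).touches y = false :=
  fun y hy => by simpa [Program.touches] using hy

theorem Frame.of_forLoop {x : ℕ} {p : Program} {σ' : Memory} (h : Frame (forLoop x e p) σ σ')
    (hp : ∀ y, y ≠ a → p.touches y = false) : ∀ y, y ≠ a → y ≠ x → σ' y = σ y :=
  fun y hya hyx => h y (touches_forLoop.2 ⟨hyx, hp y hya⟩)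

theorem exec_fill (he : e.eval σ = L) (hv : v.eval σ = w) (ha : a ≠ Arr.inner := by decide)
    (hae : ∀ y ∈ e.arrays ++ v.arrays, y ≠ a ∧ y ≠ Arr.inner := by decide) :
    Exec (fill a e v) σ (L * 3 + 2) [] fun σ' => ∀ i < L, σ' a i = w := by
  refine (Exec.forLoop_straight (I := fun j σ' => ∀ i < j, σ' a i = w) he (by simp)
    (fun j _ σ' hσ' hx hf i hi => ?_) (fun j σ' u hσ' => by rwa [store_of_ne ha]) rfl
    (preserves_forLoop touches_assign fun y hy => hae y (List.mem_append_left _ hy))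
    (touches_assign _ ha.symm)).mono le_rfl fun _ h _ => h
  have hv' : v.eval σ' = w := hv ▸ Expr.eval_congr fun y hy =>
    let hy' := hae y (List.mem_append_right _ hy)
    hf.of_forLoop touches_assign y hy'.1 hy'.2
  rcases Nat.lt_succ_iff_lt_or_eq.1 hi with hi | rfl
  · simp [hx, hi.ne, hσ' i hi]
  · simp [hx, hv']

theorem exec_tally [DecidablePred P] (he : e.eval σ = L) (hN : σ Arr.numLits 0 = N)
    (hb : b.Decides a σ P)
    (ha : ∀ y ∈ Arr.inner :: Arr.numLits :: key :: e.arrays, y ≠ a := by decide)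
    (hi : ∀ y ∈ Arr.numLits :: key :: e.arrays, y ≠ Arr.inner := by decide) :
    Exec (tally a e key b) σ (L * 3 + N * 4 + 4) [] fun σ' =>
      ∀ i < L, σ' a i = Nat.count (fun p => σ key p = i ∧ P p) N := by
  simp only [List.forall_mem_cons] at ha hi
  obtain ⟨hai, haN, hak, hae⟩ := ha
  obtain ⟨hiN, hik, hie⟩ := hi
  refine ((exec_fill (w := 0) he rfl hai.symm fun y hy => ?_).seq (t' := N * 4 + 2)
    fun σ₁ hfill hf => ?_).mono (by omega) fun _ h _ => h
  · rw [Expr.arrays, List.append_nil] at hy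
    exact ⟨hae y hy, hie y hy⟩
  have hf₁ := hf.of_forLoop touches_assign
  refine (Exec.forLoop_straight
    (I := fun j σ' => ∀ i < L, σ' a i = Nat.count (fun p => σ key p = i ∧ P p) j)
    (by rw [eval_scal, hf₁ _ haN hiN, hN]) (by simpa using hfill)
    (fun j _ σ' hσ' hx hf' i hi => ?_) (fun j σ' u hσ' => by rwa [store_of_ne hai.symm]) rfl
    (preserves_forLoop touches_ite_assign (by simp [scal, Expr.arrays, haN]))
    (touches_ite_assign _ hai)).mono le_rfl fun _ h _ => h
  have hσ : ∀ y, y ≠ a → y ≠ Arr.inner → σ' y = σ y := fun y hya hyi =>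
    (hf'.of_forLoop touches_ite_assign y hya hyi).trans (hf₁ y hya hyi)
  by_cases hP : P j
  · rcases eq_or_ne (σ key j) i with rfl | hji
    · simp [(hb σ' j hσ hx).2 hP, Nat.count_succ, hx, hσ key hak hik, hP, hσ' _ hi]
    · simp [(hb σ' j hσ hx).2 hP, Nat.count_succ, hx, hσ key hak hik, hji, hji.symm, hσ' i hi]
  · simp [mt (hb σ' j hσ hx).1 hP, Nat.count_succ, hP, hσ' i hi]

theorem exec_collect (hn : σ Arr.input 0 = n) (hm : σ Arr.input 1 = m) (hb : b.Decides a σ P)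
    (ha : ∀ y ∈ [Arr.inner, Arr.input, Arr.minMarked], y ≠ a := by decide) :
    Exec (collect a b) σ (n * 3 + m * 4 + 4) [] fun σ' =>
      ∀ v < n, σ' a v ≠ 0 ↔ ∃ c < m, P c ∧ σ Arr.minMarked c = v := by
  simp only [List.forall_mem_cons] at ha
  obtain ⟨hai, hain, hamin, -⟩ := ha
  have harr : ∀ y ∈ [Arr.input], y ≠ a ∧ y ≠ Arr.inner := by simp [hain]
  refine ((exec_fill (w := 0) (by exact hn) rfl hai.symm (by exact harr)).seq (t' := m * 4 + 2)
    fun σ₁ hfill hf => ?_).mono (by omega) fun _ h _ => h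
  have hf₁ := hf.of_forLoop touches_assign
  refine (Exec.forLoop_straight
    (I := fun j σ' => ∀ v < n, σ' a v ≠ 0 ↔ ∃ c < j, P c ∧ σ Arr.minMarked c = v)
    (by rw [eval_numClauses, hf₁ _ hain (by decide), hm])
    (fun v hv => by simpa using hfill v hv)
    (fun j _ σ' hσ' hx hf' v hv => ?_) (fun j σ' u hσ' => by rwa [store_of_ne hai.symm]) rfl
    (preserves_forLoop touches_ite_assign (by exact harr))
    (touches_ite_assign _ hai)).mono le_rfl fun _ h _ => h
  have hσ : ∀ y, y ≠ a → y ≠ Arr.inner → σ' y = σ y := fun y hya hyi =>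
    (hf'.of_forLoop touches_ite_assign y hya hyi).trans (hf₁ y hya hyi)
  rw [Nat.exists_lt_succ_right, ← hσ' v hv]
  by_cases hP : P j
  · rcases eq_or_ne (σ Arr.minMarked j) v with rfl | hjv
    · simp [(hb σ' j hσ hx).2 hP, hx, hσ _ hamin, hP]
    · simp [(hb σ' j hσ hx).2 hP, hx, hσ _ hamin, hjv, hjv.symm]
  · simp [mt (hb σ' j hσ hx).1 hP, hP]

theorem exec_rejectIf (he : e.eval σ = L) (hb : b.Decides Arr.ok σ P)
    (hae : ∀ y ∈ e.arrays, y ≠ Arr.ok ∧ y ≠ Arr.inner := by decide) :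
    Exec (rejectIf e b) σ (L * 4 + 2) [] fun σ' =>
      σ' Arr.ok 0 ≠ 0 ↔ σ Arr.ok 0 ≠ 0 ∧ ∀ j < L, ¬ P j := by
  refine (Exec.forLoop_straight
    (I := fun d σ' => σ' Arr.ok 0 ≠ 0 ↔ σ Arr.ok 0 ≠ 0 ∧ ∀ j < d, ¬ P j) he (by simp)
    (fun j _ σ' hσ' hx hf => ?_)
    (he := preserves_forLoop touches_ite_assign hae)).mono le_rfl fun _ h _ => h
  have hσ := hf.of_forLoop (a := Arr.ok) touches_ite_assign
  rw [Nat.forall_lt_succ_right, ← and_assoc, ← hσ']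
  by_cases hP : P j
  · simp [(hb σ' j hσ hx).2 hP, hP]
  · simp [mt (hb σ' j hσ hx).1 hP, hP]

end Sweeps

/-! ### Candidate sets and marks -/

/-- The first `M` entries of the arrays `parent` and `value` describe the sets `cand x`, `x < M`. -/
structure CandTable (M : ℕ) (cand : ℕ → Finset ℕ) (σ : Memory) : Prop where
  cand_zero : cand 0 = ∅
  parent_lt : ∀ x < M, x ≠ 0 → σ Arr.parent x < M
  value_notMem : ∀ x < M, x ≠ 0 → σ Arr.value x ∉ cand (σ Arr.parent x)
  cand_eq : ∀ x < M, x ≠ 0 → cand x = insert (σ Arr.value x) (cand (σ Arr.parent x))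

theorem CandTable.congr {M : ℕ} {cand : ℕ → Finset ℕ} {σ σ' : Memory} (h : CandTable M cand σ)
    (hp : σ' Arr.parent = σ Arr.parent) (hv : σ' Arr.value = σ Arr.value) :
    CandTable M cand σ' := by
  constructor
  · exact h.cand_zero
  all_goals simp only [hp, hv]
  exacts [h.parent_lt, h.value_notMem, h.cand_eq]

theorem CandTable.sdiff_parent {M y : ℕ} {cand : ℕ → Finset ℕ} {σ : Memory} {A : Finset ℕ}
    (h : CandTable M cand σ) (hy : y < M) (hy0 : y ≠ 0) (hsub : cand y ⊆ A) :
    A \ cand (σ Arr.parent y) = insert (σ Arr.value y) (A \ cand y) := by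
  rw [h.cand_eq y hy hy0] at hsub ⊢
  rw [Finset.sdiff_insert, Finset.insert_erase (Finset.mem_sdiff.2
    ⟨hsub (Finset.mem_insert_self ..), h.value_notMem y hy hy0⟩)]

/-- Run `p` once for every element `value[cursor]` of the candidate set whose number is initially
stored in `cursor`. -/
def forEachElt (p : Program) : Program :=
  .while (.lt (.const 0) (scal Arr.cursor)) (p ;; setScal Arr.cursor (entry Arr.parent Arr.cursor))

theorem Exec.forEachElt {M x : ℕ} {cand : ℕ → Finset ℕ} {σ : Memory} {p : Program}
    {I : Finset ℕ → Memory → Prop} (hT : CandTable M cand σ) (hx : σ Arr.cursor 0 = x)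
    (hxM : x < M) (h0 : I ∅ σ)
    (hstep : ∀ S v σ', I S σ' → Frame (forEachElt p) σ σ' → v ∈ cand x → v ∉ S →
      σ' Arr.value (σ' Arr.cursor 0) = v → I (insert v S) (p.eff σ'))
    (hI : ∀ S σ' y, I S σ' → I S (store σ' Arr.cursor 0 y) := by exact fun _ _ _ h => h)
    (hp : p.straight = true := by rfl)
    (hpres : (Dualization.forEachElt p).preserves [Arr.parent, Arr.value] = true := by rfl)
    (hcur : p.touches Arr.cursor = false := by rfl) :
    Exec (forEachElt p) σ ((cand x).card * (p.cost + 2) + 1) [] (I (cand x)) := by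
  set body := p ;; setScal Arr.cursor (entry Arr.parent Arr.cursor) with hbody
  have hstraight : body.straight = true := by simpa [hbody, Program.straight, setScal] using hp
  have htouch : ∀ a ∈ [Arr.parent, Arr.value], (Dualization.forEachElt p).touches a = false :=
    fun a ha => Program.touches_of_preserves hpres ha
  simp only [List.forall_mem_cons] at htouch
  obtain ⟨hpar, hval, -⟩ := htouch
  refine (while_of_measure (t := body.cost) (I := fun r σ' =>
    Frame (Dualization.forEachElt p) σ σ' ∧ ∃ y < M, σ' Arr.cursor 0 = y ∧ (cand y).card = r ∧
      cand y ⊆ cand x ∧ I (cand x \ cand y) σ') ?_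
    ⟨fun _ _ => rfl, x, hxM, hx, rfl, subset_rfl, by simpa⟩).mono le_rfl ?_
  · rintro r σ' ⟨hf, y, hyM, hy, rfl, hsub, hIy⟩ hpos
    have hy0 : y ≠ 0 := by
      rintro rfl
      simp [hy] at hpos
    have hT' : CandTable M cand σ' := hT.congr (hf _ hpar) (hf _ hval)
    have heq := hT'.cand_eq y hyM hy0
    have hnot := hT'.value_notMem y hyM hy0
    have hmem : σ' Arr.value y ∈ cand y := heq ▸ Finset.mem_insert_self ..
    refine (of_eff hstraight ⟨(cand (σ' Arr.parent y)).card, ?_, fun a ha => ?_,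
      σ' Arr.parent y, hT'.parent_lt y hyM hy0, ?_, rfl, ?_, ?_⟩).mono le_rfl fun _ h _ => h
    · rw [heq, Finset.card_insert_of_notMem hnot]
      exact Nat.lt_succ_self _
    · exact (Program.frame_eff hstraight σ' a ha).trans (hf a ha)
    · have hpar' : p.touches Arr.parent = false := (Bool.or_eq_false_iff.1 hpar).1
      simp [hbody, Program.frame_eff hp σ' _ hcur, Program.frame_eff hp σ' _ hpar', hy]
    · exact (heq ▸ Finset.subset_insert ..).trans hsub
    · rw [hT'.sdiff_parent hyM hy0 hsub]
      exact hI _ _ _ (hstep _ _ _ hIy hf (hsub hmem) (by simp [hmem]) (by rw [hy]))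
  · rintro σ' ⟨hexit, -, -, y, -, hy, -, -, hIy⟩ -
    have hy0 : y = 0 := by simpa [hy] using hexit
    rwa [hy0, hT.cand_zero, Finset.sdiff_empty] at hIy

/-- The memory contains the data that the depth-first search relies on: the clauses, their layers,
and the table of the candidate sets. -/
structure SearchData (k n m N M : ℕ) (E : ℕ → Finset ℕ) (lv : ℕ → ℕ) (cand : ℕ → Finset ℕ)
    (σ : Memory) : Prop where
  input : Input n m N E σ
  isLayering : IsLayering k (Finset.range m) E lv
  layer_eq : ∀ c < m, σ Arr.layer c = lv c
  table : CandTable M cand σ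
  tableSize_eq : σ Arr.tableSize 0 = M
  bijOn : Set.BijOn cand (Set.Iio M) (smallSubsets k (Finset.range n))

namespace SearchData

variable {k n m N M : ℕ} {E : ℕ → Finset ℕ} {lv : ℕ → ℕ} {cand : ℕ → Finset ℕ} {σ σ' : Memory}

theorem of_frame (h : SearchData k n m N M E lv cand σ) {p : Program} (hf : Frame p σ σ')
    (hp : p.preserves [Arr.input, Arr.lit, Arr.cls, Arr.numLits, Arr.layer, Arr.parent, Arr.value,
      Arr.tableSize] = true := by rfl) :
    SearchData k n m N M E lv cand σ' := by
  have hpres : ∀ a ∈ [Arr.input, Arr.lit, Arr.cls, Arr.numLits, Arr.layer, Arr.parent, Arr.value,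
      Arr.tableSize], p.touches a = false := fun a ha => Program.touches_of_preserves hp ha
  have hin : p.preserves [Arr.input, Arr.lit, Arr.cls, Arr.numLits] = true :=
    List.all_eq_true.2 fun a ha => by simp [hpres a (List.mem_append_left _ ha)]
  constructor
  · exact h.input.of_frame hf hin
  · exact h.isLayering
  · rw [hf _ (hpres _ (by simp))]
    exact h.layer_eq
  · exact h.table.congr (hf _ (hpres _ (by simp))) (hf _ (hpres _ (by simp)))
  · rw [hf _ (hpres _ (by simp)), h.tableSize_eq]
  · exact h.bijOn

theorem card_cand_le (h : SearchData k n m N M E lv cand σ) {x : ℕ} (hx : x < M) :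
    (cand x).card ≤ k :=
  (h.bijOn.mapsTo hx).2

theorem lt_of_mem_cand (h : SearchData k n m N M E lv cand σ) {x v : ℕ} (hx : x < M)
    (hv : v ∈ cand x) : v < n :=
  Finset.mem_range.1 ((h.bijOn.mapsTo hx).1 hv)

end SearchData

/-- The list `[a (i - 1), …, a 0]`. -/
def path (a : ℕ → ℕ) : ℕ → List ℕ
  | 0 => []
  | i + 1 => a i :: path a i

@[simp]
theorem length_path (a : ℕ → ℕ) (i : ℕ) : (path a i).length = i := by
  induction i with
  | zero => rfl
  | succ i ih => rw [path, List.length_cons, ih]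

theorem SearchData.lt_of_mem_chosen_path {k n m N M : ℕ} {E : ℕ → Finset ℕ} {lv : ℕ → ℕ}
    {cand : ℕ → Finset ℕ} {σ : Memory} (h : SearchData k n m N M E lv cand σ) {a : ℕ → ℕ} {i : ℕ}
    (ha : ∀ j < i, a j < M) {v : ℕ} (hv : v ∈ chosen cand (path a i)) : v < n := by
  induction i with
  | zero => simp [path, chosen] at hv
  | succ i ih =>
    rcases Finset.mem_union.1 hv with hv | hv
    · exact ih (fun j hj => ha j (by omega)) hv
    · exact h.lt_of_mem_cand (ha i (by omega)) hv

/-- Mark the elements of the current node with `1`. -/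
def markNode : Program :=
  fill Arr.mark numVars (.const 0) ;;
  forLoop Arr.outer (scal Arr.depth)
    (setScal Arr.cursor (entry Arr.choice Arr.outer) ;;
      forEachElt (.assign Arr.mark (entry Arr.value Arr.cursor) (.const 1)))

/-- Mark the elements of the current candidate with `2`, and check that it is disjoint from the
current node. -/
def markCandidate : Program :=
  setScal Arr.ok (.const 1) ;; setScal Arr.cursor (entry Arr.choice Arr.depth) ;;
  forEachElt (.ite (.eq (.get Arr.mark (entry Arr.value Arr.cursor)) (.const 0))
    (.assign Arr.mark (entry Arr.value Arr.cursor) (.const 2)) (setScal Arr.ok (.const 0)))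

section Marks

variable {k n m N M : ℕ} {E : ℕ → Finset ℕ} {lv : ℕ → ℕ} {cand : ℕ → Finset ℕ} {σ : Memory}
  {T : Finset ℕ}

theorem exec_markNode (h : SearchData k n m N M E lv cand σ)
    (hlt : ∀ j < σ Arr.depth 0, σ Arr.choice j < M) :
    Exec markNode σ (n * 3 + σ Arr.depth 0 * (k * 3 + 4) + 4) [] fun σ' => ∀ v < n,
      σ' Arr.mark v = if v ∈ chosen cand (path (σ Arr.choice) (σ Arr.depth 0)) then 1 else 0 := by
  refine ((exec_fill (by exact h.input.numVars_eq) rfl).seq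
    (t' := σ Arr.depth 0 * (k * 3 + 4) + 2) fun σ₁ hfill hf => ?_).mono (by omega) fun _ h _ => h
  refine (Exec.forLoop (I := fun j σ' => ∀ v < n,
    σ' Arr.mark v = if v ∈ chosen cand (path (σ Arr.choice) j) then 1 else 0)
    (by rw [eval_scal, hf _ rfl]) (by simpa [path, chosen] using hfill) ?_).mono
    le_rfl fun _ h _ => h
  intro j hj σ₂ hmark hj' hf₂
  have hT : CandTable M cand (store σ₂ Arr.cursor 0 (σ₂ Arr.choice (σ₂ Arr.outer 0))) :=
    h.table.congr (by simp [hf₂ Arr.parent rfl, hf Arr.parent rfl])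
      (by simp [hf₂ Arr.value rfl, hf Arr.value rfl])
  refine (Exec.eff_seq rfl (Exec.forEachElt (x := σ Arr.choice j) (I := fun S σ' => ∀ v < n,
    σ' Arr.mark v = if v ∈ chosen cand (path (σ Arr.choice) j) ∪ S then 1 else 0) (by exact hT) ?_
    (hlt j hj) ?_ ?_)).mono ?_ fun _ h _ => h
  · simp [hf₂ Arr.choice rfl, hf Arr.choice rfl, hj']
  · simpa using hmark
  · intro S v σ₃ hmark _ _ _ hv u hu
    rcases eq_or_ne u v with rfl | huv <;> simp_all
  · have := Nat.mul_le_mul_right 3 (h.card_cand_le (hlt j hj))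
    simp only [Program.cost, setScal]
    omega

theorem exec_markCandidate (h : SearchData k n m N M E lv cand σ)
    (hlt : σ Arr.choice (σ Arr.depth 0) < M)
    (hmark : ∀ v < n, σ Arr.mark v = if v ∈ T then 1 else 0) :
    Exec markCandidate σ (k * 4 + 3) [] fun σ' =>
      (∀ v < n, σ' Arr.mark v =
        if v ∈ T then 1 else if v ∈ cand (σ Arr.choice (σ Arr.depth 0)) then 2 else 0) ∧
      (σ' Arr.ok 0 ≠ 0 ↔ Disjoint T (cand (σ Arr.choice (σ Arr.depth 0)))) := by
  set x := σ Arr.choice (σ Arr.depth 0) with hx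
  refine (Exec.eff_seq rfl (Exec.eff_seq rfl (Exec.forEachElt (M := M) (cand := cand)
    (I := fun S σ' => (∀ v < n, σ' Arr.mark v = if v ∈ T then 1 else if v ∈ S then 2 else 0) ∧
      (σ' Arr.ok 0 ≠ 0 ↔ Disjoint T S)) ?_ (x := x) ?_ hlt ?_ ?_))).mono ?_ fun _ h _ => h
  · exact h.table.congr (by simp (disch := decide)) (by simp (disch := decide))
  · simp (disch := decide) [hx]
  · simpa (disch := decide) using hmark
  · rintro S v σ₃ ⟨hmark, hok⟩ _ hvx hvS hv
    have hvn := h.lt_of_mem_cand hlt hvx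
    have hmv := hmark v hvn
    rw [if_neg hvS] at hmv
    rw [Finset.disjoint_insert_right]
    by_cases hvT : v ∈ T
    · have hmark' (u) (hu : u < n) :
          σ₃ Arr.mark u = if u ∈ T then 1 else if u = v ∨ u ∈ S then 2 else 0 := by
        rcases eq_or_ne u v with rfl | huv <;> simp [hmark u hu, *]
      simp only [hvT, if_true] at hmv
      simpa (disch := decide) [hv, hmv, hvT] using hmark'
    · have hmark' (u) (hu : u < n) : Function.update (σ₃ Arr.mark) v 2 u =
          if u ∈ T then 1 else if u = v ∨ u ∈ S then 2 else 0 := by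
        rcases eq_or_ne u v with rfl | huv <;> simp [hmark u hu, *]
      simp only [hvT, if_false] at hmv
      simpa (disch := decide) [hv, hmv, hvT, hok] using hmark'
  · have := Nat.mul_le_mul_right 4 (h.card_cand_le hlt)
    simp only [Program.cost, setScal, max_self]
    omega

end Marks

/-! ### The test for children -/

/-- The occurrence `inner` is a marked element smaller than `minMarked` of its clause. -/
def isSmallerMark : Test :=
  .and (.lt (.const 0) (.get Arr.mark (entry Arr.lit Arr.inner)))
    (.lt (entry Arr.lit Arr.inner) (.get Arr.minMarked (entry Arr.cls Arr.inner)))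

/-- Let `minMarked[c]` be the least marked element of the clause `c`, if there is one. -/
def minMarks : Program :=
  fill Arr.minMarked numClauses numVars ;;
  forLoop Arr.inner (scal Arr.numLits)
    (.ite isSmallerMark
      (.assign Arr.minMarked (entry Arr.cls Arr.inner) (entry Arr.lit Arr.inner)) .skip)

/-- Count the marked elements of every clause, and those that belong to the current node, and
compute `minMarked`. -/
def countMarks : Program :=
  tally Arr.countAll numClauses Arr.cls
    (.lt (.const 0) (.get Arr.mark (entry Arr.lit Arr.inner))) ;;
  tally Arr.countOld numClauses Arr.cls
    (.eq (.get Arr.mark (entry Arr.lit Arr.inner)) (.const 1)) ;;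
  minMarks

/-- Find the elements with a private edge in the layers up to the current one, and those of the
current node with a private edge in the lower layers. -/
def findWitnesses : Program :=
  collect Arr.witness (.and (.lt (entry Arr.layer Arr.inner) (.succ (scal Arr.depth)))
    (.eq (entry Arr.countAll Arr.inner) (.const 1))) ;;
  collect Arr.witnessOld (.and (.lt (entry Arr.layer Arr.inner) (scal Arr.depth))
    (.eq (entry Arr.countOld Arr.inner) (.const 1)))

/-- Reset `ok` if some edge is missed or some marked element lacks its private edge. -/
def checkMarks : Program :=
  rejectIf numClauses (.and (.lt (entry Arr.layer Arr.inner) (.succ (scal Arr.depth)))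
    (.eq (entry Arr.countAll Arr.inner) (.const 0))) ;;
  rejectIf numVars (.and (.lt (.const 0) (entry Arr.mark Arr.inner))
    (.eq (entry Arr.witness Arr.inner) (.const 0))) ;;
  rejectIf numVars (.and (.eq (entry Arr.mark Arr.inner) (.const 1))
    (.eq (entry Arr.witnessOld Arr.inner) (.const 0)))

/-- Decide whether the elements marked with `2` are a child of those marked with `1`. -/
def checkChild : Program := countMarks ;; findWitnesses ;; checkMarks

/-- Let `ok` be nonzero if and only if the current candidate is a child of the current node. -/
def test : Program := markNode ;; markCandidate ;; checkChild

section Test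

variable {k n m N M : ℕ} {E : ℕ → Finset ℕ} {lv : ℕ → ℕ} {cand : ℕ → Finset ℕ} {σ : Memory}
  {T S : Finset ℕ}

theorem setOf_lt_succ_and_of_pos {P : ℕ → Prop} {j : ℕ} (hj : P j) :
    {p | p < j + 1 ∧ P p} = insert j {p | p < j ∧ P p} := by
  ext p
  change p < j + 1 ∧ P p ↔ p = j ∨ p < j ∧ P p
  grind

theorem setOf_lt_succ_and_of_neg {P : ℕ → Prop} {j : ℕ} (hj : ¬ P j) :
    {p | p < j + 1 ∧ P p} = {p | p < j ∧ P p} := by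
  ext p
  change p < j + 1 ∧ P p ↔ p < j ∧ P p
  grind

theorem exec_minMarks (h : Input n m N E σ) :
    Exec minMarks σ (m * 3 + N * 4 + 4) [] fun σ' => ∀ c < m,
      ({v ∈ E c | σ Arr.mark v ≠ 0}).Nonempty →
        IsLeast ↑{v ∈ E c | σ Arr.mark v ≠ 0} (σ' Arr.minMarked c) := by
  refine ((exec_fill (by exact h.numClauses_eq) (by exact h.numVars_eq)).seq (t' := N * 4 + 2)
    fun σ₁ hfill hf => ?_).mono (by omega) fun _ h _ => h
  refine (Exec.forLoop_straight (I := fun j σ' => ∀ c < m, IsLeast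
      (insert n (σ Arr.lit '' {p | p < j ∧ σ Arr.cls p = c ∧ σ Arr.mark (σ Arr.lit p) ≠ 0}))
      (σ' Arr.minMarked c)) (by rw [eval_scal, hf _ rfl, h.numLits_eq])
    (fun c hc => by simp [hfill c hc]) ?_).mono le_rfl ?_
  · intro j _ σ' hmin hj hf' c hc
    have hlit : σ' Arr.lit = σ Arr.lit := (hf' _ rfl).trans (hf _ rfl)
    have hcls : σ' Arr.cls = σ Arr.cls := (hf' _ rfl).trans (hf _ rfl)
    have hmark : σ' Arr.mark = σ Arr.mark := (hf' _ rfl).trans (hf _ rfl)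
    have hcond : isSmallerMark.eval σ' = true ↔ σ Arr.mark (σ Arr.lit j) ≠ 0 ∧
        σ Arr.lit j < σ' Arr.minMarked (σ Arr.cls j) := by
      simp [isSmallerMark, hlit, hcls, hmark, hj, Nat.pos_iff_ne_zero]
    by_cases hP : σ Arr.cls j = c ∧ σ Arr.mark (σ Arr.lit j) ≠ 0
    · rw [setOf_lt_succ_and_of_pos hP, Set.image_insert_eq, Set.insert_comm]
      refine (congrArg _ ?_).mp ((hmin c hc).insert (σ Arr.lit j))
      by_cases hlt : σ Arr.lit j < σ' Arr.minMarked c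
      · simp [hcond.2 ⟨hP.2, by rwa [hP.1]⟩, hlit, hcls, hj, hP.1, hlt.le]
      · simp [mt hcond.1 fun h => hlt (hP.1 ▸ h.2), not_lt.1 hlt]
    · rw [setOf_lt_succ_and_of_neg hP]
      convert hmin c hc using 1
      by_cases hb : isSmallerMark.eval σ' = true
      · have hjc : c ≠ σ Arr.cls j := fun h => hP ⟨h.symm, (hcond.1 hb).1⟩
        simp [hb, hcls, hj, hjc]
      · simp [hb]
  · intro σ' hmin _ c hc hne
    obtain ⟨hmem, hle⟩ := h.image_lit_setOf hc (σ Arr.mark · ≠ 0) ▸ hmin c hc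
    refine ⟨hmem.resolve_left fun heq => ?_, fun v hv => hle (.inr hv)⟩
    obtain ⟨v, hv⟩ := hne
    exact (h.edge_lt c hc v (Finset.mem_filter.1 hv).1).not_ge (heq ▸ hle (.inr hv))

theorem exec_countMarks (h : Input n m N E σ)
    (hmark : ∀ v < n, σ Arr.mark v = if v ∈ T then 1 else if v ∈ S then 2 else 0) :
    Exec countMarks σ (m * 9 + N * 12 + 12) [] fun σ' =>
      (∀ c < m, σ' Arr.countAll c = (E c ∩ (T ∪ S)).card) ∧
      (∀ c < m, σ' Arr.countOld c = (E c ∩ T).card) ∧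
      ∀ c < m, (E c ∩ (T ∪ S)).Nonempty → IsLeast ↑(E c ∩ (T ∪ S)) (σ' Arr.minMarked c) := by
  have hall (c) (hc : c < m) : {v ∈ E c | σ Arr.mark v ≠ 0} = E c ∩ (T ∪ S) := by
    ext v
    grind [h.edge_lt c hc v]
  have hold (c) (hc : c < m) : {v ∈ E c | σ Arr.mark v = 1} = E c ∩ T := by
    ext v
    grind [h.edge_lt c hc v]
  refine ((exec_tally (P := fun p => σ Arr.mark (σ Arr.lit p) ≠ 0) (by exact h.numClauses_eq)
      h.numLits_eq fun σ' j h hj => by simp (disch := decide) [h, hj, Nat.pos_iff_ne_zero]).seq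
    (t' := m * 6 + N * 8 + 8) fun σ₁ h₁ hf₁ => ?_).mono (by omega) fun _ h _ => h
  have hin₁ := h.of_frame hf₁
  refine ((exec_tally (P := fun p => σ₁ Arr.mark (σ₁ Arr.lit p) = 1) (by exact hin₁.numClauses_eq)
      hin₁.numLits_eq fun σ' j h hj => by simp (disch := decide) [h, hj]).seq
    (t' := m * 3 + N * 4 + 4) fun σ₂ h₂ hf₂ => ?_).mono (by omega) fun _ h _ => h
  refine (exec_minMarks (hin₁.of_frame hf₂)).mono le_rfl fun σ₃ h₃ hf₃ => ?_
  simp only [hf₂ Arr.mark rfl, hf₁ Arr.mark rfl] at h₃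
  refine ⟨fun c hc => ?_, fun c hc => ?_, fun c hc => ?_⟩
  · rw [hf₃ _ rfl, hf₂ _ rfl, h₁ c hc, h.count_cls (fun v => σ Arr.mark v ≠ 0) hc, hall c hc]
  · rw [hf₃ _ rfl, h₂ c hc, hin₁.count_cls (fun v => σ₁ Arr.mark v = 1) hc, hf₁ _ rfl, hold c hc]
  · simpa only [hall c hc] using h₃ c hc

theorem eq_singleton_iff_card_eq_one {A : Finset ℕ} {l v : ℕ} (hl : A.Nonempty → IsLeast ↑A l) :
    A = {v} ↔ A.card = 1 ∧ l = v := by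
  rw [Finset.card_eq_one]
  refine ⟨fun h => ⟨⟨v, h⟩, ?_⟩, ?_⟩
  · have hl' := (hl (h ▸ Finset.singleton_nonempty v)).1
    rwa [h, Finset.mem_coe, Finset.mem_singleton] at hl'
  · rintro ⟨⟨w, rfl⟩, rfl⟩
    rw [Finset.mem_singleton.1 (hl (Finset.singleton_nonempty w)).1]

theorem eq_singleton_and_le_iff_card_eq_one {A B : Finset ℕ} {l v : ℕ} (hBA : B ⊆ A)
    (hv : v ∈ A → v ∈ B) (hl : A.Nonempty → IsLeast ↑A l) :
    (B = {v} ∧ ∀ u ∈ A, v ≤ u) ↔ B.card = 1 ∧ l = v := by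
  rw [Finset.card_eq_one]
  constructor
  · rintro ⟨rfl, hmin⟩
    have hvA : v ∈ A := hBA (Finset.mem_singleton_self v)
    have hl := hl ⟨v, hvA⟩
    exact ⟨⟨v, rfl⟩, le_antisymm (hl.2 hvA) (hmin _ hl.1)⟩
  · rintro ⟨⟨w, rfl⟩, rfl⟩
    have hl := hl ⟨w, hBA (Finset.mem_singleton_self w)⟩
    exact ⟨by rw [Finset.mem_singleton.1 (hv hl.1)], fun u hu => hl.2 hu⟩

theorem isChild_iff_counts {ι : Type*} {s : Finset ι} {E : ι → Finset ℕ}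
    {lv lv' all old least : ι → ℕ} {i : ℕ} (hlv : ∀ c ∈ s, lv' c = lv c)
    (hall : ∀ c ∈ s, all c = (E c ∩ (T ∪ S)).card)
    (hold : ∀ c ∈ s, old c = (E c ∩ T).card)
    (hleast : ∀ c ∈ s, (E c ∩ (T ∪ S)).Nonempty → IsLeast ↑(E c ∩ (T ∪ S)) (least c)) :
    IsChild s E lv i T S ↔ Disjoint T S ∧ (∀ c ∈ s, lv' c < i + 1 → all c ≠ 0) ∧
      (∀ v ∈ T ∪ S, ∃ c ∈ s, (lv' c < i + 1 ∧ all c = 1) ∧ least c = v) ∧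
      ∀ v ∈ T, ∃ c ∈ s, (lv' c < i ∧ old c = 1) ∧ least c = v := by
  have hlayer (j c) : c ∈ layersBelow s lv j ↔ c ∈ s ∧ lv' c < j := by
    rw [mem_layersBelow]
    exact and_congr_right fun hc => by rw [hlv c hc]
  have hsingle : ∀ c ∈ s, ∀ v, E c ∩ (T ∪ S) = {v} ↔ all c = 1 ∧ least c = v := fun c hc v => by
    rw [eq_singleton_iff_card_eq_one (hleast c hc), hall c hc]
  have hgreedy : ∀ c ∈ s, ∀ v ∈ T, (E c ∩ T = {v} ∧ ∀ u ∈ E c ∩ (T ∪ S), v ≤ u) ↔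
      old c = 1 ∧ least c = v := fun c hc v hv => by
    rw [hold c hc]
    exact eq_singleton_and_le_iff_card_eq_one
      (Finset.inter_subset_inter_left Finset.subset_union_left)
      (fun h => Finset.mem_inter.2 ⟨(Finset.mem_inter.1 h).1, hv⟩) (hleast c hc)
  have hhit : IsTransversal (layersBelow s lv (i + 1)) E (T ∪ S) ↔
      ∀ c ∈ s, lv' c < i + 1 → all c ≠ 0 := by
    simp only [IsTransversal, hlayer, and_imp]
    exact forall₂_congr fun c hc => by rw [hall c hc, Finset.card_ne_zero]
  have hpriv : (∀ v ∈ T ∪ S, ∃ c ∈ layersBelow s lv (i + 1), E c ∩ (T ∪ S) = {v}) ↔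
      ∀ v ∈ T ∪ S, ∃ c ∈ s, (lv' c < i + 1 ∧ all c = 1) ∧ least c = v := by
    simp only [hlayer, and_assoc]
    exact forall₂_congr fun v _ => exists_congr fun c => and_congr_right fun hc =>
      and_congr_right fun _ => hsingle c hc v
  have hgr : IsGreedyIn (layersBelow s lv i) E T (T ∪ S) ↔
      ∀ v ∈ T, ∃ c ∈ s, (lv' c < i ∧ old c = 1) ∧ least c = v := by
    simp only [IsGreedyIn, hlayer, and_assoc]
    exact forall₂_congr fun v hv => exists_congr fun c => and_congr_right fun hc =>
      and_congr_right fun _ => hgreedy c hc v hv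
  rw [← hhit, ← hpriv, ← hgr]
  exact ⟨fun h => ⟨h.disjoint, h.isMinTransversal.isTransversal, h.isMinTransversal.exists_private,
    h.isGreedyIn⟩, fun h => ⟨h.1, ⟨h.2.1, h.2.2.1⟩, h.2.2.2⟩⟩

theorem exec_findWitnesses (hn : σ Arr.input 0 = n) (hm : σ Arr.input 1 = m) :
    Exec findWitnesses σ (n * 6 + m * 8 + 8) [] fun σ' =>
      (∀ v < n, σ' Arr.witness v ≠ 0 ↔ ∃ c < m, (σ Arr.layer c < σ Arr.depth 0 + 1 ∧
        σ Arr.countAll c = 1) ∧ σ Arr.minMarked c = v) ∧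
      ∀ v < n, σ' Arr.witnessOld v ≠ 0 ↔ ∃ c < m, (σ Arr.layer c < σ Arr.depth 0 ∧
        σ Arr.countOld c = 1) ∧ σ Arr.minMarked c = v := by
  refine ((exec_collect (P := fun c => σ Arr.layer c < σ Arr.depth 0 + 1 ∧ σ Arr.countAll c = 1)
      hn hm fun σ' j h hj => by simp (disch := decide) [h, hj]).seq
    (t' := n * 3 + m * 4 + 4) fun σ₁ h₁ hf₁ => ?_).mono (by omega) fun _ h _ => h
  refine (exec_collect (P := fun c => σ Arr.layer c < σ Arr.depth 0 ∧ σ Arr.countOld c = 1)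
      (by rw [hf₁ _ rfl, hn]) (by rw [hf₁ _ rfl, hm]) fun σ' j h hj => by
        simp (disch := decide) [h, hj, hf₁ Arr.layer rfl, hf₁ Arr.depth rfl,
          hf₁ Arr.countOld rfl]).mono le_rfl fun σ₂ h₂ hf₂ => ⟨?_, ?_⟩
  · rwa [hf₂ _ rfl]
  · rwa [hf₁ Arr.minMarked rfl] at h₂

theorem exec_checkMarks (hn : σ Arr.input 0 = n) (hm : σ Arr.input 1 = m) :
    Exec checkMarks σ (n * 8 + m * 4 + 6) [] fun σ' => σ' Arr.ok 0 ≠ 0 ↔ σ Arr.ok 0 ≠ 0 ∧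
      (∀ c < m, σ Arr.layer c < σ Arr.depth 0 + 1 → σ Arr.countAll c ≠ 0) ∧
      (∀ v < n, σ Arr.mark v ≠ 0 → σ Arr.witness v ≠ 0) ∧
      ∀ v < n, σ Arr.mark v = 1 → σ Arr.witnessOld v ≠ 0 := by
  refine ((exec_rejectIf (P := fun c => σ Arr.layer c < σ Arr.depth 0 + 1 ∧ σ Arr.countAll c = 0)
      (by exact hm) fun σ' j h hj => by simp (disch := decide) [h, hj]).seq
    (t' := n * 8 + 4) fun σ₁ h₁ hf₁ => ?_).mono (by omega) fun _ h _ => h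
  refine ((exec_rejectIf (L := n) (P := fun v => σ Arr.mark v ≠ 0 ∧ σ Arr.witness v = 0)
      (by rw [eval_numVars, hf₁ Arr.input rfl, hn]) fun σ' j h hj => by
        simp (disch := decide) [h, hj, hf₁ Arr.mark rfl, hf₁ Arr.witness rfl,
          Nat.pos_iff_ne_zero]).seq
    (t' := n * 4 + 2) fun σ₂ h₂ hf₂ => ?_).mono (by omega) fun _ h _ => h
  have hf₂₀ := hf₁.seq hf₂
  refine (exec_rejectIf (L := n) (P := fun v => σ Arr.mark v = 1 ∧ σ Arr.witnessOld v = 0)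
    (by rw [eval_numVars, hf₂₀ Arr.input rfl, hn]) fun σ' j h hj => by
      simp (disch := decide) [h, hj, hf₂₀ Arr.mark rfl, hf₂₀ Arr.witnessOld rfl]).mono
    le_rfl fun σ₃ h₃ _ => ?_
  simpa only [h₂, h₁, not_and, and_assoc] using h₃

theorem forall_lt_imp_iff_forall_mem {A : Finset ℕ} {P Q R : ℕ → Prop} (hA : ∀ v ∈ A, v < n)
    (hP : ∀ v < n, P v ↔ v ∈ A) (hQ : ∀ v < n, Q v ↔ R v) :
    (∀ v < n, P v → Q v) ↔ ∀ v ∈ A, R v :=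
  ⟨fun h v hv => (hQ v (hA v hv)).1 (h v (hA v hv) ((hP v (hA v hv)).2 hv)),
    fun h v hvn hv => (hQ v hvn).2 (h v ((hP v hvn).1 hv))⟩

theorem exec_checkChild (h : Input n m N E σ) (hlv : ∀ c < m, σ Arr.layer c = lv c)
    (hT : ∀ v ∈ T, v < n) (hS : ∀ v ∈ S, v < n)
    (hmark : ∀ v < n, σ Arr.mark v = if v ∈ T then 1 else if v ∈ S then 2 else 0)
    (hok : σ Arr.ok 0 ≠ 0 ↔ Disjoint T S) :
    Exec checkChild σ (n * 14 + m * 21 + N * 12 + 26) [] fun σ' =>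
      σ' Arr.ok 0 ≠ 0 ↔ IsChild (Finset.range m) E lv (σ Arr.depth 0) T S := by
  refine ((exec_countMarks h hmark).seq
    (t' := n * 14 + m * 12 + 14) fun σ₁ ⟨hall, hold, hmin⟩ hf₁ => ?_).mono (by omega) fun _ h _ => h
  have hin₁ := h.of_frame hf₁
  refine ((exec_findWitnesses hin₁.numVars_eq hin₁.numClauses_eq).seq
    (t' := n * 8 + m * 4 + 6) fun σ₂ ⟨hwit, hwitOld⟩ hf₂ => ?_).mono (by omega) fun _ h _ => h
  have hin₂ := hin₁.of_frame hf₂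
  refine (exec_checkMarks hin₂.numVars_eq hin₂.numClauses_eq).mono le_rfl fun σ₃ h₃ _ => ?_
  have hfmark : σ₂ Arr.mark = σ Arr.mark := (hf₂ _ rfl).trans (hf₁ _ rfl)
  rw [hf₁ Arr.layer rfl, hf₁ Arr.depth rfl] at hwit hwitOld
  rw [h₃, hfmark, hf₂ Arr.ok rfl, hf₁ Arr.ok rfl, hok, hf₂ Arr.depth rfl, hf₁ Arr.depth rfl,
    hf₂ Arr.countAll rfl, hf₂ Arr.layer rfl, hf₁ Arr.layer rfl,
    isChild_iff_counts (lv' := σ Arr.layer) (by simpa using hlv) (by simpa using hall)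
      (by simpa using hold) (by simpa using hmin)]
  simp only [Finset.mem_range]
  refine and_congr_right fun _ => and_congr Iff.rfl (and_congr
    (forall_lt_imp_iff_forall_mem (fun v hv => (Finset.mem_union.1 hv).elim (hT v) (hS v))
      (fun v hv => ?_) hwit)
    (forall_lt_imp_iff_forall_mem hT (fun v hv => ?_) hwitOld))
  all_goals
    rw [hmark v hv]
    split_ifs <;> simp [*]

theorem exec_test (h : SearchData k n m N M E lv cand σ)
    (hlt : ∀ j ≤ σ Arr.depth 0, σ Arr.choice j < M) :
    Exec test σ (n * 17 + m * 21 + N * 12 + (σ Arr.depth 0 + 1) * (k * 4 + 4) + 40) [] fun σ' =>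
      σ' Arr.ok 0 ≠ 0 ↔ IsCandChild (Finset.range m) E lv cand
        (path (σ Arr.choice) (σ Arr.depth 0)) (σ Arr.choice (σ Arr.depth 0)) := by
  refine ((exec_markNode h fun j hj => hlt j hj.le).seq
    (t' := n * 14 + m * 21 + N * 12 + k * 4 + 29) fun σ₁ h₁ hf₁ => ?_).mono
    (by nlinarith) fun _ h _ => h
  have hd₁ := h.of_frame hf₁
  have hdepth₁ : σ₁ Arr.depth 0 = σ Arr.depth 0 := by rw [hf₁ _ rfl]
  have hchoice₁ : σ₁ Arr.choice = σ Arr.choice := hf₁ _ rfl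
  refine ((exec_markCandidate hd₁ (by rw [hdepth₁, hchoice₁]; exact hlt _ le_rfl) h₁).seq
    (t' := n * 14 + m * 21 + N * 12 + 26) fun σ₂ ⟨hmark, hok⟩ hf₂ => ?_).mono
    (by omega) fun _ h _ => h
  rw [hdepth₁, hchoice₁] at hmark hok
  have hd₂ := hd₁.of_frame hf₂
  refine (exec_checkChild hd₂.input hd₂.layer_eq
    (fun _ => h.lt_of_mem_chosen_path fun j hj => hlt j hj.le)
    (fun _ => h.lt_of_mem_cand (hlt _ le_rfl)) hmark hok).mono le_rfl fun σ₃ h₃ _ => ?_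
  rw [h₃, IsCandChild, length_path, hf₂ _ rfl, hdepth₁]

end Test

/-! ### Finding the layers -/

/-- The layers from `i` on have been determined, and the edges without a layer, whose layer number
is `n`, have at most `i` vertices. -/
structure IsPartialLayering {ι α : Type*} [DecidableEq α] (k n : ℕ) (s : Finset ι)
    (E : ι → Finset α) (i : ℕ) (lv : ι → ℕ) : Prop where
  le : ∀ c ∈ s, i ≤ lv c ∧ lv c ≤ n
  card_le : ∀ j < n, {c ∈ s | lv c = j}.card ≤ k
  exists_pivot : ∀ c₀ ∈ s, lv c₀ < n →
    ∃ y, ∀ c ∈ s, lv c ≤ lv c₀ ∨ lv c = n → (y ∈ E c ↔ lv c = lv c₀)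
  card_biUnion_le : ({c ∈ s | lv c = n}.biUnion E).card ≤ i

theorem card_biUnion_filter_notMem_lt {ι α : Type*} [DecidableEq α] {s : Finset ι}
    {E : ι → Finset α} {y : α} (hne : {c ∈ s | y ∈ E c}.Nonempty) :
    ({c ∈ s | y ∉ E c}.biUnion E).card < (s.biUnion E).card := by
  obtain ⟨c, hc⟩ := hne
  obtain ⟨hcs, hyc⟩ := Finset.mem_filter.1 hc
  refine Finset.card_lt_card ((Finset.ssubset_iff_of_subset
    (Finset.biUnion_subset_biUnion_of_subset_left _ (Finset.filter_subset ..))).2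
    ⟨y, Finset.mem_biUnion.2 ⟨c, hcs, hyc⟩, ?_⟩)
  simp

namespace IsPartialLayering

variable {ι α : Type*} [DecidableEq α] {k n i : ℕ} {s : Finset ι} {E : ι → Finset α}
  {lv lv' : ι → ℕ}

theorem of_layer_eq (hlv : ∀ c ∈ s, lv c = n) (hcard : (s.biUnion E).card ≤ n) :
    IsPartialLayering k n s E n lv where
  le c hc := by simp [hlv c hc]
  card_le j hj := by
    rw [Finset.filter_eq_empty_iff.2 fun c hc => (hlv c hc).trans_ne hj.ne']
    exact Nat.zero_le k
  exists_pivot c hc hlt := absurd (hlv c hc) hlt.ne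
  card_biUnion_le := by rwa [Finset.filter_true_of_mem hlv]

theorem of_filter_eq_empty (h : IsPartialLayering k n s E (i + 1) lv)
    (hempty : {c ∈ s | lv c = n} = ∅) (hlv : ∀ c ∈ s, lv' c = lv c) :
    IsPartialLayering k n s E i lv' := by
  have hfilter (j) : {c ∈ s | lv' c = j} = {c ∈ s | lv c = j} :=
    Finset.filter_congr fun c hc => by rw [hlv c hc]
  constructor
  · intro c hc
    have := h.le c hc
    rw [hlv c hc]
    omega
  · simpa only [hfilter] using h.card_le
  · intro c₀ hc₀ hlt
    rw [hlv c₀ hc₀] at hlt ⊢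
    obtain ⟨y, hy⟩ := h.exists_pivot c₀ hc₀ hlt
    exact ⟨y, fun c hc => by rw [hlv c hc]; exact hy c hc⟩
  · simp [hfilter, hempty]

theorem assign (h : IsPartialLayering k n s E (i + 1) lv) (hi : i < n) {y : α}
    (hne : {c ∈ {c ∈ s | lv c = n} | y ∈ E c}.Nonempty)
    (hcard : {c ∈ {c ∈ s | lv c = n} | y ∈ E c}.card ≤ k)
    (hlv : ∀ c ∈ s, lv' c = if lv c = n ∧ y ∈ E c then i else lv c) :
    IsPartialLayering k n s E i lv' := by
  have hnew : ∀ c ∈ s, lv' c = i ↔ lv c = n ∧ y ∈ E c := fun c hc => by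
    have := h.le c hc
    rw [hlv c hc]
    grind
  have hold : ∀ c ∈ s, ∀ j, j ≠ i → j ≠ n → (lv' c = j ↔ lv c = j) := fun c hc j hji hjn => by
    rw [hlv c hc]
    grind
  have hrest : ∀ c ∈ s, lv' c = n ↔ lv c = n ∧ y ∉ E c := fun c hc => by
    rw [hlv c hc]
    grind
  constructor
  · intro c hc
    have := h.le c hc
    rw [hlv c hc]
    split_ifs <;> omega
  · intro j hj
    rcases eq_or_ne j i with rfl | hji
    · rwa [Finset.filter_congr hnew, ← Finset.filter_filter]
    · rw [Finset.filter_congr fun c hc => hold c hc j hji hj.ne]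
      exact h.card_le j hj
  · intro c₀ hc₀ hlt
    by_cases hc₀i : lv' c₀ = i
    · refine ⟨y, fun c hc hcn => ?_⟩
      have := h.le c hc
      grind
    · have hlv₀ := (hold c₀ hc₀ _ hc₀i hlt.ne).1 rfl
      obtain ⟨z, hz⟩ := h.exists_pivot c₀ hc₀ (hlv₀ ▸ hlt)
      refine ⟨z, fun c hc hcn => ?_⟩
      have := h.le c hc
      have := h.le c₀ hc₀
      have := hz c hc
      grind
  · rw [Finset.filter_congr hrest, ← Finset.filter_filter]
    exact Nat.le_of_lt_succ ((card_biUnion_filter_notMem_lt hne).trans_le h.card_biUnion_le)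

theorem step (h : IsPartialLayering k n s E (i + 1) lv) (hi : i < n) {y : α}
    (hy : {c ∈ s | lv c = n}.Nonempty → {c ∈ {c ∈ s | lv c = n} | y ∈ E c}.Nonempty ∧
      {c ∈ {c ∈ s | lv c = n} | y ∈ E c}.card ≤ k)
    (hlv : ∀ c ∈ s, lv' c = if lv c = n ∧ y ∈ E c then i else lv c) :
    IsPartialLayering k n s E i lv' := by
  rcases Finset.eq_empty_or_nonempty {c ∈ s | lv c = n} with hempty | hne
  · refine h.of_filter_eq_empty hempty fun c hc => ?_
    rw [hlv c hc, if_neg fun hcn => Finset.filter_eq_empty_iff.1 hempty hc hcn.1]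
  · exact h.assign hi (hy hne).1 (hy hne).2 hlv

theorem lt (h : IsPartialLayering k n s E 0 lv) (hE : ∀ c ∈ s, (E c).Nonempty) :
    ∀ c ∈ s, lv c < n := by
  refine fun c hc => lt_of_le_of_ne (h.le c hc).2 fun hn => ?_
  have hempty := Finset.card_eq_zero.1 (Nat.le_zero.1 h.card_biUnion_le)
  obtain ⟨v, hv⟩ := hE c hc
  exact Finset.notMem_empty v
    (hempty ▸ Finset.mem_biUnion.2 ⟨c, Finset.mem_filter.2 ⟨hc, hn⟩, hv⟩)

theorem isLayering (h : IsPartialLayering k n s E 0 lv) (hE : ∀ c ∈ s, (E c).Nonempty) :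
    IsLayering k s E lv := by
  constructor
  · intro j
    rcases lt_or_ge j n with hj | hj
    · exact h.card_le j hj
    · rw [Finset.filter_eq_empty_iff.2 fun c hc => ((h.lt hE c hc).trans_le hj).ne]
      exact Nat.zero_le k
  · intro c₀ hc₀
    obtain ⟨y, hy⟩ := h.exists_pivot c₀ hc₀ (h.lt hE c₀ hc₀)
    exact ⟨y, fun c hc hle => hy c hc (.inl hle)⟩

end IsPartialLayering

/-- Find a vertex whose `degree` is positive and at most `k`. -/
def pickPivot (k : ℕ) : Program :=
  forLoop Arr.inner numVars
    (.ite (.and (.lt (.const 0) (entry Arr.degree Arr.inner))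
        (.lt (entry Arr.degree Arr.inner) (.const (k + 1))))
      (setScal Arr.pivot (scal Arr.inner)) .skip)

/-- Put the clauses without a layer that contain `pivot` into the layer `depth`. -/
def assignLayer : Program :=
  forLoop Arr.inner (scal Arr.numLits)
    (.ite (.and (.eq (entry Arr.lit Arr.inner) (scal Arr.pivot))
        (.eq (entry₂ Arr.layer Arr.cls Arr.inner) numVars))
      (.assign Arr.layer (entry Arr.cls Arr.inner) (scal Arr.depth)) .skip)

/-- Determine the layer `depth`, when the higher ones are known. -/
def findLayer (k : ℕ) : Program :=
  tally Arr.degree numVars Arr.lit (.eq (entry₂ Arr.layer Arr.cls Arr.inner) numVars) ;;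
  pickPivot k ;; assignLayer

/-- Determine the layers from the last one to the first one. -/
def findLayers (k : ℕ) : Program :=
  fill Arr.layer numClauses numVars ;; setScal Arr.depth numVars ;;
  forLoop Arr.outer numVars (setScal Arr.depth (.pred (scal Arr.depth)) ;; findLayer k)

section FindLayers

variable {k n m N i : ℕ} {E : ℕ → Finset ℕ} {lv : ℕ → ℕ} {σ : Memory}

theorem exec_pickPivot (hn : σ Arr.input 0 = n) :
    Exec (pickPivot k) σ (n * 4 + 2) [] fun σ' =>
      (∃ v < n, 0 < σ Arr.degree v ∧ σ Arr.degree v ≤ k) →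
        ∃ v < n, σ' Arr.pivot 0 = v ∧ 0 < σ Arr.degree v ∧ σ Arr.degree v ≤ k := by
  refine Exec.forLoop_straight (I := fun j σ' =>
      (∃ v < j, 0 < σ Arr.degree v ∧ σ Arr.degree v ≤ k) →
        ∃ v < n, σ' Arr.pivot 0 = v ∧ 0 < σ Arr.degree v ∧ σ Arr.degree v ≤ k)
    (by exact hn) (by simp) fun j hjn σ' hσ' hj hf => ?_
  have hdeg : σ' Arr.degree = σ Arr.degree := hf _ rfl
  rw [Program.eff]
  split_ifs with hgood
  · simp only [Test.eval, eval_entry, Expr.eval, hj, hdeg, Bool.and_eq_true, decide_eq_true_eq]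
      at hgood
    exact fun _ => ⟨j, hjn, by simp [hj], by omega⟩
  · simp only [Test.eval, eval_entry, Expr.eval, hj, hdeg, Bool.and_eq_true, decide_eq_true_eq]
      at hgood
    rw [Nat.exists_lt_succ_right, or_iff_left (by omega)]
    exact hσ'

theorem exec_assignLayer (h : Input n m N E σ) :
    Exec assignLayer σ (N * 4 + 2) [] fun σ' => ∀ c < m, σ' Arr.layer c =
      if σ Arr.layer c = n ∧ σ Arr.pivot 0 ∈ E c then σ Arr.depth 0 else σ Arr.layer c := by
  refine (Exec.forLoop_straight (I := fun j σ' => ∀ c < m, σ' Arr.layer c =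
      if σ Arr.layer c = n ∧ ∃ p < j, σ Arr.cls p = c ∧ σ Arr.lit p = σ Arr.pivot 0
      then σ Arr.depth 0 else σ Arr.layer c)
    (by exact h.numLits_eq) (by simp) fun j hj σ' hσ' hj' hf => ?_).mono le_rfl ?_
  · intro c hc
    have hlayer := hσ' _ (h.cls_lt hj)
    have hlit : σ' Arr.lit = σ Arr.lit := hf _ rfl
    have hcls : σ' Arr.cls = σ Arr.cls := hf _ rfl
    have hpivot : σ' Arr.pivot = σ Arr.pivot := hf _ rfl
    have hdepth : σ' Arr.depth = σ Arr.depth := hf _ rfl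
    simp only [Program.eff, Nat.exists_lt_succ_right]
    by_cases hgood : σ Arr.lit j = σ Arr.pivot 0 ∧ σ' Arr.layer (σ Arr.cls j) = n
    · rw [if_pos (by simpa [hj', hlit, hcls, hpivot, (h.of_frame hf).numVars_eq] using hgood)]
      rcases eq_or_ne c (σ Arr.cls j) with rfl | hcj
      · simp [hj', hcls, hdepth]
        grind
      · simp [hj', hcls, hcj, hcj.symm, hσ' c hc]
    · rw [if_neg (by simpa [hj', hlit, hcls, hpivot, (h.of_frame hf).numVars_eq] using hgood),
        hσ' c hc]
      refine if_congr (and_congr_right fun hn => ⟨.inl, fun hp => ?_⟩) rfl rfl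
      rcases hp with hp | ⟨rfl, hlit_j⟩
      · exact hp
      · by_contra hnone
        exact hgood ⟨hlit_j, by rw [hlayer, if_neg fun hp => hnone hp.2, hn]⟩
  · intro σ' hσ' _ c hc
    rw [hσ' c hc]
    refine if_congr (and_congr_right fun _ => ⟨?_, fun hmem => ?_⟩) rfl rfl
    · rintro ⟨p, hp, rfl, hlit⟩
      exact hlit ▸ h.lit_mem hp
    · obtain ⟨p, hp, hcls, hlit⟩ := h.exists_occurrence hc hmem
      exact ⟨p, hp, hcls, hlit⟩

theorem exec_findLayer (h : Input n m N E σ)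
    (hdeg : IsDegenerateFamily k (Finset.range m) E) (hi : σ Arr.depth 0 = i) (hin : i < n)
    (hL : IsPartialLayering k n (Finset.range m) E (i + 1) (σ Arr.layer)) :
    Exec (findLayer k) σ (n * 7 + N * 8 + 8) [] fun σ' =>
      IsPartialLayering k n (Finset.range m) E i (σ' Arr.layer) := by
  refine ((exec_tally (P := fun p => σ Arr.layer (σ Arr.cls p) = n) (by exact h.numVars_eq)
    h.numLits_eq fun σ' j hσ' hj => by simp (disch := decide) [hσ', hj, h.numVars_eq]).seq
    (t' := n * 4 + N * 4 + 4) fun σ₁ h₁ hf₁ => ?_).mono (by omega) fun _ h _ => h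
  have hin₁ := h.of_frame hf₁
  refine ((exec_pickPivot hin₁.numVars_eq).seq
    (t' := N * 4 + 2) fun σ₂ h₂ hf₂ => ?_).mono (by omega) fun _ h _ => h
  have hin₂ := hin₁.of_frame hf₂
  refine (exec_assignLayer hin₂).mono le_rfl fun σ₃ h₃ _ => ?_
  rw [hf₂ Arr.layer rfl, hf₁ Arr.layer rfl, hf₂ Arr.depth rfl, hf₁ Arr.depth rfl, hi] at h₃
  refine hL.step hin (fun hne => ?_) fun c hc => h₃ c (Finset.mem_range.1 hc)
  have hdegree (v) (hv : v < n) := (h₁ v hv).trans (h.count_lit (fun c => σ Arr.layer c = n) v)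
  obtain ⟨v, hv, hvk⟩ := hdeg _ (Finset.filter_subset _ _) hne
  have hvn : v < n := by
    obtain ⟨c, hc⟩ := hv
    simp only [Finset.mem_filter, Finset.mem_range] at hc
    exact h.edge_lt c hc.1.1 v hc.2
  obtain ⟨y, hyn, hy, hpos, hle⟩ := h₂ ⟨v, hvn, by
    rw [hdegree v hvn]
    exact ⟨Finset.card_pos.2 hv, hvk⟩⟩
  rw [hdegree y hyn] at hpos hle
  rw [hy]
  exact ⟨Finset.card_pos.1 hpos, hle⟩

theorem exec_findLayers (h : Input n m N E σ) (hdeg : IsDegenerateFamily k (Finset.range m) E) :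
    Exec (findLayers k) σ (m * 3 + n * (n * 7 + N * 8 + 12) + 5) [] fun σ' =>
      σ' Arr.depth 0 = 0 ∧ IsPartialLayering k n (Finset.range m) E 0 (σ' Arr.layer) := by
  refine ((exec_fill (by exact h.numClauses_eq) (by exact h.numVars_eq)).seq
    (t' := n * (n * 7 + N * 8 + 12) + 3) fun σ₁ hfill hf₁ => ?_).mono (by omega) fun _ h _ => h
  have hin₁ := h.of_frame hf₁
  refine (Exec.eff_seq rfl (Exec.forLoop (N := n) (t := n * 7 + N * 8 + 10)
    (I := fun j σ' => σ' Arr.depth 0 = n - j ∧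
      IsPartialLayering k n (Finset.range m) E (n - j) (σ' Arr.layer))
    (by simpa using hin₁.numVars_eq) ⟨by simp [hin₁.numVars_eq], ?_⟩
    fun j hj σ' hσ' _ hf => ?_)).mono ?_ fun σ' hσ' _ => by simpa using hσ'
  · have hlayer : ∀ c ∈ Finset.range m, σ₁ Arr.layer c = n := fun c hc =>
      hfill c (Finset.mem_range.1 hc)
    have hsub : (Finset.range m).biUnion E ⊆ Finset.range n := Finset.biUnion_subset.2
      fun c hc v hv => Finset.mem_range.2 (h.edge_lt c (Finset.mem_range.1 hc) v hv)
    simpa using IsPartialLayering.of_layer_eq (k := k) hlayer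
      ((Finset.card_le_card hsub).trans_eq (Finset.card_range n))
  · have hin' := (hin₁.of_frame (Program.frame_eff rfl σ₁)).of_frame hf
    refine (Exec.eff_seq rfl ((exec_findLayer (i := n - (j + 1))
      (hin'.of_frame (Program.frame_eff rfl σ')) hdeg ?_ (by omega) ?_).mono le_rfl
      fun σ'' hσ'' hf'' => ⟨?_, hσ''⟩)).mono ?_ fun _ h _ => h
    · simp [hσ'.1]
      omega
    · simpa (disch := decide) [show n - (j + 1) + 1 = n - j by omega] using hσ'.2
    · simp +arith [Program.cost, setScal]
    · rw [hf'' Arr.depth rfl]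
      simp [hσ'.1]
      omega
  · simp +arith [Program.cost, setScal]

end FindLayers

/-! ### The table of the candidate sets -/

theorem smallSubsets_insert {α : Type*} [DecidableEq α] {k M : ℕ} {V : Finset α} {v : α}
    {cand : ℕ → Finset α} (h : Set.BijOn cand (Set.Iio M) (smallSubsets k V)) :
    smallSubsets k (insert v V) =
      smallSubsets k V ∪ (fun y => insert v (cand y)) '' {y | y < M ∧ (cand y).card < k} := by
  ext S
  constructor
  · rintro ⟨hS, hSk⟩
    by_cases hv : v ∈ S
    · have hcard : (S.erase v).card + 1 = S.card := Finset.card_erase_add_one hv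
      obtain ⟨y, hy, hye⟩ := h.surjOn ⟨Finset.subset_insert_iff.1 hS, by omega⟩
      exact .inr ⟨y, ⟨hy, by rw [hye]; omega⟩, by simp only [hye, Finset.insert_erase hv]⟩
    · exact .inl ⟨(Finset.subset_insert_iff_of_notMem hv).1 hS, hSk⟩
  · rintro (⟨hS, hSk⟩ | ⟨y, ⟨hy, hyk⟩, rfl⟩)
    · exact ⟨hS.trans (Finset.subset_insert ..), hSk⟩
    · exact ⟨Finset.insert_subset_insert _ (h.mapsTo hy).1, (Finset.card_insert_le ..).trans hyk⟩

theorem le_of_bijOn_smallSubsets {k n M : ℕ} {cand : ℕ → Finset ℕ} {V : Finset ℕ}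
    (h : Set.BijOn cand (Set.Iio M) (smallSubsets k V)) (hV : V.card ≤ n) :
    M ≤ (k + 1) * max 1 n ^ k := by
  calc M = (Finset.range M).card := (Finset.card_range M).symm
    _ ≤ ((Finset.range (k + 1)).biUnion fun i => V.powersetCard i).card := by
      refine Finset.card_le_card_of_injOn cand (fun x hx => ?_) (by simpa using h.injOn)
      obtain ⟨hsub, hle⟩ := h.mapsTo (x := x) (by simpa using hx)
      simpa [Finset.mem_powersetCard, Nat.lt_succ_iff] using And.intro hsub hle
    _ ≤ (Finset.range (k + 1)).card * max 1 n ^ k := by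
      refine Finset.card_biUnion_le_card_mul _ _ _ fun i hi => ?_
      rw [Finset.card_powersetCard]
      exact (Nat.choose_le_pow ..).trans ((Nat.pow_le_pow_left (hV.trans (le_max_right ..)) i).trans
        (Nat.pow_le_pow_right (by omega) (Finset.mem_range_succ_iff.1 hi)))
    _ = (k + 1) * max 1 n ^ k := by rw [Finset.card_range]

theorem CandTable.append {M y v : ℕ} {cand : ℕ → Finset ℕ} {σ σ' : Memory}
    (h : CandTable M cand σ) (hy : y < M) (hv : v ∉ cand y)
    (hp : σ' Arr.parent = Function.update (σ Arr.parent) M y)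
    (hval : σ' Arr.value = Function.update (σ Arr.value) M v) :
    CandTable (M + 1) (Function.update cand M (insert v (cand y))) σ' := by
  have hentry : ∀ x < M + 1, x ≠ 0 → ∃ z < M, σ' Arr.parent x = z ∧ σ' Arr.value x ∉ cand z ∧
      Function.update cand M (insert v (cand y)) x = insert (σ' Arr.value x) (cand z) := by
    intro x hx hx0
    rw [hp, hval]
    rcases Nat.lt_succ_iff_lt_or_eq.1 hx with hx | rfl
    · simp only [Function.update_of_ne hx.ne]
      exact ⟨_, h.parent_lt x hx hx0, rfl, h.value_notMem x hx hx0, h.cand_eq x hx hx0⟩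
    · simp only [Function.update_self]
      exact ⟨y, hy, rfl, hv, rfl⟩
  constructor
  · rw [Function.update_of_ne (by omega), h.cand_zero]
  all_goals
    intro x hx hx0
    obtain ⟨z, hz, hpar, hval, heq⟩ := hentry x hx hx0
    rw [hpar]
  · omega
  · rwa [Function.update_of_ne hz.ne]
  · rwa [Function.update_of_ne hz.ne]

/-- The table in the memory consists of the sets in `A`, each listed once. -/
structure TableOf (A : Set (Finset ℕ)) (M : ℕ) (cand : ℕ → Finset ℕ) (σ : Memory) : Prop where
  table : CandTable M cand σ
  card_eq : ∀ x < M, σ Arr.card x = (cand x).card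
  tableSize_eq : σ Arr.tableSize 0 = M
  bijOn : Set.BijOn cand (Set.Iio M) A

namespace TableOf

variable {A : Set (Finset ℕ)} {M y v : ℕ} {cand : ℕ → Finset ℕ} {σ σ' : Memory}

theorem congr (h : TableOf A M cand σ) (hp : σ' Arr.parent = σ Arr.parent)
    (hv : σ' Arr.value = σ Arr.value) (hc : σ' Arr.card = σ Arr.card)
    (hs : σ' Arr.tableSize = σ Arr.tableSize) : TableOf A M cand σ' :=
  ⟨h.table.congr hp hv, hc ▸ h.card_eq, hs ▸ h.tableSize_eq, h.bijOn⟩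

theorem append (h : TableOf A M cand σ) (hy : y < M) (hv : v ∉ cand y)
    (hA : insert v (cand y) ∉ A) (hs : σ' Arr.tableSize 0 = M + 1)
    (hp : σ' Arr.parent = Function.update (σ Arr.parent) M y)
    (hval : σ' Arr.value = Function.update (σ Arr.value) M v)
    (hc : σ' Arr.card = Function.update (σ Arr.card) M ((cand y).card + 1)) :
    TableOf (insert (insert v (cand y)) A) (M + 1)
      (Function.update cand M (insert v (cand y))) σ' := by
  have hold : ∀ x < M, Function.update cand M (insert v (cand y)) x = cand x :=
    fun x hx => Function.update_of_ne hx.ne ..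
  refine ⟨h.table.append hy hv hp hval, fun x hx => ?_, hs, ?_⟩
  · rw [hc]
    rcases Nat.lt_succ_iff_lt_or_eq.1 hx with hx | rfl
    · rw [hold x hx, Function.update_of_ne hx.ne, h.card_eq x hx]
    · rw [Function.update_self, Function.update_self, Finset.card_insert_of_notMem hv]
  · have hbij := (h.bijOn.congr fun x hx => (hold x hx).symm).insert (a := M)
      (by rwa [Function.update_self])
    rwa [Function.update_self, ← Order.Iio_succ_eq_insert, Nat.succ_eq_succ] at hbij

end TableOf

/-- The sets listed after the first `h` of the sets that `cand` lists have been extended by `v`. -/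
def extended (k : ℕ) (A : Set (Finset ℕ)) (cand : ℕ → Finset ℕ) (v h : ℕ) : Set (Finset ℕ) :=
  A ∪ (fun y => insert v (cand y)) '' {y | y < h ∧ (cand y).card < k}

theorem extended_zero {k : ℕ} {A : Set (Finset ℕ)} {cand : ℕ → Finset ℕ} {v : ℕ} :
    extended k A cand v 0 = A := by
  simp [extended]

theorem extended_succ {k : ℕ} {A : Set (Finset ℕ)} {cand : ℕ → Finset ℕ} {v h : ℕ} :
    extended k A cand v (h + 1) = if (cand h).card < k
      then insert (insert v (cand h)) (extended k A cand v h) else extended k A cand v h := by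
  have hset : {y | y < h + 1 ∧ (cand y).card < k} =
      if (cand h).card < k then insert h {y | y < h ∧ (cand y).card < k}
      else {y | y < h ∧ (cand y).card < k} := by
    ext y
    split_ifs <;> grind
  rw [extended, hset]
  split_ifs
  · rw [Set.image_insert_eq, Set.union_insert, extended]
  · rfl

theorem insert_notMem_extended {k M v h : ℕ} {A : Set (Finset ℕ)} {cand : ℕ → Finset ℕ}
    (hbij : Set.BijOn cand (Set.Iio M) A) (hv : ∀ S ∈ A, v ∉ S) (hh : h < M) :
    insert v (cand h) ∉ extended k A cand v h := by
  rintro (hA | ⟨y, ⟨hy, -⟩, heq⟩)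
  · exact hv _ hA (Finset.mem_insert_self ..)
  · beta_reduce at heq
    have hvy : ∀ x < M, v ∉ cand x := fun x hx => hv _ (hbij.mapsTo hx)
    have hcand : cand y = cand h := by
      rw [← Finset.erase_insert (hvy y (hy.trans hh)), heq, Finset.erase_insert (hvy h hh)]
    exact hy.ne (hbij.injOn (Set.mem_Iio.2 (hy.trans hh)) hh hcand)

/-- Extend the sets of the table with less than `k` elements by the variable `outer`. -/
def extendTable (k : ℕ) : Program :=
  setScal Arr.count (scal Arr.tableSize) ;;
  forLoop Arr.inner (scal Arr.count)
    (.ite (.lt (entry Arr.card Arr.inner) (.const k))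
      (.assign Arr.parent (scal Arr.tableSize) (scal Arr.inner) ;;
       .assign Arr.value (scal Arr.tableSize) (scal Arr.outer) ;;
       .assign Arr.card (scal Arr.tableSize) (.succ (entry Arr.card Arr.inner)) ;;
       setScal Arr.tableSize (.succ (scal Arr.tableSize)))
      .skip)

/-- List the sets of at most `k` variables. -/
def makeTable (k : ℕ) : Program :=
  (setScal Arr.tableSize (.const 1) ;; .assign Arr.card (.const 0) (.const 0)) ;;
  forLoop Arr.outer numVars (extendTable k)

section MakeTable

variable {k n M v : ℕ} {cand : ℕ → Finset ℕ} {σ : Memory}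

theorem exec_extendTable {A : Set (Finset ℕ)} (h : TableOf A M cand σ) (hv : σ Arr.outer 0 = v)
    (hA : ∀ S ∈ A, v ∉ S) :
    Exec (extendTable k) σ (M * 7 + 3) [] fun σ' =>
      ∃ M' cand', TableOf (extended k A cand v M) M' cand' σ' := by
  refine (Exec.eff_seq rfl (Exec.forLoop_straight (N := M)
    (I := fun i σ' => ∃ M' cand', M ≤ M' ∧ (∀ x < M, cand' x = cand x) ∧
      TableOf (extended k A cand v i) M' cand' σ')
    (by simp [h.tableSize_eq]) ⟨M, cand, le_rfl, fun _ _ => rfl, ?_⟩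
    (fun i hi σ' hσ' hi' hf => ?_) ?_)).mono ?_ ?_
  · rw [extended_zero]
    exact h.congr rfl rfl rfl rfl
  · obtain ⟨M', cand', hM, hcand, hT⟩ := hσ'
    have hcard : σ' Arr.card i = (cand i).card := by
      rw [hT.card_eq i (hi.trans_le hM), hcand i hi]
    have houter : σ' Arr.outer 0 = v := by rw [hf Arr.outer rfl, ← hv]; rfl
    have hvi : v ∉ cand i := hA _ (h.bijOn.mapsTo hi)
    by_cases hk : (cand i).card < k
    · refine ⟨M' + 1, Function.update cand' M' (insert v (cand' i)), by omega, fun x hx => ?_, ?_⟩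
      · rw [Function.update_of_ne (hx.trans_le hM).ne, hcand x hx]
      · rw [extended_succ, if_pos hk, ← hcand i hi]
        refine hT.append (hi.trans_le hM) (hcand i hi ▸ hvi)
          (hcand i hi ▸ insert_notMem_extended h.bijOn hA hi) ?_ ?_ ?_ ?_
        all_goals simp (disch := decide) [hi', hcard, hk, houter, hT.tableSize_eq, hcand i hi]
    · refine ⟨M', cand', hM, hcand, ?_⟩
      rw [extended_succ, if_neg hk]
      simpa [hi', hcard, hk] using hT
  · rintro i σ' x ⟨M', cand', hM, hcand, hT⟩
    exact ⟨M', cand', hM, hcand, hT.congr rfl rfl rfl rfl⟩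
  · simp +arith [Program.cost, setScal]
  · rintro σ' ⟨M', cand', -, -, hT⟩ -
    exact ⟨M', cand', hT⟩

theorem exec_makeTable (hn : σ Arr.input 0 = n) :
    Exec (makeTable k) σ (n * ((k + 1) * max 1 n ^ k * 7 + 5) + 4) [] fun σ' =>
      ∃ M cand, TableOf (smallSubsets k (Finset.range n)) M cand σ' := by
  refine (Exec.eff_seq rfl (Exec.forLoop (N := n) (t := (k + 1) * max 1 n ^ k * 7 + 3)
    (I := fun v σ' => ∃ M cand, TableOf (smallSubsets k (Finset.range v)) M cand σ')
    (by simpa using hn) ?_ (fun v hv σ' hσ' hv' _ => ?_)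
    fun _ _ _ ⟨M, cand, hT⟩ => ⟨M, cand, hT.congr rfl rfl rfl rfl⟩)).mono ?_ fun _ h _ => h
  · have hbase : smallSubsets k (Finset.range 0) = {∅} := by
      ext S
      simp +contextual [smallSubsets]
    have hbij : Set.BijOn (fun _ => ∅) (Set.Iio 1) (smallSubsets k (Finset.range 0)) := by
      rw [hbase, Order.Iio_one]
      exact Set.bijOn_singleton.2 rfl
    exact ⟨1, fun _ => ∅, ⟨rfl, by omega, by omega, by omega⟩, by simp +contextual,
      by simp (disch := decide), hbij⟩
  · obtain ⟨M, cand, hT⟩ := hσ'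
    have hM := le_of_bijOn_smallSubsets hT.bijOn (by simpa using hv.le)
    refine (exec_extendTable hT hv' fun S hS hvS => ?_).mono (by omega)
      fun σ'' ⟨M', cand', hT'⟩ _ => ⟨M', cand', ?_⟩
    · simpa using hS.1 hvS
    · rwa [Finset.range_add_one, smallSubsets_insert hT.bijOn]
  · simp +arith [Program.cost, setScal]

end MakeTable

/-! ### The search programs -/

theorem path_congr {a b : ℕ → ℕ} {i : ℕ} (h : ∀ j < i, a j = b j) : path a i = path b i := by
  induction i with
  | zero => rfl
  | succ i ih => rw [path, path, h i (by omega), ih fun j hj => h j (by omega)]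

theorem IsNode.lt_of_path {M i j : ℕ} {child : List ℕ → ℕ → Prop} {a : ℕ → ℕ}
    (h : IsNode M child (path a i)) (hj : j < i) : a j < M := by
  induction i with
  | zero => omega
  | succ i ih =>
    obtain hj | rfl := Nat.lt_succ_iff_lt_or_eq.1 hj
    · exact ih h.2 hj
    · exact (mem_childrenFrom.1 h.1).2.1

/-- The memory contains the search data, and the search has reached the node `st`: its choices are
the first entries of the array `choice`. -/
structure AtNode (k n m N M : ℕ) (E : ℕ → Finset ℕ) (lv : ℕ → ℕ) (cand : ℕ → Finset ℕ)
    (st : List ℕ) (σ : Memory) : Prop where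
  data : SearchData k n m N M E lv cand σ
  isNode : IsNode M (IsCandChild (Finset.range m) E lv cand) st
  path_eq : path (σ Arr.choice) (σ Arr.depth 0) = st
  length_le : st.length ≤ n

/-- Starting with the number `choice[depth]`, look for a child of the current node. If there is one,
move to it and set `ok` to a nonzero value; otherwise set `ok` to `0`. -/
def seek : Program :=
  setScal Arr.ok (.const 0) ;;
  .while (.and (.lt (entry Arr.choice Arr.depth) (scal Arr.tableSize))
      (.eq (scal Arr.ok) (.const 0)))
    (test ;;
      .ite (.eq (scal Arr.ok) (.const 0))
        (.assign Arr.choice (scal Arr.depth) (.succ (entry Arr.choice Arr.depth)))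
        (setScal Arr.depth (.succ (scal Arr.depth))))

/-- Move to the first leaf below the current node. -/
def descend : Program :=
  .while (.lt (scal Arr.depth) numVars)
    (.assign Arr.choice (scal Arr.depth) (.const 0) ;; seek)

/-- Move to the next sibling of the current node or, if there is none, of its closest ancestor that
has one. -/
def backtrack : Program :=
  .while (.and (.lt (.const 0) (scal Arr.depth)) (.eq (scal Arr.ok) (.const 0)))
    (setScal Arr.depth (.pred (scal Arr.depth)) ;;
      .assign Arr.choice (scal Arr.depth) (.succ (entry Arr.choice Arr.depth)) ;; seek)

/-- Move to the next leaf or, if there is none, set `done`. -/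
def nextLeaf : Program :=
  setScal Arr.ok (.const 0) ;; backtrack ;;
  .ite (.eq (scal Arr.ok) (.const 0)) (setScal Arr.done (.const 1)) descend

/-- The time that suffices for `seek`. -/
def seekTime (k n m N M : ℕ) : ℕ := M * (n * (k * 4 + 21) + m * 21 + N * 12 + 43) + 2

section Search

variable {k n m N M x : ℕ} {E : ℕ → Finset ℕ} {lv : ℕ → ℕ} {cand : ℕ → Finset ℕ}
  {st : List ℕ} {σ σ' : Memory}

local notation "child" => IsCandChild (Finset.range m) E lv cand

namespace AtNode

theorem depth_eq (h : AtNode k n m N M E lv cand st σ) : σ Arr.depth 0 = st.length := by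
  rw [← h.path_eq, length_path]

theorem choice_lt (h : AtNode k n m N M E lv cand st σ) {j : ℕ} (hj : j < σ Arr.depth 0) :
    σ Arr.choice j < M :=
  IsNode.lt_of_path (h.path_eq ▸ h.isNode) hj

theorem of_frame (h : AtNode k n m N M E lv cand st σ) {p : Program} (hf : Frame p σ σ')
    (hp : p.preserves [Arr.input, Arr.lit, Arr.cls, Arr.numLits, Arr.layer, Arr.parent, Arr.value,
      Arr.tableSize] = true := by rfl)
    (hnode : p.preserves [Arr.choice, Arr.depth] = true := by rfl) :
    AtNode k n m N M E lv cand st σ' := by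
  refine ⟨h.data.of_frame hf hp, h.isNode, ?_, h.length_le⟩
  rw [hf _ (Program.touches_of_preserves hnode (by simp)),
    hf _ (Program.touches_of_preserves hnode (by simp)), h.path_eq]

theorem store_choice (h : AtNode k n m N M E lv cand st σ) (v : ℕ) :
    AtNode k n m N M E lv cand st (store σ Arr.choice (σ Arr.depth 0) v) := by
  refine ⟨h.data.of_frame (p := .assign Arr.choice (scal Arr.depth) (.const v))
    (Program.frame_eff rfl σ), h.isNode, ?_, h.length_le⟩
  rw [store_of_ne (b := Arr.depth) (by decide), store_self, ← h.path_eq]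
  exact path_congr fun j hj => Function.update_of_ne hj.ne ..

theorem store_depth_succ (h : AtNode k n m N M E lv cand st σ) (hn : st.length < n)
    (hx : σ Arr.choice (σ Arr.depth 0) = x) (hchild : x ∈ childrenFrom M child st 0) :
    AtNode k n m N M E lv cand (x :: st) (store σ Arr.depth 0 (σ Arr.depth 0 + 1)) := by
  refine ⟨h.data.of_frame (p := setScal Arr.depth (.succ (scal Arr.depth)))
    (Program.frame_eff rfl σ), ⟨hchild, h.isNode⟩, ?_, hn⟩
  rw [store_of_ne (by decide), store_self, Function.update_self, path, h.path_eq, hx]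

theorem store_depth_pred (h : AtNode k n m N M E lv cand (x :: st) σ) :
    AtNode k n m N M E lv cand st (store σ Arr.depth 0 (σ Arr.depth 0 - 1)) ∧
      σ Arr.choice (σ Arr.depth 0 - 1) = x := by
  have hpath := h.path_eq
  rw [h.depth_eq, List.length_cons, path, List.cons.injEq] at hpath
  refine ⟨⟨h.data.of_frame (p := setScal Arr.depth (.pred (scal Arr.depth)))
    (Program.frame_eff rfl σ), h.isNode.2, ?_, ?_⟩, ?_⟩
  · rw [store_of_ne (by decide), store_self, Function.update_self, h.depth_eq]
    exact hpath.2
  · have := h.length_le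
    rw [List.length_cons] at this
    omega
  · rw [h.depth_eq]
    exact hpath.1

end AtNode

theorem exec_seek_body (h : AtNode k n m N M E lv cand st σ) (hn : st.length < n)
    (hx : σ Arr.choice (σ Arr.depth 0) = x) (hxM : x < M) :
    Exec (test ;;
      .ite (.eq (scal Arr.ok) (.const 0))
        (.assign Arr.choice (scal Arr.depth) (.succ (entry Arr.choice Arr.depth)))
        (setScal Arr.depth (.succ (scal Arr.depth)))) σ
      (n * (k * 4 + 21) + m * 21 + N * 12 + 42) [] fun σ' =>
        σ' Arr.ok 0 = 0 ∧ ¬ child st x ∧ AtNode k n m N M E lv cand st σ' ∧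
            σ' Arr.choice (σ' Arr.depth 0) = x + 1 ∨
          σ' Arr.ok 0 ≠ 0 ∧ child st x ∧ AtNode k n m N M E lv cand (x :: st) σ' := by
  have hdepth := h.depth_eq
  have hlt : ∀ j ≤ σ Arr.depth 0, σ Arr.choice j < M := fun j hj =>
    hj.lt_or_eq.elim h.choice_lt fun hj => by rwa [hj, hx]
  refine ((exec_test h.data hlt).seq (t' := 2) fun σ₁ hok hf => ?_).mono ?_ fun _ h _ => h
  · rw [h.path_eq, hx] at hok
    have h₁ : AtNode k n m N M E lv cand st σ₁ := h.of_frame hf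
    rw [← hf Arr.choice rfl, ← hf Arr.depth rfl] at hx
    refine Exec.ite (fun hb => .assign (.inl ?_)) (fun hb => .assign (.inr ?_))
    · have hzero : σ₁ Arr.ok 0 = 0 := of_decide_eq_true hb
      refine ⟨by simpa using hzero, fun hc => hok.2 hc hzero, h₁.store_choice _, ?_⟩
      simp [hx]
    · have hne : σ₁ Arr.ok 0 ≠ 0 := of_decide_eq_false hb
      exact ⟨by simpa using hne, hok.1 hne, h₁.store_depth_succ hn hx
        (mem_childrenFrom.2 ⟨Nat.zero_le x, hxM, hok.1 hne⟩)⟩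
  · have : (σ Arr.depth 0 + 1) * (k * 4 + 4) ≤ n * (k * 4 + 4) :=
      Nat.mul_le_mul_right _ (hdepth ▸ hn)
    linarith

theorem exec_seek (h : AtNode k n m N M E lv cand st σ) (hn : st.length < n)
    (hx : σ Arr.choice (σ Arr.depth 0) = x) :
    Exec seek σ (seekTime k n m N M) [] fun σ' =>
      σ' Arr.ok 0 = 0 ∧ AtNode k n m N M E lv cand st σ' ∧ childrenFrom M child st x = [] ∨
        σ' Arr.ok 0 ≠ 0 ∧ ∃ y, AtNode k n m N M E lv cand (y :: st) σ' ∧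
          childrenFrom M child st x = y :: childrenFrom M child st (y + 1) := by
  refine ((Exec.eff_seq rfl (Exec.while_of_measure (r := M - x)
    (t := n * (k * 4 + 21) + m * 21 + N * 12 + 42)
    (I := fun r σ' => (σ' Arr.ok 0 = 0 ∧ AtNode k n m N M E lv cand st σ' ∧
        ∃ y, σ' Arr.choice (σ' Arr.depth 0) = y ∧ r = M - y ∧
          childrenFrom M child st x = childrenFrom M child st y) ∨
      (σ' Arr.ok 0 ≠ 0 ∧ r = 0 ∧ ∃ y, AtNode k n m N M E lv cand (y :: st) σ' ∧
          childrenFrom M child st x = y :: childrenFrom M child st (y + 1))) ?_ ?_))).mono ?_ ?_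
  · rintro r σ' (⟨-, h', y, hy, rfl, hxy⟩ | ⟨hok, -⟩) hb
    · have hyM : y < M := by
        have := (Bool.and_eq_true_iff.1 hb).1
        simpa [h'.data.tableSize_eq, hy] using this
      refine (exec_seek_body h' hn hy hyM).mono le_rfl ?_
      rintro σ'' (⟨hok, hc, h'', hy'⟩ | ⟨hok, hc, h''⟩) -
      · exact ⟨M - (y + 1), by omega, .inl ⟨hok, h'', y + 1, hy', rfl,
          hxy.trans (childrenFrom_succ hyM hc).symm⟩⟩
      · exact ⟨0, by omega, .inr ⟨hok, rfl, y, h'', hxy.trans (childrenFrom_eq_cons hyM hc)⟩⟩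
    · simp [hok] at hb
  · exact .inl ⟨rfl, h.of_frame (Program.frame_eff (p := setScal Arr.ok (.const 0)) rfl σ), x, hx,
      rfl, rfl⟩
  · simp +arith [Program.cost, setScal, seekTime]
  · rintro σ' ⟨hexit, r, ⟨hok, h', y, hy, -, hxy⟩ | ⟨hok, -, hfound⟩⟩ -
    · refine .inl ⟨hok, h', hxy.trans (childrenFrom_eq_nil ?_)⟩
      simpa [hok, h'.data.tableSize_eq, hy] using hexit
    · exact .inr ⟨hok, hfound⟩

theorem exec_descend (h : AtNode k n m N M E lv cand st σ) :
    Exec descend σ (n * (seekTime k n m N M + 2) + 1) [] fun σ' =>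
      ∃ leaf, AtNode k n m N M E lv cand leaf σ' ∧ leaf.length = n ∧
        remainingLeaves M child n leaf = remainingLeaves M child n st := by
  refine (Exec.while_of_measure (r := n - st.length) (t := 1 + seekTime k n m N M)
    (I := fun r σ' => ∃ st', AtNode k n m N M E lv cand st' σ' ∧ r = n - st'.length ∧
      remainingLeaves M child n st' = remainingLeaves M child n st) ?_ ⟨st, h, rfl, rfl⟩).mono ?_ ?_
  · rintro r σ' ⟨st', h', rfl, heq⟩ hb
    have hlt : st'.length < n := by
      simpa [← h'.depth_eq, h'.data.input.numVars_eq] using hb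
    refine (Exec.eff_seq rfl (exec_seek (h'.store_choice 0) hlt (x := 0) ?_)).mono le_rfl ?_
    · simp
    rintro σ'' (⟨-, -, hnil⟩ | ⟨-, x, h'', hcons⟩) -
    · refine (h'.isNode.childrenFrom_ne_nil h'.data.isLayering h'.data.bijOn.surjOn ?_ hnil).elim
      exact Finset.biUnion_subset.2 fun c hc v hv =>
        Finset.mem_range.2 (h'.data.input.edge_lt c (Finset.mem_range.1 hc) v hv)
    · refine ⟨_, ?_, x :: st', h'', rfl, (remainingLeaves_cons hlt hcons).trans heq⟩
      rw [List.length_cons]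
      omega
  · have := Nat.mul_le_mul_right (seekTime k n m N M + 2) (Nat.sub_le n st.length)
    rwa [add_le_add_iff_right, add_comm 1, add_assoc]
  · rintro σ' ⟨hexit, r, leaf, h', -, heq⟩ -
    refine ⟨leaf, h', le_antisymm h'.length_le ?_, heq⟩
    simpa [← h'.depth_eq, h'.data.input.numVars_eq] using hexit

theorem exec_backtrack_body (h : AtNode k n m N M E lv cand (x :: st) σ) :
    Exec (setScal Arr.depth (.pred (scal Arr.depth)) ;;
      .assign Arr.choice (scal Arr.depth) (.succ (entry Arr.choice Arr.depth)) ;; seek) σ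
      (seekTime k n m N M + 2) [] fun σ' =>
        σ' Arr.ok 0 = 0 ∧ AtNode k n m N M E lv cand st σ' ∧
            laterLeaves M child n (x :: st) = laterLeaves M child n st ∨
          σ' Arr.ok 0 ≠ 0 ∧ ∃ st', AtNode k n m N M E lv cand st' σ' ∧
            laterLeaves M child n (x :: st) = remainingLeaves M child n st' := by
  obtain ⟨h', hx⟩ := h.store_depth_pred
  set σ' := store σ Arr.depth 0 (σ Arr.depth 0 - 1) with hσ'
  have heff : (Program.assign Arr.choice (scal Arr.depth) (.succ (entry Arr.choice Arr.depth))).eff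
      ((setScal Arr.depth (.pred (scal Arr.depth))).eff σ) =
        store σ' Arr.choice (σ' Arr.depth 0) (x + 1) := by
    simp (disch := decide) [hσ', hx]
  have hseek := exec_seek (h'.store_choice (x + 1)) h.length_le (x := x + 1)
    (by simp (disch := decide))
  refine (Exec.eff_seq rfl (Exec.eff_seq rfl (heff ▸ hseek))).mono
    (by simp +arith [Program.cost, setScal]) ?_
  rintro σ'' (⟨hok, h'', hnil⟩ | ⟨hok, y, h'', hcons⟩) -
  · exact .inl ⟨hok, h'', laterLeaves_cons_of_eq_nil hnil⟩
  · exact .inr ⟨hok, y :: st, h'', laterLeaves_cons_of_eq_cons hcons⟩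

theorem exec_backtrack (h : AtNode k n m N M E lv cand st σ) (hok : σ Arr.ok 0 = 0) :
    Exec backtrack σ (n * (seekTime k n m N M + 3) + 1) [] fun σ' =>
      σ' Arr.ok 0 = 0 ∧ laterLeaves M child n st = [] ∨
        σ' Arr.ok 0 ≠ 0 ∧ ∃ st', AtNode k n m N M E lv cand st' σ' ∧
          laterLeaves M child n st = remainingLeaves M child n st' := by
  refine (Exec.while_of_measure (r := st.length) (t := seekTime k n m N M + 2)
    (I := fun r σ' => (σ' Arr.ok 0 = 0 ∧ ∃ st', AtNode k n m N M E lv cand st' σ' ∧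
        r = st'.length ∧ laterLeaves M child n st = laterLeaves M child n st') ∨
      (σ' Arr.ok 0 ≠ 0 ∧ ∃ st', AtNode k n m N M E lv cand st' σ' ∧
        r = 0 ∧ laterLeaves M child n st = remainingLeaves M child n st')) ?_
    (.inl ⟨hok, st, h, rfl, rfl⟩)).mono ?_ ?_
  · rintro r σ' (⟨-, st', h', rfl, heq⟩ | ⟨hok, -⟩) hb
    · obtain _ | ⟨x, st'⟩ := st'
      · simp [h'.depth_eq] at hb
      refine (exec_backtrack_body h').mono le_rfl ?_
      rintro σ'' (⟨hok, h'', heq'⟩ | ⟨hok, st'', h'', heq'⟩) -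
      · exact ⟨_, Nat.lt_succ_self _, .inl ⟨hok, st', h'', rfl, heq.trans heq'⟩⟩
      · exact ⟨0, Nat.succ_pos _, .inr ⟨hok, st'', h'', rfl, heq.trans heq'⟩⟩
    · simp [hok] at hb
  · exact Nat.add_le_add_right (Nat.mul_le_mul_right _ h.length_le) 1
  · rintro σ' ⟨hexit, r, ⟨hok, st', h', -, heq⟩ | ⟨hok, st', h', -, heq⟩⟩ -
    · obtain rfl : st' = [] := by simpa [hok, h'.depth_eq] using hexit
      exact .inl ⟨hok, heq⟩
    · exact .inr ⟨hok, st', h', heq⟩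

theorem exec_nextLeaf (h : AtNode k n m N M E lv cand st σ) (hdone : σ Arr.done 0 = 0) :
    Exec nextLeaf σ (n * (seekTime k n m N M + 3) * 2 + 4) [] fun σ' =>
      σ' Arr.done 0 ≠ 0 ∧ laterLeaves M child n st = [] ∨
        σ' Arr.done 0 = 0 ∧ ∃ leaf, AtNode k n m N M E lv cand leaf σ' ∧ leaf.length = n ∧
          laterLeaves M child n st = remainingLeaves M child n leaf := by
  set σ₀ := (setScal Arr.ok (.const 0)).eff σ with hσ₀
  have h₀ : AtNode k n m N M E lv cand st σ₀ := h.of_frame (Program.frame_eff rfl σ)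
  refine (Exec.eff_seq rfl ((exec_backtrack h₀ (by simp [hσ₀])).seq
    (t' := n * (seekTime k n m N M + 3) + 2) fun σ₁ h₁ hf₁ => ?_)).mono ?_ fun _ h _ => h
  · have hdone₁ : σ₁ Arr.done 0 = 0 := by simp (disch := decide) [hf₁ Arr.done rfl, hσ₀, hdone]
    obtain ⟨hok, hnil⟩ | ⟨hok, st', h', heq⟩ := h₁
    · refine (Exec.ite (t := 1) (fun _ => .assign (.inl ⟨by simp, hnil⟩)) fun hb => ?_).mono
        (by omega) fun _ h _ => h
      simp [hok] at hb
    · refine (Exec.ite (fun hb => ?_) fun _ => (exec_descend h').mono (Nat.add_le_add_right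
        (Nat.mul_le_mul_left n (Nat.le_succ _)) 1) ?_)
      · simp [hok] at hb
      · rintro σ₂ ⟨leaf, hleaf, hlen, heq'⟩ hf₂
        exact .inr ⟨by rw [hf₂ Arr.done rfl, hdone₁], leaf, hleaf, hlen, heq.trans heq'.symm⟩
  · simp only [Program.cost, setScal]
    omega

/-! ### Output -/

/-- Write the elements of the current leaf. -/
def output : Program :=
  markNode ;;
  forLoop Arr.inner numVars
    (.ite (.not (.eq (entry Arr.mark Arr.inner) (.const 0))) (.write (scal Arr.inner)) .skip)

/-- Output all leaves, starting with the current one. -/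
def enumerate : Program :=
  .while (.eq (scal Arr.done) (.const 0)) (.seq output (.seq .endItem nextLeaf))

theorem exec_output (h : AtNode k n m N M E lv cand st σ) :
    Exec output σ (n * (k * 3 + 11) + 6)
      ((List.range n).filter fun v => v ∈ chosen cand st) fun _ => True := by
  refine ((exec_markNode h.data fun j => h.choice_lt).seq (t' := n * (2 + 2) + 2)
    (w' := (List.range n).filter fun v => v ∈ chosen cand st) fun σ₁ h₁ hf => ?_).mono ?_
    fun _ h _ => h
  · rw [h.path_eq] at h₁
    rw [← List.filterMap_eq_filter, List.filterMap_eq_flatMap_toList]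
    refine (Exec.forLoop_output (t := 2) (I := fun _ σ' => σ' Arr.mark = σ₁ Arr.mark)
      (by exact (h.data.input.of_frame hf).numVars_eq) rfl (fun v hv σ' hmark hv' _ => ?_)
      (by exact fun _ _ _ h => h) rfl rfl).mono le_rfl fun _ _ _ => trivial
    by_cases hmem : v ∈ chosen cand st
    · refine Exec.ite (fun _ => ?_) fun hb => ?_
      · simpa [hmem, hv'] using
          Exec.write (Q := fun σ' => σ' Arr.mark = σ₁ Arr.mark) (e := scal Arr.inner) hmark
      · simp [hmark, hv', h₁ v hv, hmem] at hb
    · refine Exec.ite (fun hb => ?_) fun _ => ?_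
      · simp [hmark, hv', h₁ v hv, hmem] at hb
      · simpa [Option.guard, hmem] using Exec.skip (Q := fun σ' => σ' Arr.mark = σ₁ Arr.mark) hmark
  · have := Nat.mul_le_mul_right (k * 3 + 4) (h.depth_eq.trans_le h.length_le)
    linarith

theorem enumerates_enumerate {leaf : List ℕ} {s D : ℕ} {items : List (List ℕ)}
    (h : AtNode k n m N M E lv cand leaf σ) (hlen : leaf.length = n) (hdone : σ Arr.done 0 = 0)
    (hD : s + (n * (k * 3 + 11) + 8) ≤ D)
    (hD' : n * (k * 3 + 11) + n * (seekTime k n m N M + 3) * 2 + 12 ≤ D)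
    (hitems : remainingLeaves M child n leaf = items) :
    Enumerates enumerate σ s D
      (items.map fun st => (List.range n).filter fun v => v ∈ chosen cand st) := by
  induction items generalizing leaf σ s with
  | nil => simp [remainingLeaves_of_length_eq hlen] at hitems
  | cons leaf' items ih =>
    rw [remainingLeaves_of_length_eq hlen, List.cons.injEq] at hitems
    obtain ⟨rfl, hlater⟩ := hitems
    refine Enumerates.while_cons (decide_eq_true hdone) (exec_output h) (fun σ₁ _ hf => ?_)
      (by omega)
    refine Enumerates.seq (exec_nextLeaf (h.of_frame hf) (by rw [hf Arr.done rfl, hdone]))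
      fun σ₂ h₂ _ => ?_
    obtain ⟨hdone₂, hnil⟩ | ⟨hdone₂, leaf', h', hlen', heq⟩ := h₂
    · obtain rfl : items = [] := hlater.symm.trans hnil
      exact Enumerates.while_nil (decide_eq_false hdone₂) (by omega)
    · exact ih h' hlen' hdone₂ (by omega) (heq.symm.trans hlater)

end Search

/-! ### The dualization program -/

/-- Compute the layers and the candidate sets, and move to the first leaf of the tree. -/
def prepare (k : ℕ) : Program := findLayers k ;; makeTable k ;; descend

/-- Output the minimal transversals of the listed CNF. An empty clause has no transversals. -/
def dualize (k : ℕ) : Program :=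
  parse ;; .ite (.eq (scal Arr.hasEmpty) (.const 0)) (prepare k ;; enumerate) .skip

section Listing

variable {k n M : ℕ} {φ ψ : MonotoneCNF n} {L : List (List (Fin n))} {lv : ℕ → ℕ}
  {cand : ℕ → Finset ℕ}

theorem map_toFinset_filter_finRange {T : Finset ℕ} (hT : T ⊆ Finset.range n) :
    ((List.finRange n).filter fun v => v.val ∈ T).toFinset.map Fin.valEmbedding = T := by
  ext v
  simp only [Finset.mem_map, List.mem_toFinset, List.mem_filter, List.mem_finRange, true_and,
    decide_eq_true_eq, Fin.valEmbedding_apply]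
  exact ⟨fun ⟨_, hi, hv⟩ => hv ▸ hi, fun hv => ⟨⟨v, Finset.mem_range.1 (hT hv)⟩, hv, rfl⟩⟩

theorem map_val_filter_finRange (T : Finset ℕ) :
    ((List.finRange n).filter fun v => v.val ∈ T).map Fin.val =
      (List.range n).filter fun v => v ∈ T := by
  rw [← List.map_coe_finRange_eq_range, List.filter_map]
  rfl

theorem biUnion_listedEdge_subset :
    (Finset.range L.length).biUnion (listedEdge L) ⊆ Finset.range n := by
  refine Finset.biUnion_subset.2 fun c _ v hv => ?_
  obtain ⟨i, -, rfl⟩ := Finset.mem_map.1 hv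
  exact Finset.mem_range.2 i.isLt

theorem isMinTransversal_iff_exists_mem_leaves {ι α : Type*} [LinearOrder α] {s : Finset ι}
    {E : ι → Finset α} {lv : ι → ℕ} {cand : ℕ → Finset α} {V T : Finset α}
    (hlayer : IsLayering k s E lv) (hlt : ∀ c ∈ s, lv c < n) (hV : s.biUnion E ⊆ V)
    (hcand : Set.SurjOn cand (Set.Iio M) (smallSubsets k V)) :
    IsMinTransversal s E T ↔
      ∃ st ∈ leaves M (IsCandChild s E lv cand) n [], chosen cand st = T := by
  have hall : layersBelow s lv n = s := Finset.filter_true_of_mem hlt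
  constructor
  · intro hT
    obtain ⟨st, hnode, hlen, heq⟩ :=
      IsMinTransversal.exists_isNode hlayer hcand hV (hall.symm ▸ hT)
    exact ⟨st, mem_leaves.2 ⟨hnode, hlen⟩, heq⟩
  · rintro ⟨st, hst, rfl⟩
    obtain ⟨hnode, rfl⟩ := mem_leaves.1 hst
    exact hall ▸ hnode.isMinTransversal

theorem lists_leaves (hL : Lists L φ) (hψ : ∀ T, T ∈ ψ ↔ IsMinTransversal φ id T)
    (hlayer : IsLayering k (Finset.range L.length) (listedEdge L) lv)
    (hlt : ∀ c ∈ Finset.range L.length, lv c < n)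
    (hcand : Set.BijOn cand (Set.Iio M) (smallSubsets k (Finset.range n))) :
    Lists ((leaves M (IsCandChild (Finset.range L.length) (listedEdge L) lv cand) n []).map
      fun st => (List.finRange n).filter fun v => v.val ∈ chosen cand st) ψ := by
  have hiff (T : Finset ℕ) := isMinTransversal_iff_exists_mem_leaves (T := T) hlayer hlt
    biUnion_listedEdge_subset hcand.surjOn
  set child := IsCandChild (Finset.range L.length) (listedEdge L) lv cand
  have hmap : ∀ st ∈ leaves M child n [], ((List.finRange n).filter
      fun v => v.val ∈ chosen cand st).toFinset.map Fin.valEmbedding = chosen cand st :=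
    fun st hst => map_toFinset_filter_finRange
      (((hiff _).2 ⟨st, hst, rfl⟩).subset_biUnion.trans biUnion_listedEdge_subset)
  refine ⟨fun l hl => ?_, ?_, ?_⟩
  · obtain ⟨st, -, rfl⟩ := List.mem_map.1 hl
    exact (List.nodup_finRange n).filter _
  · rw [List.map_map]
    refine (nodup_leaves (st := []) trivial).map_on fun st hst st' hst' heq => ?_
    obtain ⟨hnode, hlen⟩ := mem_leaves.1 hst
    obtain ⟨hnode', hlen'⟩ := mem_leaves.1 hst'
    refine hnode.eq_of_chosen_eq hcand.injOn hnode' (hlen.trans hlen'.symm) ?_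
    rw [← hmap st hst, ← hmap st' hst']
    exact congrArg _ heq
  · ext T
    simp only [List.map_map, List.mem_toFinset, List.mem_map, Function.comp_apply, hψ,
      ← hL.isMinTransversal_iff, hiff]
    refine exists_congr fun st => and_congr_right fun hst => ?_
    rw [← (Finset.map_injective Fin.valEmbedding).eq_iff, hmap st hst]

end Listing

/-- The time that suffices for `prepare`, where `a` is `n` or `1`, whichever is larger. -/
def prepareTime (k n m N a : ℕ) : ℕ :=
  (m * 3 + n * (n * 7 + N * 8 + 12) + 5) + (n * ((k + 1) * a ^ k * 7 + 5) + 4 +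
    (n * (seekTime k n m N ((k + 1) * a ^ k) + 2) + 1))

section Bounds

variable {k n m N M a b : ℕ} {φ : MonotoneCNF n} {L : List (List (Fin n))}

theorem AllOccur.le_length (h : AllOccur φ) : n ≤ length φ := by
  have hcover : (Finset.univ : Finset (Fin n)) ⊆ φ.biUnion id := fun v _ => by
    obtain ⟨c, hc, hv⟩ := h v
    exact Finset.mem_biUnion.2 ⟨c, hc, hv⟩
  calc n = (Finset.univ : Finset (Fin n)).card := by simp
    _ ≤ (φ.biUnion id).card := Finset.card_le_card hcover
    _ ≤ length φ := Finset.card_biUnion_le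

theorem Lists.length_le (hL : Lists L φ) : L.length ≤ length φ + 1 := by
  calc L.length = φ.card := by
        rw [← hL.2.2, List.toFinset_card_of_nodup hL.2.1, List.length_map]
    _ ≤ (φ.erase ∅).card + 1 := Nat.sub_le_iff_le_add.1 Finset.pred_card_le_card_erase
    _ ≤ ∑ c ∈ φ.erase ∅, c.card + 1 := by
        rw [Finset.card_eq_sum_ones, Nat.add_le_add_iff_right]
        exact Finset.sum_le_sum fun c hc =>
          Finset.card_pos.2 (Finset.nonempty_iff_ne_empty.2 (Finset.ne_of_mem_erase hc))
    _ ≤ length φ + 1 :=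
        Nat.add_le_add_right (Finset.sum_le_sum_of_subset (Finset.erase_subset ..)) 1

theorem AllOccur.max_mul_max_pow_le (h : AllOccur φ) :
    max 1 (length φ) * max 1 n ^ (k + 1) ≤ length φ * n ^ (k + 1) + 1 := by
  obtain rfl | hn := Nat.eq_zero_or_pos n
  · have hlen : length φ = 0 := Finset.sum_eq_zero fun c _ => by
      rw [Finset.eq_empty_of_isEmpty c, Finset.card_empty]
    simp [hlen]
  · rw [max_eq_right (le_trans hn h.le_length), max_eq_right hn]
    exact Nat.le_succ _

theorem le_mul_pow_succ (hab : a ≤ b) : a ≤ b * a ^ (k + 1) := by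
  obtain rfl | ha := Nat.eq_zero_or_pos a
  · exact Nat.zero_le _
  · exact (Nat.le_self_pow (Nat.succ_ne_zero k) a).trans
      (Nat.le_mul_of_pos_left _ (lt_of_lt_of_le ha hab))

theorem mul_seekTime_le (ha : 1 ≤ a) (hab : a ≤ b) (hn : n ≤ a) (hm : m ≤ 2 * b) (hN : N ≤ b) :
    n * (seekTime k n m N ((k + 1) * a ^ k) + 3) ≤
      ((k + 1) * (4 * k + 118) + 5) * (b * a ^ (k + 1)) := by
  have htest : n * (k * 4 + 21) + m * 21 + N * 12 + 43 ≤ b * (4 * k + 118) := by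
    have := Nat.mul_le_mul_right (k * 4 + 21) (hn.trans hab)
    linarith
  calc n * (seekTime k n m N ((k + 1) * a ^ k) + 3)
      ≤ a * ((k + 1) * a ^ k * (b * (4 * k + 118)) + 2 + 3) := by
        unfold seekTime
        gcongr
    _ = (k + 1) * (4 * k + 118) * (b * a ^ (k + 1)) + 5 * a := by ring
    _ ≤ ((k + 1) * (4 * k + 118) + 5) * (b * a ^ (k + 1)) := by
        linarith [le_mul_pow_succ (k := k) hab]

theorem prepareTime_le (ha : 1 ≤ a) (hab : a ≤ b) (hn : n ≤ a) (hm : m ≤ 2 * b) (hN : N ≤ b) :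
    prepareTime k n m N a ≤ ((k + 1) * (4 * k + 125) + 55) * (b * a ^ (k + 1)) := by
  have hseek := mul_seekTime_le (k := k) ha hab hn hm hN
  have hba : b * a ≤ b * a ^ (k + 1) := by gcongr; exact Nat.le_self_pow (Nat.succ_ne_zero k) a
  have hnn : n * n ≤ b * a := Nat.mul_le_mul (hn.trans hab) hn
  have hnN : n * N ≤ b * a := by rw [mul_comm]; exact Nat.mul_le_mul hN hn
  have htable : n * ((k + 1) * a ^ k * 7) ≤ (k + 1) * 7 * (b * a ^ (k + 1)) := by
    calc n * ((k + 1) * a ^ k * 7) ≤ a * ((k + 1) * a ^ k * 7) := by gcongr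
      _ = (k + 1) * 7 * (1 * a ^ (k + 1)) := by ring
      _ ≤ (k + 1) * 7 * (b * a ^ (k + 1)) := by gcongr; exact ha.trans hab
  have hb : b ≤ b * a := Nat.le_mul_of_pos_right _ ha
  unfold prepareTime
  linarith

theorem first_delay_le (ha : 1 ≤ a) (hab : a ≤ b) (hn : n ≤ a) (hm : m ≤ 2 * b) (hN : N ≤ b) :
    m * (n * 6 + 8) + 3 + 1 + prepareTime k n m N a + (n * (k * 3 + 11) + 8) ≤
      8 * (k + 1) * (k + 34) * (b * a ^ (k + 1)) := by
  have hprepare := prepareTime_le (k := k) ha hab hn hm hN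
  have hX := le_mul_pow_succ (k := k) hab
  have hba : b * a ≤ b * a ^ (k + 1) := by gcongr; exact Nat.le_self_pow (Nat.succ_ne_zero k) a
  have hmn : m * (n * 6 + 8) ≤ 28 * (b * a) := by
    calc m * (n * 6 + 8) ≤ 2 * b * (a * 6 + 8 * a) := by gcongr; omega
      _ = 28 * (b * a) := by ring
  have hnk : n * (k * 3 + 11) ≤ (b * a ^ (k + 1)) * (k * 3 + 11) := by gcongr; exact hn.trans hX
  have hsq : 0 ≤ k * k * (b * a ^ (k + 1)) := Nat.zero_le _
  have hlin : 0 ≤ k * (b * a ^ (k + 1)) := Nat.zero_le _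
  linarith

theorem next_delay_le (ha : 1 ≤ a) (hab : a ≤ b) (hn : n ≤ a) (hm : m ≤ 2 * b) (hN : N ≤ b) :
    n * (k * 3 + 11) + n * (seekTime k n m N ((k + 1) * a ^ k) + 3) * 2 + 12 ≤
      8 * (k + 1) * (k + 34) * (b * a ^ (k + 1)) := by
  have hseek := mul_seekTime_le (k := k) ha hab hn hm hN
  have hX := le_mul_pow_succ (k := k) hab
  have hnk : n * (k * 3 + 11) ≤ (b * a ^ (k + 1)) * (k * 3 + 11) := by gcongr; exact hn.trans hX
  have hlin : 0 ≤ k * (b * a ^ (k + 1)) := Nat.zero_le _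
  linarith

end Bounds

section Dualize

variable {k n m N : ℕ} {E : ℕ → Finset ℕ} {φ ψ : MonotoneCNF n} {L : List (List (Fin n))}
  {σ : Memory}

theorem exec_parse_input (hL : Lists L φ) :
    Exec parse (initial (encode L)) (L.length * (n * 6 + 8) + 3) [] fun σ =>
      Input n L.length (length φ) (listedEdge L) σ ∧ (σ Arr.hasEmpty 0 = 0 ↔ ∅ ∉ φ) ∧
        σ Arr.done 0 = 0 := by
  refine (exec_parse hL.1).mono le_rfl fun σ ⟨hlits, hempty⟩ hf => ⟨?_, ?_, ?_⟩
  · rw [← hL.sum_length, ← length_occurrences]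
    refine input_of_storedLits_eq hL.1 hlits ?_ ?_ <;> rw [hf Arr.input rfl] <;> rfl
  · rw [hempty, ← hL.2.2]
    simp
  · rw [hf Arr.done rfl]
    rfl

theorem exec_prepare (h : Input n m N E σ) (hdeg : IsDegenerateFamily k (Finset.range m) E)
    (hE : ∀ c ∈ Finset.range m, (E c).Nonempty) :
    Exec (prepare k) σ (prepareTime k n m N (max 1 n)) [] fun σ' =>
      ∃ M cand lv leaf, (∀ c ∈ Finset.range m, lv c < n) ∧ AtNode k n m N M E lv cand leaf σ' ∧
        leaf.length = n ∧ remainingLeaves M (IsCandChild (Finset.range m) E lv cand) n leaf =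
          leaves M (IsCandChild (Finset.range m) E lv cand) n [] := by
  refine (exec_findLayers h hdeg).seq fun σ₁ ⟨hdepth, hlayer⟩ hf₁ =>
    (exec_makeTable (h.of_frame hf₁).numVars_eq).seq fun σ₂ ⟨M, cand, hT⟩ hf₂ => ?_
  have hroot : AtNode k n m N M E (σ₁ Arr.layer) cand [] σ₂ := by
    refine ⟨⟨(h.of_frame hf₁).of_frame hf₂, hlayer.isLayering hE, fun c _ => ?_, hT.table,
      hT.tableSize_eq, hT.bijOn⟩, trivial, ?_, Nat.zero_le n⟩
    · rw [hf₂ Arr.layer rfl]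
    · rw [hf₂ Arr.depth rfl, hdepth, path]
  have hM : M ≤ (k + 1) * max 1 n ^ k := le_of_bijOn_smallSubsets hT.bijOn (by simp)
  refine (exec_descend hroot).mono ?_ fun σ₃ ⟨leaf, hleaf, hlen, hrem⟩ _ =>
    ⟨M, cand, σ₁ Arr.layer, leaf, hlayer.lt hE, hleaf, hlen, ?_⟩
  · unfold seekTime
    gcongr
  · simpa [remainingLeaves, laterLeaves] using hrem

theorem enumerates_prepare_enumerate {s D : ℕ} (hL : Lists L φ)
    (hψ : ∀ T, T ∈ ψ ↔ IsMinTransversal φ id T) (hdeg : IsDegenerate k φ) (hφ : ∅ ∉ φ)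
    (h : Input n L.length (length φ) (listedEdge L) σ) (hdone : σ Arr.done 0 = 0)
    (hD : s + prepareTime k n L.length (length φ) (max 1 n) + (n * (k * 3 + 11) + 8) ≤ D)
    (hD' : n * (k * 3 + 11) +
      n * (seekTime k n L.length (length φ) ((k + 1) * max 1 n ^ k) + 3) * 2 + 12 ≤ D) :
    ∃ out, Lists out ψ ∧ Enumerates (prepare k ;; enumerate) σ s D (out.map (·.map Fin.val)) := by
  have hne : ∀ c ∈ φ, c.Nonempty := fun c hc =>
    Finset.nonempty_iff_ne_empty.2 (ne_of_mem_of_not_mem hc hφ)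
  have hE : ∀ c ∈ Finset.range L.length, (listedEdge L c).Nonempty := fun c hc =>
    (hne _ (hL.image_listedClause ▸ Finset.mem_image_of_mem _ hc)).map
  obtain ⟨σ₁, ⟨M, cand, lv, leaf, hlt, hleaf, hlen, hrem⟩, hexec⟩ :=
    (exec_prepare h (hL.isDegenerateFamily (hdeg.isDegenerateFamily hne)) hE).exists_eq
  refine ⟨_, lists_leaves hL hψ hleaf.data.isLayering hlt hleaf.data.bijOn,
    Enumerates.seq hexec fun σ₂ hσ hf => ?_⟩
  obtain rfl : σ₂ = σ₁ := hσ
  have hM : M ≤ (k + 1) * max 1 n ^ k := le_of_bijOn_smallSubsets hleaf.data.bijOn (by simp)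
  have hseek : seekTime k n L.length (length φ) M ≤
      seekTime k n L.length (length φ) ((k + 1) * max 1 n ^ k) := by
    unfold seekTime
    gcongr
  simp only [List.map_map, Function.comp_def, map_val_filter_finRange]
  refine enumerates_enumerate hleaf hlen ((congrFun (hf Arr.done rfl) 0).trans hdone) hD
    (le_trans ?_ hD') hrem
  gcongr

theorem IsTransversal.empty_notMem {T : Finset (Fin n)} (h : IsTransversal φ id T) : ∅ ∉ φ :=
  fun hφ => by simpa using h ∅ hφ

theorem enumerates_dualize {D : ℕ} (hL : Lists L φ)
    (hψ : ∀ T, T ∈ ψ ↔ IsMinTransversal φ id T) (hdeg : IsDegenerate k φ)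
    (hD : L.length * (n * 6 + 8) + 3 + 1 + prepareTime k n L.length (length φ) (max 1 n) +
      (n * (k * 3 + 11) + 8) ≤ D)
    (hD' : n * (k * 3 + 11) +
      n * (seekTime k n L.length (length φ) ((k + 1) * max 1 n ^ k) + 3) * 2 + 12 ≤ D) :
    ∃ out, Lists out ψ ∧
      Enumerates (dualize k) (initial (encode L)) 0 D (out.map (·.map Fin.val)) := by
  obtain ⟨σ₁, ⟨hin, hempty, hdone⟩, hparse⟩ := (exec_parse_input hL).exists_eq
  have htest : (Test.eq (scal Arr.hasEmpty) (.const 0)).eval σ₁ = decide (σ₁ Arr.hasEmpty 0 = 0) :=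
    rfl
  by_cases hφ : ∅ ∈ φ
  · have hψ₀ : ψ = ∅ := Finset.eq_empty_of_forall_notMem fun T hT =>
      ((hψ T).1 hT).isTransversal.empty_notMem hφ
    refine ⟨[], ⟨by simp, by simp, by simp [hψ₀]⟩, Enumerates.seq hparse fun σ₂ hσ _ => ?_⟩
    obtain rfl : σ₂ = σ₁ := hσ
    refine .ite (fun hb => ?_) fun _ => .of_exec (.skip trivial (Q := fun _ => True)) (by omega)
    exact absurd hφ (hempty.1 (of_decide_eq_true (htest ▸ hb)))
  · obtain ⟨out, hout, henum⟩ := enumerates_prepare_enumerate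
      (s := 0 + (L.length * (n * 6 + 8) + 3) + 1) hL hψ hdeg hφ hin hdone (by omega) hD'
    refine ⟨out, hout, Enumerates.seq hparse fun σ₂ hσ _ => ?_⟩
    obtain rfl : σ₂ = σ₁ := hσ
    refine .ite (fun _ => henum) fun hb => ?_
    exact absurd (hempty.2 hφ) (of_decide_eq_false (htest ▸ hb))

theorem dualizesWithDelay_dualize (hocc : AllOccur φ) (hdeg : IsDegenerate k φ) :
    DualizesWithDelay (dualize k) φ (8 * (k + 1) * (k + 34) * (length φ * n ^ (k + 1) + 1)) := by
  classical
  intro L hL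
  let ψ : MonotoneCNF n := Finset.univ.filter (IsMinTransversal φ id)
  have hψ (T) : T ∈ ψ ↔ IsMinTransversal φ id T := by simp [ψ]
  have hbound := Nat.mul_le_mul_left (8 * (k + 1) * (k + 34)) (hocc.max_mul_max_pow_le (k := k))
  have hab : max 1 n ≤ max 1 (length φ) := max_le_max_left 1 hocc.le_length
  have hm : L.length ≤ 2 * max 1 (length φ) := by have := hL.length_le; omega
  have hfirst := (first_delay_le (k := k) (le_max_left 1 n) hab (le_max_right 1 n) hm
    (le_max_right 1 (length φ))).trans hbound
  have hnext := (next_delay_le (k := k) (le_max_left 1 n) hab (le_max_right 1 n) hm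
    (le_max_right 1 (length φ))).trans hbound
  obtain ⟨out, hout, σ, tr, hrun, hdelay⟩ := enumerates_dualize hL hψ hdeg hfirst hnext
  exact ⟨σ, tr, ψ, out, hrun, isPrimeCNFOf_dual hψ, hout,
    hdelay [] List.not_mem_nil rfl (Nat.zero_le 0)⟩

end Dualize

end Dualization

theorem mainTheorem7_general (k : ℕ) :
    ∃ (p : Dualization.Program) (C : ℕ), ∀ (n : ℕ) (φ : Dualization.MonotoneCNF n),
      Dualization.AllOccur φ → Dualization.IsDegenerate k φ →
        Dualization.DualizesWithDelay p φ (C * (Dualization.length φ * n ^ (k + 1) + 1)) :=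
  ⟨Dualization.dualize k, 8 * (k + 1) * (k + 34),
    fun _ _ => Dualization.dualizesWithDelay_dualize⟩

/-- For every constant `k ≥ 1` there is a program that solves Dualization for all `k`-degenerate
prime monotone CNFs with delay `O(‖φ‖ · n ^ (k + 1))`, where `n` is the number of variables of `φ`.
The summand `1` matters only for the constant CNFs (`n = 0`). -/
theorem mainTheorem7 (k : ℕ) (hk : 1 ≤ k) :
    ∃ (p : Dualization.Program) (C : ℕ),
      ∀ (n : ℕ) (φ : Dualization.MonotoneCNF n),
        Dualization.IsPrime φ → Dualization.AllOccur φ → Dualization.IsDegenerate k φ →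
          Dualization.DualizesWithDelay p φ
            (C * (Dualization.length φ * n ^ (k + 1) + 1)) :=
  let ⟨p, C, h⟩ := mainTheorem7_general k
  ⟨p, C, fun n φ _ => h n φ⟩
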